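/- **Setting.** Let $\delta\in\mathbb R$, $q_0>0$, $q_-\in\mathbb C$ with $|q_-|=q_0$. Put $k(z)=\frac12\left(z-\frac{q_0^2}{z}\right)$, $\lambda(z)=\frac12\left(z+\frac{q_0^2}{z}\right)$, $$\theta(x,t;z)=\lambda\left[x+\left(32\delta k^5-16\delta q_0^2k^3+12\delta q_0^4k+k\right)t\right],$$ $D^{\pm}=\{z:\pm(|z|^2-q_0^2)\,\mathrm{Im}\,z>0\}$, $\Sigma=\mathbb R\cup\{|z|=q_0\}$, $\sigma_3=\mathrm{diag}(1,-1)$, $Q_\pm=\begin{pmatrix}0&iq_\pm^*\\ iq_\pm&0\end{pmatrix}$, $Y_\pm(z)=I+\frac iz\sigma_3Q_\pm$. Let $z_1,\dots,z_N\in D^+\cap\{\mathrm{Im}\,z>0\}$ be distinct and $C_1,\dots,C_N\in\mathbb C\setminus\{0\}$ ($N\ge 0$). For $n\le N$ put $\xi_n=z_n$, $\xi_{N+n}=-q_0^2/z_n^*$, $C_{N+n}=\frac{q_-}{q_-^*}\left(\frac{q_0}{z_n^*}\right)^2C_n^*$; for $n\le 2N$ put $\tilde C_n=-C_n^*$. Put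 $q_+=q_-\prod_{n=1}^N(z_n/z_n^*)^2$. *Riemann–Hilbert problem.* For a function $\rho$ on $\Sigma$ and fixed $(x,t)$, find a $2\times2$ matrix $\Phi(z)=M(x,t;z)$, analytic off $\Sigma\cup\{\xi_n,\xi_n^*\}$, with continuous limits $\Phi^\pm$ from $D^\pm$ on $\Sigma\setminus\{0\}$ satisfying $\Phi^-=\Phi^+(I-G)$, $$G=\begin{pmatrix}0&-\tilde\rho\, e^{2i\theta}\\ \rho\, e^{-2i\theta}&\rho\tilde\rho\end{pmatrix},\qquad \tilde\rho(z)=-\rho(z^*)^*,$$ with $\Phi=I+O(1/z)$ as $z\to\infty$ and $\Phi=\frac iz\sigma_3Q_-+O(1)$ as $z\to0$, with at most simple poles and $$\mathop{\mathrm{Res}}_{z=\xi_n}\Phi=\left(C_ne^{-2i\theta(\xi_n)}\Phi_2(\xi_n),\,0\right),\qquad \mathop{\mathrm{Res}}_{z=\xi_n^*}\Phi=\left(0,\,\tilde C_ne^{2i\theta(\xi_n^*)}\Phi_1(\xi_n^*)\right),$$ where $\Phi_1,\Phi_2$ are the columns of $\Phi$. (In terms of the Jost functions $\mu_\pm$ and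 the scattering matrix $S=(s_{ij})$ of a potential, $\Phi=(\mu_{+,1}/s_{11},\mu_{-,2})$ on $D^+$ and $\Phi=(\mu_{-,1},\mu_{+,2}/s_{22})$ on $D^-$; in particular $\Phi_{22}(\xi_n)=\mu_{-,22}(\xi_n)$.) *Matrices.* For $1\le n,j\le 2N$ let $$c_j(z)=\frac{C_j}{z-\xi_j}e^{-2i\theta(x,t;\xi_j)},\quad A_{nj}=\sum_{k=1}^{2N}c_k(\xi_n^*)^*\,c_j(\xi_k^*),\quad B_n=1-\sum_{k=1}^{2N}c_k(\xi_n^*)^*\frac{q_-}{\xi_k^*},\quad Y_n=C_ne^{-2i\theta(x,t;\xi_n)},$$ $$M=I+A,\qquad M^{\rm aug}=\begin{pmatrix}0&Y^T\\ B&M\end{pmatrix},\qquad M_n^{\rm ext}=M\text{ with its }n\text{-th column replaced by }B.$$ **Theorem.** 1. $\det M\ne0$ for all $(x,t)\in\mathbb R^2$. 2. If $\rho\equiv0$ on $\Sigma$, then for every $(x,t)$ and every solution $\Phi$ of the Riemann–Hilbert problem, the vector $X_n=\Phi_{22}(\xi_n)$ $(1\le n\le 2N)$ satisfies $(I+A)X=B$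 and $X_n=\det M_n^{\rm ext}/\det M$, and the potential recovered from $\Phi$ is $$q(x,t)=\lim_{z\to\infty,\ z\notin\Sigma}z\,\Phi_{21}(z)=q_--\frac{\det M^{\rm aug}}{\det M}.$$ 3. The function $q=q_--\det M^{\rm aug}/\det M$ is $C^\infty$ on $\mathbb R^2$ and solves $$iq_t+\tfrac12q_{xx}+q(|q|^2-q_0^2)+\delta\left(\mathcal K[q]-20q_0^6q\right)=0,$$ $$\begin{aligned}\mathcal K[q]={}&q_{xxxxxx}+\left[60q^*|q_x|^2+50(q^*)^2q_{xx}+2q^*_{xxxx}\right]q^2+q\left[12q^*q_{xxxx}+8q_xq^*_{xxx}+22|q_{xx}|^2\right]\\&+q\left[18q_{xxx}q_x^*+70(q^*)^2q_x^2\right]+20q_x^2q^*_{xx}+10q_x\left[5q_{xx}q_x^*+3q^*q_{xxx}\right]+20q^*q_{xx}^2\\&+10q^3\left[(q_x^*)^2+2q^*q^*_{xx}\right]+20q|q|^6,\end{aligned}$$ with $q(x,t)\to q_\pm$ as $x\to\pm\infty$ for every $t$, and $|q_\pm|=q_0$. Equivalently, $u=q\,e^{i(q_0^2+20\delta q_0^6)t}$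 solves the sextic nonlinear Schrödinger equation $iu_t+\frac12(u_{xx}+2|u|^2u)+\delta\,\mathcal K[u]=0$ with $u\to q_\pm e^{i(q_0^2+20\delta q_0^6)t}$ as $x\to\pm\infty$. 4. This $q$ is a reflectionless potential with the given discrete data, as follows. There are Jost matrices $\mu_\pm(x,t;z)$: for $z\ne0$, the columns $\mu_{-,1},\mu_{+,2}$ are defined on $D^-\cup\Sigma$ and $\mu_{-,2},\mu_{+,1}$ on $D^+\cup\Sigma$, the columns of $\psi_\pm=\mu_\pm e^{i\theta\sigma_3}$ solve $\psi_x=\left(ik\sigma_3+\begin{pmatrix}0&iq^*\\ iq&0\end{pmatrix}\right)\psi$, and those of $\mu_\pm$ tend to those of $Y_\pm$ as $x\to\pm\infty$. There is a matrix $S(z)$, independent of $x,t$, with $\mu_+=\mu_-e^{i\theta\sigma_3}Se^{-i\theta\sigma_3}$ on $\Sigma\setminus\{0\}$, and with $(1+q_0^2/z^2)s_{11}=\det(\mu_{+,1},\mu_{-,2})$ on $(D^+\cup\Sigma)\setminus\{0\}$ and $(1+q_0^2/z^2)s_{22}=\det(\mu_{-,1},\mu_{+,2})$ on $(D^-\cup\Sigma)\setminus\{0\}$.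 On $\Sigma\setminus\{0\}$, $s_{11},s_{22}\ne0$ and $\rho=s_{21}/s_{11}=0$, $\tilde\rho=s_{12}/s_{22}=0$. The functions $s_{11}$ and $s_{22}$ are analytic in $D^+$ and $D^-$, and their zeros there are exactly the $\xi_n$ and the $\xi_n^*$ respectively, all simple. The norming constants are the prescribed ones: $\mu_{+,1}(\xi_n)=b_ne^{-2i\theta(\xi_n)}\mu_{-,2}(\xi_n)$ with $C_n=b_n/s_{11}'(\xi_n)$ and $\mu_{+,2}(\xi_n^*)=\tilde b_ne^{2i\theta(\xi_n^*)}\mu_{-,1}(\xi_n^*)$ with $\tilde C_n=\tilde b_n/s_{22}'(\xi_n^*)$, where $b_n,\tilde b_n$ do not depend on $x,t$. For every $(x,t)$ the matrix $M(x,t;z)$ assembled from $\mu_\pm,s_{11},s_{22}$ as above solves the Riemann–Hilbert problem, and the values $X_n=\mu_{-,22}(x,t;\xi_n)$ satisfy $(I+A)X=B$. -/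

import Mathlib

open Filter Topology
open scoped ComplexConjugate ContDiff

namespace SNLS

/-! ### The sextic NLS equation -/

/-- The `n`-th derivative of `q` in the space variable. -/
noncomputable def dx (n : ℕ) (q : ℝ → ℝ → ℂ) (x t : ℝ) : ℂ :=
  iteratedDeriv n (fun y => q y t) x

/-- The sextic part of the equation (the coefficient of `δ`); `p ^ 4 * r ^ 3` is `q |q|^6`. -/
noncomputable def sexticTerm (q : ℝ → ℝ → ℂ) (x t : ℝ) : ℂ :=
  let p := q x t
  let p1 := dx 1 q x t
  let p2 := dx 2 q x t
  let p3 := dx 3 q x t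
  let p4 := dx 4 q x t
  let p6 := dx 6 q x t
  let r := conj p
  let r1 := conj p1
  let r2 := conj p2
  let r3 := conj p3
  let r4 := conj p4
  p6 + (60 * r * (p1 * r1) + 50 * r ^ 2 * p2 + 2 * r4) * p ^ 2
    + p * (12 * r * p4 + 8 * p1 * r3 + 22 * (p2 * r2))
    + p * (18 * p3 * r1 + 70 * r ^ 2 * p1 ^ 2)
    + 20 * p1 ^ 2 * r2
    + 10 * p1 * (5 * p2 * r1 + 3 * r * p3)
    + 20 * r * p2 ^ 2
    + 10 * p ^ 3 * (r1 ^ 2 + 2 * r * r2)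
    + 20 * (p ^ 4 * r ^ 3)

/-- The sNLS equation
`i q_t + (1/2)(q_xx + 2 |q|^2 q) + δ (sextic part) = 0`. -/
def SolvesSNLS (δ : ℝ) (q : ℝ → ℝ → ℂ) : Prop :=
  ∀ x t : ℝ, Complex.I * deriv (fun s => q x s) t
    + (1 / 2) * (dx 2 q x t + 2 * (q x t * conj (q x t)) * q x t)
    + δ * sexticTerm q x t = 0

/-- The sNLS equation in the gauge in which the boundary values do not depend on `t`:
`i q_t + (1/2) q_xx + q (|q|^2 - q₀^2) + δ (sextic part) - 20 δ q₀^6 q = 0`. -/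
def SolvesGaugedSNLS (δ q₀ : ℝ) (q : ℝ → ℝ → ℂ) : Prop :=
  ∀ x t : ℝ, Complex.I * deriv (fun s => q x s) t
    + (1 / 2) * dx 2 q x t + q x t * (q x t * conj (q x t) - (q₀ : ℂ) ^ 2)
    + δ * (sexticTerm q x t - 20 * (q₀ : ℂ) ^ 6 * q x t) = 0

/-! ### The uniformization variable -/

noncomputable def kz (q₀ : ℝ) (z : ℂ) : ℂ := (z - (q₀ : ℂ) ^ 2 / z) / 2

noncomputable def lam (q₀ : ℝ) (z : ℂ) : ℂ := (z + (q₀ : ℂ) ^ 2 / z) / 2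

/-- The phase `θ(x,t;z) = λ [x + (32 δ k^5 - 16 δ q₀^2 k^3 + 12 δ q₀^4 k + k) t]`. -/
noncomputable def theta (δ q₀ x t : ℝ) (z : ℂ) : ℂ :=
  lam q₀ z * (x + (32 * δ * kz q₀ z ^ 5 - 16 * δ * (q₀ : ℂ) ^ 2 * kz q₀ z ^ 3
    + 12 * δ * (q₀ : ℂ) ^ 4 * kz q₀ z + kz q₀ z) * t)

def Dplus (q₀ : ℝ) : Set ℂ := {z | 0 < (‖z‖ ^ 2 - q₀ ^ 2) * z.im}

def Dminus (q₀ : ℝ) : Set ℂ := {z | (‖z‖ ^ 2 - q₀ ^ 2) * z.im < 0}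

/-- The contour `Σ`: the real line together with the circle `|z| = q₀`. -/
def contour (q₀ : ℝ) : Set ℂ := {z | z.im = 0 ∨ ‖z‖ = q₀}

/-! ### Discrete scattering data and the explicit matrices -/

/-- The boundary value `q₋` with `|q₋| = q₀ ≠ 0`, the distinct discrete eigenvalues `z_n` in
`D⁺ ∩ {Im z > 0}` (that is `|z_n| > q₀`, `Im z_n > 0`), and their nonzero norming constants. -/
structure DiscreteData (N : ℕ) where
  q₀ : ℝ
  qm : ℂ
  ev : Fin N → ℂ
  nc : Fin N → ℂ
  q₀_pos : 0 < q₀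
  norm_qm : ‖qm‖ = q₀
  ev_injective : Function.Injective ev
  ev_mem : ∀ n, ev n ∈ Dplus q₀
  ev_im : ∀ n, 0 < (ev n).im
  nc_ne_zero : ∀ n, nc n ≠ 0

namespace DiscreteData

variable {N : ℕ} (D : DiscreteData N)

/-- `ξ_n = z_n` and `ξ_{N+n} = -q₀^2 / z_n^*`: the `2N` eigenvalues in `D⁺`. The index set
`{1, …, 2N}` is `Fin N ⊕ Fin N`. -/
noncomputable def xi : Fin N ⊕ Fin N → ℂ :=
  Sum.elim D.ev (fun n => -(D.q₀ : ℂ) ^ 2 / conj (D.ev n))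

/-- `C_n`, and `C_{N+n} = -(q₋ / q₋^*) (q₀ / z_n^*)^2 C̃_n` with `C̃_n = -C_n^*`. -/
noncomputable def C : Fin N ⊕ Fin N → ℂ :=
  Sum.elim D.nc
    (fun n => -(D.qm / conj D.qm) * ((D.q₀ : ℂ) / conj (D.ev n)) ^ 2 * -conj (D.nc n))

noncomputable def Ctilde (n : Fin N ⊕ Fin N) : ℂ := -conj (D.C n)

/-- The boundary value at `x → +∞`. -/
noncomputable def qp : ℂ := D.qm * ∏ n, (D.ev n / conj (D.ev n)) ^ 2

/-- `c_j(z) = C_j e^{-2iθ(ξ_j)} / (z - ξ_j)`. -/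
noncomputable def c (δ x t : ℝ) (j : Fin N ⊕ Fin N) (z : ℂ) : ℂ :=
  D.C j / (z - D.xi j) * Complex.exp (-2 * Complex.I * theta δ D.q₀ x t (D.xi j))

noncomputable def A (δ x t : ℝ) : Matrix (Fin N ⊕ Fin N) (Fin N ⊕ Fin N) ℂ :=
  fun n j => ∑ k, conj (D.c δ x t k (conj (D.xi n))) * D.c δ x t j (conj (D.xi k))

noncomputable def B (δ x t : ℝ) : Fin N ⊕ Fin N → ℂ :=
  fun n => 1 - ∑ k, conj (D.c δ x t k (conj (D.xi n))) * (D.qm / conj (D.xi k))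

noncomputable def M (δ x t : ℝ) : Matrix (Fin N ⊕ Fin N) (Fin N ⊕ Fin N) ℂ := 1 + D.A δ x t

noncomputable def Y (δ x t : ℝ) : Fin N ⊕ Fin N → ℂ :=
  fun n => D.C n * Complex.exp (-2 * Complex.I * theta δ D.q₀ x t (D.xi n))

/-- `M` with its `n`-th column replaced by `B`. -/
noncomputable def Mext (δ x t : ℝ) (n : Fin N ⊕ Fin N) :
    Matrix (Fin N ⊕ Fin N) (Fin N ⊕ Fin N) ℂ :=
  (D.M δ x t).updateCol n (D.B δ x t)

/-- The bordered matrix `[[0, Yᵀ], [B, M]]`. -/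
noncomputable def Maug (δ x t : ℝ) :
    Matrix (Unit ⊕ (Fin N ⊕ Fin N)) (Unit ⊕ (Fin N ⊕ Fin N)) ℂ :=
  Matrix.fromBlocks 0 (Matrix.replicateRow Unit (D.Y δ x t))
    (Matrix.replicateCol Unit (D.B δ x t)) (D.M δ x t)

/-- `q(x,t) = q₋ - det M^aug / det M`. -/
noncomputable def potential (δ x t : ℝ) : ℂ :=
  D.qm - (D.Maug δ x t).det / (D.M δ x t).det

end DiscreteData

/-! ### The generalized Riemann–Hilbert problem -/

/-- `f` has at `a` at most a simple pole, with residue `r`. -/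
def HasSimplePole (f : ℂ → ℂ) (a r : ℂ) : Prop :=
  ∃ g : ℂ → ℂ, AnalyticAt ℂ g a ∧ ∀ᶠ z in 𝓝[≠] a, f z = r / (z - a) + g z

/-- The jump matrix `G`, with `ρ̃(z) = -ρ(z^*)^*`. -/
noncomputable def jump (δ q₀ : ℝ) (ρ : ℂ → ℂ) (x t : ℝ) (z : ℂ) : Matrix (Fin 2) (Fin 2) ℂ :=
  !![0, conj (ρ (conj z)) * Complex.exp (2 * Complex.I * theta δ q₀ x t z);
     ρ z * Complex.exp (-2 * Complex.I * theta δ q₀ x t z), -(ρ z * conj (ρ (conj z)))]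

/-- `(i / z) σ₃ Q₋`, the leading term at `z = 0`. -/
noncomputable def polePart (qm z : ℂ) : Matrix (Fin 2) (Fin 2) ℂ :=
  !![0, -conj qm / z; qm / z, 0]

/-- `Φ = M(x,t;·)` solves the generalized Riemann–Hilbert problem with reflection coefficient `ρ`,
simple poles at `ξ_n`, `ξ_n^*` and norming constants `C_n`. On `D⁺` the columns of `Φ` are
`μ₊,₁ / s₁₁` and `μ₋,₂`, on `D⁻` they are `μ₋,₁` and `μ₊,₂ / s₂₂`. -/
structure IsRHPSolution {N : ℕ} (D : DiscreteData N) (δ : ℝ) (ρ : ℂ → ℂ) (x t : ℝ)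
    (Φ : ℂ → Matrix (Fin 2) (Fin 2) ℂ) : Prop where
  analytic : ∀ z ∈ (contour D.q₀)ᶜ, (∀ n, z ≠ D.xi n) → (∀ n, z ≠ conj (D.xi n)) →
    ∀ i j, AnalyticAt ℂ (fun w => Φ w i j) z
  regular_plus : ∀ n i, AnalyticAt ℂ (fun w => Φ w i 1) (D.xi n)
  residue_plus : ∀ n i, HasSimplePole (fun w => Φ w i 0) (D.xi n)
    (D.C n * Complex.exp (-2 * Complex.I * theta δ D.q₀ x t (D.xi n)) * Φ (D.xi n) i 1)
  regular_minus : ∀ n i, AnalyticAt ℂ (fun w => Φ w i 0) (conj (D.xi n))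
  residue_minus : ∀ n i, HasSimplePole (fun w => Φ w i 1) (conj (D.xi n))
    (D.Ctilde n * Complex.exp (2 * Complex.I * theta δ D.q₀ x t (conj (D.xi n)))
      * Φ (conj (D.xi n)) i 0)
  jump_condition : ∀ s ∈ contour D.q₀, s ≠ 0 → ∃ P R : Matrix (Fin 2) (Fin 2) ℂ,
    Tendsto Φ (𝓝[Dplus D.q₀] s) (𝓝 P) ∧ Tendsto Φ (𝓝[Dminus D.q₀] s) (𝓝 R) ∧
    R = P * (1 - jump δ D.q₀ ρ x t s)
  at_infinity : ∀ i j,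
    (fun z => Φ z i j - (1 : Matrix (Fin 2) (Fin 2) ℂ) i j)
      =O[Bornology.cobounded ℂ ⊓ 𝓟 (contour D.q₀)ᶜ] (fun z => z⁻¹)
  at_zero : ∀ i j,
    (fun z => Φ z i j - polePart D.qm z i j) =O[𝓝[(contour D.q₀)ᶜ] 0] (fun _ => (1 : ℂ))

/-! ### Jost functions and scattering data of a potential -/

/-- `X = i k σ₃ + Q`, the space part of the Lax pair. -/
noncomputable def laxX (q : ℝ → ℝ → ℂ) (x t : ℝ) (k : ℂ) : Matrix (Fin 2) (Fin 2) ℂ :=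
  !![Complex.I * k, Complex.I * conj (q x t); Complex.I * q x t, -(Complex.I * k)]

/-- `Y_±(z) = I + (i / z) σ₃ Q_±` for the boundary value `qb = q_±`. -/
noncomputable def asympY (qb z : ℂ) : Matrix (Fin 2) (Fin 2) ℂ :=
  !![1, -conj qb / z; qb / z, 1]

/-- `ε_1 = 1`, `ε_2 = -1`: the exponents in `e^{iθσ₃}`. -/
def eps : Fin 2 → ℂ := ![1, -1]

/-- `v = μ_j(·,t;z)` is the `j`-th (modified) Jost column of `q` normalized at `x → l`
(`l = ±∞`): `ψ_j = μ_j e^{ε_j iθ}` satisfies `ψ_x = X ψ`, and `μ_j` tends to the `j`-th column of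
`Y`. -/
structure IsJostColumn (δ q₀ : ℝ) (q : ℝ → ℝ → ℂ) (qb : ℂ) (l : Filter ℝ) (t : ℝ) (z : ℂ)
    (j : Fin 2) (v : ℝ → Fin 2 → ℂ) : Prop where
  lax : ∀ x, HasDerivAt (fun y => Complex.exp (eps j * Complex.I * theta δ q₀ y t z) • v y)
    ((laxX q x t (kz q₀ z)).mulVec (Complex.exp (eps j * Complex.I * theta δ q₀ x t z) • v x)) x
  lim : Tendsto v l (𝓝 (fun i => asympY qb z i j))

/-- The matrix `M = (μ₊,₁ / s₁₁, μ₋,₂)` on `D⁺`, `(μ₋,₁, μ₊,₂ / s₂₂)` on `D⁻`. -/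
noncomputable def assembled (q₀ : ℝ) (μm μp : ℝ → ℝ → ℂ → Matrix (Fin 2) (Fin 2) ℂ)
    (S : ℂ → Matrix (Fin 2) (Fin 2) ℂ) (x t : ℝ) (z : ℂ) : Matrix (Fin 2) (Fin 2) ℂ :=
  open Classical in
  if z ∈ Dplus q₀ then
    !![μp x t z 0 0 / S z 0 0, μm x t z 0 1; μp x t z 1 0 / S z 0 0, μm x t z 1 1]
  else
    !![μm x t z 0 0, μp x t z 0 1 / S z 1 1; μm x t z 1 0, μp x t z 1 1 / S z 1 1]

noncomputable def reflection (S : ℂ → Matrix (Fin 2) (Fin 2) ℂ) (z : ℂ) : ℂ :=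
  S z 1 0 / S z 0 0

noncomputable def reflectionTilde (S : ℂ → Matrix (Fin 2) (Fin 2) ℂ) (z : ℂ) : ℂ :=
  S z 0 1 / S z 1 1

/-- The potential `q` has Jost matrices `μ₋`, `μ₊`, a scattering matrix `S` that depends on neither
`x` nor `t`, vanishing reflection coefficients, simple discrete eigenvalues exactly at `ξ_n` and
`ξ_n^*`, and norming constants `C_n = b_n / s₁₁'(ξ_n)`, `C̃_n = b̃_n / s₂₂'(ξ_n^*)`. -/
structure IsReflectionless {N : ℕ} (D : DiscreteData N) (δ : ℝ) (q : ℝ → ℝ → ℂ)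
    (μm μp : ℝ → ℝ → ℂ → Matrix (Fin 2) (Fin 2) ℂ) (S : ℂ → Matrix (Fin 2) (Fin 2) ℂ) : Prop where
  jost_minus_one : ∀ t z, z ≠ 0 → z ∈ Dminus D.q₀ ∪ contour D.q₀ →
    IsJostColumn δ D.q₀ q D.qm atBot t z 0 (fun x i => μm x t z i 0)
  jost_minus_two : ∀ t z, z ≠ 0 → z ∈ Dplus D.q₀ ∪ contour D.q₀ →
    IsJostColumn δ D.q₀ q D.qm atBot t z 1 (fun x i => μm x t z i 1)
  jost_plus_one : ∀ t z, z ≠ 0 → z ∈ Dplus D.q₀ ∪ contour D.q₀ →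
    IsJostColumn δ D.q₀ q D.qp atTop t z 0 (fun x i => μp x t z i 0)
  jost_plus_two : ∀ t z, z ≠ 0 → z ∈ Dminus D.q₀ ∪ contour D.q₀ →
    IsJostColumn δ D.q₀ q D.qp atTop t z 1 (fun x i => μp x t z i 1)
  /-- `μ₊ = μ₋ e^{iθσ₃} S e^{-iθσ₃}` on the contour. -/
  scattering : ∀ x t z, z ≠ 0 → z ∈ contour D.q₀ → μp x t z = μm x t z *
    !![S z 0 0, Complex.exp (2 * Complex.I * theta δ D.q₀ x t z) * S z 0 1;
       Complex.exp (-2 * Complex.I * theta δ D.q₀ x t z) * S z 1 0, S z 1 1]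
  /-- `γ s₁₁ = W(ψ₊,₁, ψ₋,₂)` with `γ = 1 + q₀^2 / z^2`. -/
  wronskian_one : ∀ x t z, z ≠ 0 → z ∈ Dplus D.q₀ ∪ contour D.q₀ →
    (1 + (D.q₀ : ℂ) ^ 2 / z ^ 2) * S z 0 0
      = μp x t z 0 0 * μm x t z 1 1 - μp x t z 1 0 * μm x t z 0 1
  /-- `γ s₂₂ = W(ψ₋,₁, ψ₊,₂)`. -/
  wronskian_two : ∀ x t z, z ≠ 0 → z ∈ Dminus D.q₀ ∪ contour D.q₀ →
    (1 + (D.q₀ : ℂ) ^ 2 / z ^ 2) * S z 1 1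
      = μm x t z 0 0 * μp x t z 1 1 - μm x t z 1 0 * μp x t z 0 1
  reflectionless : ∀ z, z ≠ 0 → z ∈ contour D.q₀ → S z 0 0 ≠ 0 ∧ S z 1 1 ≠ 0 ∧
    reflection S z = 0 ∧ reflectionTilde S z = 0
  analytic_one : AnalyticOnNhd ℂ (fun z => S z 0 0) (Dplus D.q₀)
  analytic_two : AnalyticOnNhd ℂ (fun z => S z 1 1) (Dminus D.q₀)
  zeros_one : ∀ z ∈ Dplus D.q₀, S z 0 0 = 0 ↔ ∃ n, z = D.xi n
  zeros_two : ∀ z ∈ Dminus D.q₀, S z 1 1 = 0 ↔ ∃ n, z = conj (D.xi n)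
  simple_one : ∀ n, deriv (fun z => S z 0 0) (D.xi n) ≠ 0
  simple_two : ∀ n, deriv (fun z => S z 1 1) (conj (D.xi n)) ≠ 0
  norming : ∀ n, ∃ b : ℂ, D.C n = b / deriv (fun z => S z 0 0) (D.xi n) ∧
    ∀ x t i, μp x t (D.xi n) i 0 =
      b * Complex.exp (-2 * Complex.I * theta δ D.q₀ x t (D.xi n)) * μm x t (D.xi n) i 1
  norming_tilde : ∀ n, ∃ b : ℂ, D.Ctilde n = b / deriv (fun z => S z 1 1) (conj (D.xi n)) ∧
    ∀ x t i, μp x t (conj (D.xi n)) i 1 =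
      b * Complex.exp (2 * Complex.I * theta δ D.q₀ x t (conj (D.xi n)))
        * μm x t (conj (D.xi n)) i 0

end SNLS

/-! Without a jump the Riemann–Hilbert problem is rational in z. The second row of a solution is
determined by X_j = Φ₂₂(ξ_j) and Z_k = Φ₂₁(ξ_k^*), which satisfy two coupled Cauchy-type linear
systems; eliminating Z leaves (1 + A) X = B.

The pivot is `cauchySystem_trivial`: the homogeneous coupled system has only the zero solution. For
a solution (x, y), put f = ∑ Y_j x_j / (s - ξ_j) and g = ∑ Y_k^* y_k / (s - ξ_k^*). For real s, both
|f|² and |g|² expand in partial fractions, and the residues of |f|² + |g|² cancel, so f = g = 0.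
This gives det M ≠ 0. It also proves identities between solutions: the defect of a conjectured
identity solves the homogeneous system, hence vanishes. The symmetry z ↦ -q₀²/z (`Z_eq_X_swap`) and
the x-part of the Lax pair (`hasDerivAt_X_Z_x`) are obtained in this way.

The t-part of the Lax pair is not needed. If Y_j evolves with frequency w_j, then q evolves by -2i ∑
w_j Y_j X_j² (`hasDerivAt_potential_of_hasDerivAt`). The moments of these squared eigenfunctions
with weights λ(ξ_j) k(ξ_j)^(m-1) are the coefficients c_m of a solution Ω of the stationary Lax
equation. The relation Ω² = -(k² + q₀²) integrates the diagonal coefficients explicitly, so every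
c_m that is needed becomes a differential polynomial in q (`IsLaxHierarchy`). The phase combines
c_2, c_4 and c_6 into the equation.

As x → -∞ all Y_j tend to 0 and the limits are immediate. As x → +∞ the Y_j blow up; multiplying the
columns by the Blaschke-type products s₁₁ and s₂₂ exchanges the poles ξ_j and ξ_j^* and gives an
equivalent system that contains 1/Y_j instead. The functions φ before and ψ after this
multiplication are the Jost columns at -∞ and +∞.

For an arbitrary solution Φ with ρ = 0, the two boundary values agree on Σ. Since λ is real on Σ and
a local coordinate away from ±q₀, Painlevé's theorem removes the contour; Liouville's theorem
(`eq_cauchySum_of_contour`) then gives the partial fractions and hence the linear system. -/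

namespace SNLS

/-! ### Cauchy sums -/

section CauchySums

variable {ι : Type*} [Fintype ι]

/-- A product of two Cauchy sums with disjoint poles, decomposed into partial fractions. -/
theorem cauchySum_mul_cauchySum (u v α β : ι → ℂ) (h : ∀ j k, α j ≠ β k) (s : ℂ)
    (hα : ∀ j, s ≠ α j) (hβ : ∀ k, s ≠ β k) :
    (∑ j, u j / (s - α j)) * (∑ k, v k / (s - β k)) =
      ∑ j, u j / (s - α j) * (∑ k, v k / (α j - β k)) +
      ∑ k, v k / (s - β k) * (∑ j, u j / (β k - α j)) := by
  rw [Finset.sum_mul_sum]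
  simp only [Finset.mul_sum]
  have e : ∑ k, ∑ j, v k / (s - β k) * (u j / (β k - α j)) =
    ∑ j, ∑ k, v k / (s - β k) * (u j / (β k - α j)) := Finset.sum_comm
  rw [e, ← Finset.sum_add_distrib]
  refine Finset.sum_congr rfl fun j _ => ?_
  rw [← Finset.sum_add_distrib]
  refine Finset.sum_congr rfl fun k _ => ?_
  have h1 := sub_ne_zero.2 (hα j)
  have h2 := sub_ne_zero.2 (hβ k)
  have h3 := sub_ne_zero.2 (h j k)
  have h4 := sub_ne_zero.2 (h j k).symm
  rw [show u j / (s - α j) * (v k / (α j - β k)) = u j * v k / ((s - α j) * (α j - β k)) by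
      field_simp,
    show v k / (s - β k) * (u j / (β k - α j)) = -(u j * v k / ((s - β k) * (α j - β k))) by
      rw [← neg_sub (α j) (β k)]; field_simp]
  field_simp
  ring

/-- A Cauchy sum with distinct poles that vanishes at infinitely many points is zero. -/
theorem eq_zero_of_cauchySum_eq_zero (u α : ι → ℂ) (hα : Function.Injective α)
    {T : Set ℂ} (hT : T.Infinite) (hTα : ∀ s ∈ T, ∀ j, s ≠ α j)
    (h : ∀ s ∈ T, ∑ j, u j / (s - α j) = 0) (j : ι) : u j = 0 := by
  classical
  -- Clearing denominators yields a polynomial with infinitely many roots; its value at `α j` is `u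
  -- j` times a nonzero product.
  set P : Polynomial ℂ := ∑ j, Polynomial.C (u j) *
    ∏ i ∈ Finset.univ.erase j, (Polynomial.X - Polynomial.C (α i)) with hP
  have hev : ∀ s, P.eval s = ∑ j, u j * ∏ i ∈ Finset.univ.erase j, (s - α i) := by
    intro s
    simp [hP, Polynomial.eval_finsetSum, Polynomial.eval_prod]
  have hroot : ∀ s ∈ T, P.IsRoot s := by
    intro s hs
    have : P.eval s = (∏ i, (s - α i)) * ∑ j, u j / (s - α j) := by
      rw [hev, Finset.mul_sum]
      refine Finset.sum_congr rfl fun j _ => ?_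
      rw [← Finset.mul_prod_erase _ _ (Finset.mem_univ j)]
      have := sub_ne_zero.2 (hTα s hs j)
      field_simp
    rw [Polynomial.IsRoot.def, this, h s hs, mul_zero]
  have hP0 : P = 0 := Polynomial.eq_zero_of_infinite_isRoot P (hT.mono hroot)
  have hj := hev (α j)
  rw [hP0, Polynomial.eval_zero, Finset.sum_eq_single j] at hj
  · refine (mul_eq_zero.1 hj.symm).resolve_right (Finset.prod_ne_zero_iff.2 fun i hi => ?_)
    exact sub_ne_zero.2 (hα.ne (Finset.ne_of_mem_erase hi).symm)
  · intro i _ hij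
    rw [Finset.prod_eq_zero (i := j) (by simp [hij.symm]) (sub_self _), mul_zero]
  · simp

/-- The homogeneous linear system of the reflectionless Riemann–Hilbert problem has only the
trivial solution. -/
theorem cauchySystem_trivial (ξ Y x y : ι → ℂ) (hinj : Function.Injective ξ)
    (hne : ∀ j k, ξ j ≠ conj (ξ k))
    (hy : ∀ k, y k = ∑ j, Y j * x j / (conj (ξ k) - ξ j))
    (hx : ∀ j, x j = -∑ k, conj (Y k) * y k / (ξ j - conj (ξ k))) : x = 0 ∧ y = 0 := by
  have hreal : ∀ (s : ℝ) j, (s : ℂ) ≠ ξ j := by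
    intro s j h
    exact hne j j (by rw [← h, Complex.conj_ofReal])
  have hreal' : ∀ (s : ℝ) j, (s : ℂ) ≠ conj (ξ j) := by
    intro s j h
    exact hreal s j (by simpa using congrArg conj h)
  -- On the real line conjugation only moves the poles, so |f|² and |g|² are products of Cauchy sums
  -- with disjoint poles. By the two systems the residue of |f|² at ξ_j is Y_j x_j y_j^* and that of
  -- |g|² is its negative; likewise at ξ_k^*.
  have key : ∀ s : ℝ, ∑ j, Y j * x j / ((s : ℂ) - ξ j) = 0 := by
    intro s
    set f := ∑ j, Y j * x j / ((s : ℂ) - ξ j) with hf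
    set g := ∑ k, conj (Y k) * y k / ((s : ℂ) - conj (ξ k)) with hg
    have hfc : conj f = ∑ j, conj (Y j * x j) / ((s : ℂ) - conj (ξ j)) := by
      simp [hf, map_sum, map_div₀]
    have hgc : conj g = ∑ j, Y j * conj (y j) / ((s : ℂ) - ξ j) := by
      simp [hg, map_sum, map_div₀]
    have hyc : ∀ j, conj (y j) = ∑ k, conj (Y k * x k) / (ξ j - conj (ξ k)) := by
      intro j; rw [hy j]; simp [map_sum, map_div₀]
    have hxc : ∀ k, -conj (x k) = ∑ j, Y j * conj (y j) / (conj (ξ k) - ξ j) := by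
      intro j; rw [hx j]; simp [map_sum, map_div₀]
    have hx' : ∀ j, ∑ k, conj (Y k) * y k / (ξ j - conj (ξ k)) = -x j := by
      intro j; rw [hx j, neg_neg]
    have h1 := cauchySum_mul_cauchySum (fun j => Y j * x j) (fun k => conj (Y k * x k)) ξ
      (fun k => conj (ξ k)) hne s (hreal s) (hreal' s)
    have h2 := cauchySum_mul_cauchySum (fun j => Y j * conj (y j)) (fun k => conj (Y k) * y k) ξ
      (fun k => conj (ξ k)) hne s (hreal s) (hreal' s)
    simp only [← hyc, ← hxc, ← hy, hx', ← hf, ← hg, ← hfc, ← hgc] at h1 h2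
    have h0 : f * conj f + conj g * g = 0 := by
      rw [h1, h2]
      simp only [← Finset.sum_add_distrib]
      refine Finset.sum_eq_zero fun j _ => ?_
      simp only [map_mul]
      ring
    rw [mul_comm (conj g), Complex.mul_conj, Complex.mul_conj] at h0
    have h3 : Complex.normSq f + Complex.normSq g = 0 := by exact_mod_cast h0
    have := Complex.normSq_nonneg f
    have := Complex.normSq_nonneg g
    exact Complex.normSq_eq_zero.1 (by linarith)
  have hu : ∀ j, Y j * x j = 0 := by
    refine eq_zero_of_cauchySum_eq_zero (fun j => Y j * x j) ξ hinj
      (T := Set.range ((↑) : ℝ → ℂ)) ?_ ?_ ?_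
    · exact Set.infinite_range_of_injective Complex.ofReal_injective
    · rintro _ ⟨s, rfl⟩; exact hreal s
    · rintro _ ⟨s, rfl⟩; exact key s
  have hy0 : y = 0 := by
    funext k; rw [hy k]; simp [hu]
  refine ⟨?_, hy0⟩
  funext j; rw [hx j]; simp [hy0]

end CauchySums

/-! ### The discrete spectrum -/

namespace DiscreteData

variable {N : ℕ} (D : DiscreteData N)

theorem q₀_ne_zero : (D.q₀ : ℂ) ≠ 0 := Complex.ofReal_ne_zero.2 D.q₀_pos.ne'

theorem qm_ne_zero : D.qm ≠ 0 := by
  rw [← norm_ne_zero_iff, D.norm_qm]; exact D.q₀_pos.ne'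

theorem conj_qm_ne_zero : conj D.qm ≠ 0 := (map_ne_zero _).2 D.qm_ne_zero

theorem qm_mul_conj : D.qm * conj D.qm = (D.q₀ : ℂ) ^ 2 := by
  rw [Complex.mul_conj, Complex.normSq_eq_norm_sq, D.norm_qm]; push_cast; ring

theorem ev_ne_zero (n : Fin N) : D.ev n ≠ 0 := by
  intro h; have := D.ev_im n; simp [h] at this

theorem conj_ev_ne_zero (n : Fin N) : conj (D.ev n) ≠ 0 := (map_ne_zero _).2 (D.ev_ne_zero n)

theorem xi_inl (n : Fin N) : D.xi (.inl n) = D.ev n := rfl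

theorem xi_inr (n : Fin N) : D.xi (.inr n) = -(D.q₀ : ℂ) ^ 2 / conj (D.ev n) := rfl

theorem xi_ne_zero (j : Fin N ⊕ Fin N) : D.xi j ≠ 0 := by
  cases j with
  | inl n => exact D.ev_ne_zero n
  | inr n => exact div_ne_zero (neg_ne_zero.2 (pow_ne_zero 2 D.q₀_ne_zero)) (D.conj_ev_ne_zero n)

theorem conj_xi_ne_zero (j : Fin N ⊕ Fin N) : conj (D.xi j) ≠ 0 :=
  (map_ne_zero _).2 (D.xi_ne_zero j)

/-- The second symmetry of the spectrum: swapping the two halves of the index set realizes the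
involution z ↦ -q₀²/z, up to conjugation. -/
theorem neg_sq_div_xi (j : Fin N ⊕ Fin N) :
    -(D.q₀ : ℂ) ^ 2 / D.xi j = conj (D.xi j.swap) := by
  have h0 := D.q₀_ne_zero
  cases j with
  | inl n => simp [xi_inl, xi_inr, map_div₀]
  | inr n =>
    have := D.conj_ev_ne_zero n
    simp only [xi_inl, xi_inr, Sum.swap_inr]
    field_simp

theorem conj_xi_swap_mul (j : Fin N ⊕ Fin N) :
    D.xi j * conj (D.xi j.swap) = -(D.q₀ : ℂ) ^ 2 := by
  rw [← D.neg_sq_div_xi, mul_div_cancel₀ _ (D.xi_ne_zero j)]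

theorem xi_swap (j : Fin N ⊕ Fin N) : D.xi j.swap = -(D.q₀ : ℂ) ^ 2 / conj (D.xi j) := by
  rw [eq_div_iff (D.conj_xi_ne_zero j)]
  simpa using D.conj_xi_swap_mul j.swap

/-- The point is z times the negative number -q₀²/|z|², so both factors in the definition of D⁺
change sign. -/
theorem mem_Dplus_neg_sq_div_conj {q₀ : ℝ} (hq : 0 < q₀) {z : ℂ} (hz : z ∈ Dplus q₀) :
    -(q₀ : ℂ) ^ 2 / conj z ∈ Dplus q₀ := by
  have hz0 : z ≠ 0 := by rintro rfl; simp [Dplus] at hz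
  have hn : 0 < ‖z‖ := norm_pos_iff.2 hz0
  simp only [Dplus, Set.mem_ofPred_eq] at hz ⊢
  have e1 : ‖-(q₀ : ℂ) ^ 2 / conj z‖ = q₀ ^ 2 / ‖z‖ := by
    simp [abs_of_pos hq]
  have e2 : (-(q₀ : ℂ) ^ 2 / conj z).im = -(q₀ ^ 2 / ‖z‖ ^ 2 * z.im) := by
    have : -(q₀ : ℂ) ^ 2 / conj z = ((-(q₀ ^ 2) / ‖z‖ ^ 2 : ℝ) : ℂ) * z := by
      have h3 : conj z ≠ 0 := (map_ne_zero _).2 hz0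
      have h2 : ((‖z‖ ^ 2 : ℝ) : ℂ) = z * conj z := by
        rw [Complex.mul_conj, Complex.normSq_eq_norm_sq]
      rw [Complex.ofReal_div, h2]
      push_cast
      field_simp
    rw [this, Complex.im_ofReal_mul]
    ring
  rw [e1, e2]
  have : ((q₀ ^ 2 / ‖z‖) ^ 2 - q₀ ^ 2) * -(q₀ ^ 2 / ‖z‖ ^ 2 * z.im)
      = q₀ ^ 4 / ‖z‖ ^ 4 * ((‖z‖ ^ 2 - q₀ ^ 2) * z.im) := by
    field_simp; ring
  rw [this]; positivity

theorem xi_mem_Dplus (j : Fin N ⊕ Fin N) : D.xi j ∈ Dplus D.q₀ := by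
  cases j with
  | inl n => exact D.ev_mem n
  | inr n => exact mem_Dplus_neg_sq_div_conj D.q₀_pos (D.ev_mem n)

end DiscreteData

/-! ### The regions D⁺, D⁻ and the contour -/

theorem conj_mem_Dminus_iff {q₀ : ℝ} {z : ℂ} : conj z ∈ Dminus q₀ ↔ z ∈ Dplus q₀ := by
  simp [Dplus, Dminus]

theorem conj_mem_Dplus_iff {q₀ : ℝ} {z : ℂ} : conj z ∈ Dplus q₀ ↔ z ∈ Dminus q₀ := by
  simp [Dplus, Dminus]

theorem conj_mem_contour_iff {q₀ : ℝ} {z : ℂ} : conj z ∈ contour q₀ ↔ z ∈ contour q₀ := by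
  simp [contour]

theorem notMem_Dminus_of_mem_Dplus {q₀ : ℝ} {z : ℂ} (h : z ∈ Dplus q₀) : z ∉ Dminus q₀ := by
  simp only [Dplus, Dminus, Set.mem_ofPred_eq] at *; linarith

theorem notMem_contour_of_mem_Dplus {q₀ : ℝ} {z : ℂ} (h : z ∈ Dplus q₀) : z ∉ contour q₀ := by
  rintro (h1 | h1) <;> simp [Dplus, h1] at h

theorem notMem_contour_of_mem_Dminus {q₀ : ℝ} {z : ℂ} (h : z ∈ Dminus q₀) : z ∉ contour q₀ := by
  rintro (h1 | h1) <;> simp [Dminus, h1] at h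

theorem isOpen_Dplus (q₀ : ℝ) : IsOpen (Dplus q₀) :=
  isOpen_lt continuous_const (by fun_prop)

theorem isOpen_Dminus (q₀ : ℝ) : IsOpen (Dminus q₀) :=
  isOpen_lt (by fun_prop) continuous_const

theorem contour_compl {q₀ : ℝ} (hq : 0 < q₀) : (contour q₀)ᶜ = Dplus q₀ ∪ Dminus q₀ := by
  ext z
  have h : ‖z‖ = q₀ ↔ ‖z‖ ^ 2 - q₀ ^ 2 = 0 := by
    rw [sub_eq_zero, sq_eq_sq₀ (norm_nonneg _) hq.le]
  simp only [contour, Dplus, Dminus, Set.mem_compl_iff, Set.mem_ofPred_eq, Set.mem_union, h]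
  rw [or_comm, ← mul_eq_zero, ← ne_eq, ne_iff_lt_or_gt, or_comm]

namespace DiscreteData

variable {N : ℕ} (D : DiscreteData N)

theorem conj_xi_mem_Dminus (j : Fin N ⊕ Fin N) : conj (D.xi j) ∈ Dminus D.q₀ :=
  conj_mem_Dminus_iff.2 (D.xi_mem_Dplus j)

theorem xi_ne_conj_xi (j k : Fin N ⊕ Fin N) : D.xi j ≠ conj (D.xi k) := fun h =>
  notMem_Dminus_of_mem_Dplus (D.xi_mem_Dplus j) (h ▸ D.conj_xi_mem_Dminus k)

theorem xi_sub_conj_xi (j k : Fin N ⊕ Fin N) : D.xi j - conj (D.xi k) ≠ 0 :=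
  sub_ne_zero.2 (D.xi_ne_conj_xi j k)

theorem conj_xi_sub_xi (j k : Fin N ⊕ Fin N) : conj (D.xi k) - D.xi j ≠ 0 :=
  sub_ne_zero.2 (D.xi_ne_conj_xi j k).symm

/-- The reflected points lie inside the circle, where D⁺ is the lower half disc. This separates the
two halves of the spectrum and makes the 2N eigenvalues distinct. -/
theorem xi_inr_im_neg (n : Fin N) : (D.xi (.inr n)).im < 0 := by
  have h := D.ev_im n
  have h2 := D.ev_mem n
  have h1 : 0 < ‖D.ev n‖ ^ 2 - D.q₀ ^ 2 := by
    by_contra h3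
    simp only [Dplus, Set.mem_ofPred_eq] at h2
    nlinarith
  have h4 := D.xi_mem_Dplus (.inr n)
  simp only [Dplus, Set.mem_ofPred_eq] at h4
  by_contra h5
  push Not at h5
  have hq := D.q₀_pos
  have h6 : ‖D.xi (.inr n)‖ = D.q₀ ^ 2 / ‖D.ev n‖ := by
    simp [xi_inr, abs_of_pos hq]
  have h7 : D.q₀ < ‖D.ev n‖ := by
    by_contra h8; push Not at h8
    nlinarith [norm_nonneg (D.ev n)]
  have h8 : ‖D.xi (.inr n)‖ < D.q₀ := by
    rw [h6, div_lt_iff₀ (hq.trans h7), sq]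
    exact mul_lt_mul_of_pos_left h7 hq
  have h9 : ‖D.xi (.inr n)‖ ^ 2 - D.q₀ ^ 2 ≤ 0 := by
    nlinarith [norm_nonneg (D.xi (.inr n))]
  nlinarith

theorem xi_injective : Function.Injective D.xi := by
  rintro (n | n) (m | m) h
  · exact congrArg _ (D.ev_injective h)
  · have h1 := D.xi_inr_im_neg m
    rw [← h] at h1
    exact absurd h1 (D.ev_im n).not_gt
  · have h1 := D.xi_inr_im_neg n
    rw [h] at h1
    exact absurd h1 (D.ev_im m).not_gt
  · have h2 : conj (D.xi (Sum.inr n).swap) = conj (D.xi (Sum.inr m).swap) := by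
      rw [← neg_sq_div_xi, ← neg_sq_div_xi, h]
    have h3 : D.ev n = D.ev m := (starRingEnd ℂ).injective h2
    exact congrArg _ (D.ev_injective h3)

end DiscreteData

namespace DiscreteData

variable {N : ℕ} (D : DiscreteData N) (δ x t : ℝ)

/-! ### The linear system -/

theorem c_eq (j : Fin N ⊕ Fin N) (z : ℂ) : D.c δ x t j z = D.Y δ x t j / (z - D.xi j) := by
  simp only [c, Y]; ring

theorem conj_c_conj_xi (k n : Fin N ⊕ Fin N) :
    conj (D.c δ x t k (conj (D.xi n))) = conj (D.Y δ x t k) / (D.xi n - conj (D.xi k)) := by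
  simp [c_eq, map_div₀]

/-- A is a product of two Cauchy matrices; factoring it exposes the intermediate vector, which is
the Z-component of the coupled system. -/
theorem A_mulVec (v : Fin N ⊕ Fin N → ℂ) (n : Fin N ⊕ Fin N) :
    (D.A δ x t).mulVec v n = ∑ k, conj (D.Y δ x t k) *
      (∑ j, D.Y δ x t j * v j / (conj (D.xi k) - D.xi j)) / (D.xi n - conj (D.xi k)) := by
  simp only [Matrix.mulVec, dotProduct, A, conj_c_conj_xi, Finset.sum_mul, Finset.mul_sum,
    Finset.sum_div]
  rw [Finset.sum_comm]
  refine Finset.sum_congr rfl fun k _ => Finset.sum_congr rfl fun j _ => ?_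
  rw [c_eq]
  ring

theorem B_eq (n : Fin N ⊕ Fin N) : D.B δ x t n = 1 - ∑ k, conj (D.Y δ x t k) *
    (D.qm / conj (D.xi k)) / (D.xi n - conj (D.xi k)) := by
  simp only [B, conj_c_conj_xi]
  congr 1
  refine Finset.sum_congr rfl fun k _ => ?_
  ring

/-- The `2N × 2N` system for `X` is the elimination of `Z` from the `4N × 4N` residue system. -/
theorem mulVec_eq_B_iff (X Z : Fin N ⊕ Fin N → ℂ)
    (hZ : ∀ k, Z k = D.qm / conj (D.xi k) +
      ∑ j, D.Y δ x t j * X j / (conj (D.xi k) - D.xi j)) :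
    (1 + D.A δ x t).mulVec X = D.B δ x t ↔
      ∀ j, X j = 1 - ∑ k, conj (D.Y δ x t k) * Z k / (D.xi j - conj (D.xi k)) := by
  rw [funext_iff]
  refine forall_congr' fun n => ?_
  have h : ∑ k, conj (D.Y δ x t k) * Z k / (D.xi n - conj (D.xi k)) =
      ∑ k, conj (D.Y δ x t k) * (D.qm / conj (D.xi k)) / (D.xi n - conj (D.xi k)) +
      ∑ k, conj (D.Y δ x t k) *
      (∑ j, D.Y δ x t j * X j / (conj (D.xi k) - D.xi j)) / (D.xi n - conj (D.xi k)) := by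
    rw [← Finset.sum_add_distrib]
    refine Finset.sum_congr rfl fun k _ => ?_
    rw [hZ]; ring
  rw [Matrix.add_mulVec, Matrix.one_mulVec, Pi.add_apply, A_mulVec, B_eq, h]
  constructor <;> intro h' <;> linear_combination h'

/-- A kernel vector, together with its intermediate vector, solves the homogeneous coupled system.
-/
theorem det_M_ne_zero : (D.M δ x t).det ≠ 0 := by
  intro h
  obtain ⟨v, hv, hMv⟩ := Matrix.exists_mulVec_eq_zero_iff.2 h
  apply hv
  refine (cauchySystem_trivial D.xi (D.Y δ x t) v
    (fun k => ∑ j, D.Y δ x t j * v j / (conj (D.xi k) - D.xi j)) D.xi_injective D.xi_ne_conj_xi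
    (fun k => rfl) fun n => ?_).1
  have h1 := congrFun hMv n
  rw [M, Matrix.add_mulVec, Matrix.one_mulVec, Pi.add_apply, A_mulVec, Pi.zero_apply] at h1
  linear_combination h1

/-- The solution of `(1 + A) X = B`, by Cramer's rule. -/
noncomputable def X : Fin N ⊕ Fin N → ℂ := fun n => (D.Mext δ x t n).det / (D.M δ x t).det

theorem X_eq_cramer : D.X δ x t = (D.M δ x t).det⁻¹ • (D.M δ x t).cramer (D.B δ x t) := by
  funext n
  simp [X, Mext, Matrix.cramer_apply, div_eq_inv_mul]

theorem mulVec_X : (1 + D.A δ x t).mulVec (D.X δ x t) = D.B δ x t := by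
  rw [X_eq_cramer, Matrix.mulVec_smul, ← M, Matrix.mulVec_cramer, smul_smul,
    inv_mul_cancel₀ (D.det_M_ne_zero δ x t), one_smul]

theorem eq_X_of_mulVec_eq {v : Fin N ⊕ Fin N → ℂ} (hv : (1 + D.A δ x t).mulVec v = D.B δ x t) :
    v = D.X δ x t := by
  have h : (D.M δ x t).mulVec (v - D.X δ x t) = 0 := by
    rw [Matrix.mulVec_sub, M, hv, mulVec_X, sub_self]
  by_contra hne
  exact D.det_M_ne_zero δ x t (Matrix.exists_mulVec_eq_zero_iff.1 ⟨_, sub_ne_zero.2 hne, h⟩)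

/-- The Schur complement of M in the bordered matrix is the scalar -Yᵀ M⁻¹ B, and M⁻¹ B = X. -/
theorem potential_eq : D.potential δ x t = D.qm + ∑ j, D.Y δ x t j * D.X δ x t j := by
  have hM := D.det_M_ne_zero δ x t
  have hdet : IsUnit (D.M δ x t).det := isUnit_iff_ne_zero.2 hM
  let _ : Invertible (D.M δ x t) := Matrix.invertibleOfIsUnitDet _ hdet
  have hX : (D.M δ x t)⁻¹.mulVec (D.B δ x t) = D.X δ x t := by
    rw [← D.mulVec_X δ x t, ← M, Matrix.mulVec_mulVec, Matrix.nonsing_inv_mul _ hdet,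
      Matrix.one_mulVec]
  have : (D.Maug δ x t).det = (D.M δ x t).det * -∑ j, D.Y δ x t j * D.X δ x t j := by
    rw [Maug, Matrix.det_fromBlocks₂₂, Matrix.det_unique (n := Unit), Matrix.invOf_eq_nonsing_inv,
      Matrix.mul_assoc, ← hX]
    congr 1
    simp [Matrix.mul_apply, Matrix.mulVec, dotProduct]
  rw [potential, this, mul_div_cancel_left₀ _ hM, sub_neg_eq_add]

/-- The values at `ξ_k^*` of the entry `21` of the solution of the Riemann–Hilbert problem. -/
noncomputable def Z : Fin N ⊕ Fin N → ℂ := fun k => D.qm / conj (D.xi k) +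
  ∑ j, D.Y δ x t j * D.X δ x t j / (conj (D.xi k) - D.xi j)

theorem Z_eq (k : Fin N ⊕ Fin N) : D.Z δ x t k = D.qm / conj (D.xi k) +
    ∑ j, D.Y δ x t j * D.X δ x t j / (conj (D.xi k) - D.xi j) := rfl

theorem X_eq (j : Fin N ⊕ Fin N) : D.X δ x t j =
    1 - ∑ k, conj (D.Y δ x t k) * D.Z δ x t k / (D.xi j - conj (D.xi k)) :=
  (D.mulVec_eq_B_iff δ x t _ _ (D.Z_eq δ x t)).1 (D.mulVec_X δ x t) j

/-! ### The symmetry `z ↦ -q₀² / z` -/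

/-- The velocity of `Y_j` in `t` is `p(k)` times its velocity in `x`. -/
noncomputable def disp (δ q₀ : ℝ) (k : ℂ) : ℂ :=
  32 * δ * k ^ 5 - 16 * δ * (q₀ : ℂ) ^ 2 * k ^ 3 + 12 * δ * (q₀ : ℂ) ^ 4 * k + k

theorem theta_eq (q₀ : ℝ) (z : ℂ) :
    theta δ q₀ x t z = lam q₀ z * (x + disp δ q₀ (kz q₀ z) * t) := rfl

theorem conj_lam (q₀ : ℝ) (z : ℂ) : conj (lam q₀ z) = lam q₀ (conj z) := by
  simp [lam, map_div₀, Complex.conj_ofNat]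

theorem conj_kz (q₀ : ℝ) (z : ℂ) : conj (kz q₀ z) = kz q₀ (conj z) := by
  simp [kz, map_div₀, Complex.conj_ofNat]

theorem conj_disp (q₀ : ℝ) (k : ℂ) : conj (disp δ q₀ k) = disp δ q₀ (conj k) := by
  simp [disp, Complex.conj_ofNat]

theorem conj_theta (q₀ : ℝ) (z : ℂ) : conj (theta δ q₀ x t z) = theta δ q₀ x t (conj z) := by
  simp [theta_eq, conj_lam, conj_disp, conj_kz]

/-- λ is odd and k is even under z ↦ -q₀²/z. Hence θ is odd, whatever polynomial in k multiplies t.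
-/
theorem lam_conj_xi_swap (j : Fin N ⊕ Fin N) :
    lam D.q₀ (conj (D.xi j.swap)) = -lam D.q₀ (D.xi j) := by
  rw [← D.neg_sq_div_xi]
  have := D.xi_ne_zero j
  have := D.q₀_ne_zero
  simp only [lam]
  field_simp
  ring

theorem kz_conj_xi_swap (j : Fin N ⊕ Fin N) :
    kz D.q₀ (conj (D.xi j.swap)) = kz D.q₀ (D.xi j) := by
  rw [← D.neg_sq_div_xi]
  have := D.xi_ne_zero j
  have := D.q₀_ne_zero
  simp only [kz]
  field_simp
  ring

theorem theta_conj_xi_swap (j : Fin N ⊕ Fin N) :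
    theta δ D.q₀ x t (conj (D.xi j.swap)) = -theta δ D.q₀ x t (D.xi j) := by
  simp only [theta_eq, lam_conj_xi_swap, kz_conj_xi_swap]; ring

theorem C_ne_zero (j : Fin N ⊕ Fin N) : D.C j ≠ 0 := by
  have h0 := D.q₀_ne_zero
  cases j with
  | inl n => exact D.nc_ne_zero n
  | inr n =>
    have h1 := D.conj_ev_ne_zero n
    have h2 : conj (D.nc n) ≠ 0 := (map_ne_zero _).2 (D.nc_ne_zero n)
    have := D.qm_ne_zero
    have := D.conj_qm_ne_zero
    simp only [C, Sum.elim_inr]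
    exact mul_ne_zero (mul_ne_zero (neg_ne_zero.2 (div_ne_zero ‹_› ‹_›))
      (pow_ne_zero 2 (div_ne_zero h0 h1))) (neg_ne_zero.2 h2)

theorem Y_ne_zero (j : Fin N ⊕ Fin N) : D.Y δ x t j ≠ 0 :=
  mul_ne_zero (D.C_ne_zero j) (Complex.exp_ne_zero _)

/-- The rule defining C_{N+n} from C_n is involutive, so it takes the same form on both halves. -/
theorem C_swap (k : Fin N ⊕ Fin N) : D.C k.swap =
    conj (D.C k) * (D.qm / conj D.qm) * D.xi k.swap ^ 2 / (D.q₀ : ℂ) ^ 2 := by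
  have h0 := D.q₀_ne_zero
  have h1 := D.qm_ne_zero
  have h2 := D.conj_qm_ne_zero
  cases k with
  | inl n =>
    have h3 := D.conj_ev_ne_zero n
    simp only [C, Sum.swap_inl, Sum.elim_inl, Sum.elim_inr, xi_inr]
    field_simp
  | inr n =>
    have h3 := D.ev_ne_zero n
    simp only [C, Sum.swap_inr, Sum.elim_inl, Sum.elim_inr, xi_inl, map_mul, map_neg, map_pow,
      map_div₀, Complex.conj_conj, Complex.conj_ofReal]
    field_simp

/-- Because θ is odd under the pairing, the exponentials match and the symmetry of C persists for
all (x, t). -/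
theorem Y_swap (k : Fin N ⊕ Fin N) : D.Y δ x t k.swap =
    conj (D.Y δ x t k) * (D.qm / conj D.qm) * D.xi k.swap ^ 2 / (D.q₀ : ℂ) ^ 2 := by
  have h : conj (-2 * Complex.I * theta δ D.q₀ x t (D.xi k)) =
      -2 * Complex.I * theta δ D.q₀ x t (D.xi k.swap) := by
    have := D.theta_conj_xi_swap δ x t k.swap
    rw [Sum.swap_swap] at this
    simp only [map_mul, map_neg, conj_theta, this, Complex.conj_I, map_ofNat]
    ring
  simp only [Y, C_swap, map_mul, ← Complex.exp_conj, h]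
  ring

theorem conj_Y_eq (k : Fin N ⊕ Fin N) : conj (D.Y δ x t k) =
    D.Y δ x t k.swap * conj D.qm * conj (D.xi k) ^ 2 / (D.qm * (D.q₀ : ℂ) ^ 2) := by
  have h0 := D.q₀_ne_zero
  have h1 := D.qm_ne_zero
  have h2 := D.conj_qm_ne_zero
  have h3 := D.conj_xi_ne_zero k
  rw [Y_swap, xi_swap]
  field_simp

/-- The symmetry z ↦ -q₀²/z of the solution. Substituting the paired indices turns the X-system into
the Z-system; the inhomogeneous terms cancel because q₋ q₋^* = q₀², so the defects solve the
homogeneous system. -/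
theorem Z_eq_X_swap (k : Fin N ⊕ Fin N) :
    D.Z δ x t k = D.X δ x t k.swap * D.qm / conj (D.xi k) := by
  have h0 := D.q₀_ne_zero
  have h1 := D.qm_ne_zero
  have h2 := D.conj_qm_ne_zero
  have hq := D.qm_mul_conj
  have hX : ∀ j : Fin N ⊕ Fin N, D.Z δ x t j.swap = D.qm / conj (D.xi j.swap) + ∑ k :
    Fin N ⊕ Fin N, D.Y δ x t k.swap *
      D.X δ x t k.swap / (conj (D.xi j.swap) - D.xi k.swap) := by
    intro j
    rw [Z_eq]
    congr 1
    exact ((Equiv.sumComm (Fin N) (Fin N)).sum_comp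
      (fun k => D.Y δ x t k * D.X δ x t k / (conj (D.xi j.swap) - D.xi k))).symm
  have hZ : ∀ k : Fin N ⊕ Fin N, D.X δ x t k.swap = 1 - ∑ j : Fin N ⊕ Fin N, conj
    (D.Y δ x t j.swap) * D.Z δ x t j.swap /
      (D.xi k.swap - conj (D.xi j.swap)) := by
    intro k
    rw [X_eq]
    congr 1
    exact ((Equiv.sumComm (Fin N) (Fin N)).sum_comp
      (fun j => conj (D.Y δ x t j) * D.Z δ x t j / (D.xi k.swap - conj (D.xi j)))).symm
  have hdiff : ∀ j k : Fin N ⊕ Fin N, conj (D.xi j.swap) - D.xi k.swap =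
      (D.q₀ : ℂ) ^ 2 * (D.xi j - conj (D.xi k)) / (D.xi j * conj (D.xi k)) := by
    intro j k
    have := D.xi_ne_zero j
    have := D.conj_xi_ne_zero k
    rw [← neg_sq_div_xi, xi_swap]
    field_simp
    ring
  have key := cauchySystem_trivial D.xi (D.Y δ x t)
    (fun j => D.X δ x t j + D.Z δ x t j.swap * conj D.qm / D.xi j)
    (fun k => D.Z δ x t k - D.X δ x t k.swap * D.qm / conj (D.xi k))
    D.xi_injective D.xi_ne_conj_xi ?_ ?_
  · exact sub_eq_zero.1 (congrFun key.2 k)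
  · intro k
    have h3 := D.conj_xi_ne_zero k
    rw [Z_eq, hZ, sub_mul, sub_div, one_mul, add_sub_sub_cancel, Finset.sum_mul, Finset.sum_div,
      ← Finset.sum_add_distrib]
    refine Finset.sum_congr rfl fun j _ => ?_
    have h4 := D.xi_ne_zero j
    have h5 := D.conj_xi_sub_xi j k
    have h6 : D.xi k.swap - conj (D.xi j.swap) =
      (D.q₀ : ℂ) ^ 2 * (conj (D.xi k) - D.xi j) / (D.xi j * conj (D.xi k)) := by
      rw [← neg_sub, hdiff, ← neg_sub (D.xi j)]; ring
    have h7 : D.Y δ x t j = conj (D.Y δ x t j.swap) * (D.qm / conj D.qm) * D.xi j ^ 2 /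
        (D.q₀ : ℂ) ^ 2 := by
      have := D.Y_swap δ x t j.swap
      rwa [Sum.swap_swap] at this
    rw [h6, h7]
    field_simp
  · intro j
    have h3 := D.xi_ne_zero j
    have h4 : D.qm / conj (D.xi j.swap) * conj D.qm / D.xi j = -1 := by
      rw [← D.neg_sq_div_xi, ← hq]; field_simp
    rw [X_eq, hX, add_mul, add_div, h4]
    rw [show ∀ a b : ℂ, 1 - a + (-1 + b) = -(a - b) by intros; ring, Finset.sum_mul,
      Finset.sum_div, ← Finset.sum_sub_distrib]
    congr 1
    refine Finset.sum_congr rfl fun k _ => ?_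
    have h5 := D.conj_xi_ne_zero k
    have h6 := D.xi_sub_conj_xi j k
    rw [hdiff, conj_Y_eq, ← hq]
    field_simp

theorem conj_Y_mul_Z_mul (k : Fin N ⊕ Fin N) :
    conj (D.Y δ x t k) * D.Z δ x t k * (D.qm / conj (D.xi k)) =
      D.Y δ x t k.swap * D.X δ x t k.swap := by
  have h1 := D.qm_ne_zero
  have h2 := D.conj_qm_ne_zero
  have h3 := D.conj_xi_ne_zero k
  rw [conj_Y_eq, Z_eq_X_swap, ← D.qm_mul_conj]
  field_simp

/-- Identifies the squared eigenfunctions at ξ_k^* with those at the paired point, so that both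
kinds of sums can be compared. -/
theorem conj_Y_mul_Z_sq (k : Fin N ⊕ Fin N) :
    conj (D.Y δ x t k) * D.Z δ x t k ^ 2 = D.Y δ x t k.swap * D.X δ x t k.swap ^ 2 := by
  have h3 := D.conj_xi_ne_zero k
  have h := D.conj_Y_mul_Z_mul δ x t k
  have h4 := D.Z_eq_X_swap δ x t k
  linear_combination (D.X δ x t k.swap) * h + conj (D.Y δ x t k) * D.Z δ x t k * h4

/-- The value at `z = 0` of the entry `22` of the solution is `q / q₋`. -/
theorem sum_conj_Y_mul_Z :
    ∑ k, conj (D.Y δ x t k) * D.Z δ x t k * (D.qm / conj (D.xi k)) =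
      ∑ j, D.Y δ x t j * D.X δ x t j := by
  simp only [conj_Y_mul_Z_mul]
  exact (Equiv.sumComm (Fin N) (Fin N)).sum_comp (fun k => D.Y δ x t k * D.X δ x t k)

end DiscreteData

/-! ### Smooth dependence on `x` and `t` -/

theorem contDiff_det {E ι : Type*} [NormedAddCommGroup E] [NormedSpace ℝ E] [Fintype ι]
    [DecidableEq ι] {F : E → Matrix ι ι ℂ} (h : ∀ i j, ContDiff ℝ ∞ fun p => F p i j) :
    ContDiff ℝ ∞ fun p => (F p).det := by
  simp only [Matrix.det_apply']
  exact ContDiff.sum fun σ _ => contDiff_const.mul (contDiff_prod fun i _ => h _ _)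

theorem contDiff_conj {E : Type*} [NormedAddCommGroup E] [NormedSpace ℝ E] {f : E → ℂ}
    (h : ContDiff ℝ ∞ f) : ContDiff ℝ ∞ fun p => conj (f p) :=
  Complex.conjCLE.contDiff.comp h

theorem hasDerivAt_conj {f : ℝ → ℂ} {f' : ℂ} {x : ℝ} (h : HasDerivAt f f' x) :
    HasDerivAt (fun y => conj (f y)) (conj f') x :=
  Complex.conjCLE.hasFDerivAt.comp_hasDerivAt x h

namespace DiscreteData

variable {N : ℕ} (D : DiscreteData N) (δ x t : ℝ)

theorem contDiff_Y (j : Fin N ⊕ Fin N) : ContDiff ℝ ∞ fun p : ℝ × ℝ => D.Y δ p.1 p.2 j := by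
  have h1 : ContDiff ℝ ∞ fun p : ℝ × ℝ => (p.1 : ℂ) := Complex.ofRealCLM.contDiff.comp contDiff_fst
  have h2 : ContDiff ℝ ∞ fun p : ℝ × ℝ => (p.2 : ℂ) := Complex.ofRealCLM.contDiff.comp contDiff_snd
  simp only [Y, theta_eq]
  exact contDiff_const.mul (contDiff_const.mul
    (contDiff_const.mul (h1.add (contDiff_const.mul h2)))).cexp

theorem contDiff_c (j : Fin N ⊕ Fin N) (z : ℂ) :
    ContDiff ℝ ∞ fun p : ℝ × ℝ => D.c δ p.1 p.2 j z := by
  simp only [c_eq]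
  exact (D.contDiff_Y δ j).div_const _

theorem contDiff_M (n j : Fin N ⊕ Fin N) : ContDiff ℝ ∞ fun p : ℝ × ℝ => D.M δ p.1 p.2 n j := by
  simp only [M, Matrix.add_apply, A]
  exact contDiff_const.add (ContDiff.sum fun k _ =>
    (contDiff_conj (D.contDiff_c δ _ _)).mul (D.contDiff_c δ _ _))

theorem contDiff_B (n : Fin N ⊕ Fin N) : ContDiff ℝ ∞ fun p : ℝ × ℝ => D.B δ p.1 p.2 n := by
  simp only [B]
  exact contDiff_const.sub (ContDiff.sum fun k _ =>
    (contDiff_conj (D.contDiff_c δ _ _)).mul contDiff_const)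

theorem contDiff_X (n : Fin N ⊕ Fin N) : ContDiff ℝ ∞ fun p : ℝ × ℝ => D.X δ p.1 p.2 n := by
  simp only [X, div_eq_mul_inv]
  refine (contDiff_det fun i j => ?_).mul ((contDiff_det fun i j => D.contDiff_M δ i j).inv
    fun p => D.det_M_ne_zero δ _ _)
  simp only [Mext, Matrix.updateCol_apply]
  split_ifs
  exacts [D.contDiff_B δ i, D.contDiff_M δ i j]

theorem contDiff_Z (n : Fin N ⊕ Fin N) : ContDiff ℝ ∞ fun p : ℝ × ℝ => D.Z δ p.1 p.2 n := by
  simp only [Z]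
  exact contDiff_const.add (ContDiff.sum fun j _ =>
    ((D.contDiff_Y δ j).mul (D.contDiff_X δ j)).div_const _)

theorem contDiff_potential : ContDiff ℝ ∞ fun p : ℝ × ℝ => D.potential δ p.1 p.2 := by
  simp only [potential_eq]
  exact contDiff_const.add (ContDiff.sum fun j _ => (D.contDiff_Y δ j).mul (D.contDiff_X δ j))

theorem hasDerivAt_Y_x (j : Fin N ⊕ Fin N) : HasDerivAt (fun y => D.Y δ y t j)
    (-2 * Complex.I * lam D.q₀ (D.xi j) * D.Y δ x t j) x := by
  have h1 : HasDerivAt (fun y : ℝ => (y : ℂ)) 1 x := Complex.ofRealCLM.hasDerivAt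
  have h := (((h1.add_const (disp δ D.q₀ (kz D.q₀ (D.xi j)) * t)).const_mul
    (lam D.q₀ (D.xi j))).const_mul (-2 * Complex.I)).cexp.const_mul (D.C j)
  refine h.congr_deriv ?_
  simp only [Y, theta_eq]
  ring

theorem hasDerivAt_Y_t (j : Fin N ⊕ Fin N) : HasDerivAt (fun s => D.Y δ x s j)
    (-2 * Complex.I * (lam D.q₀ (D.xi j) * disp δ D.q₀ (kz D.q₀ (D.xi j))) * D.Y δ x t j) t := by
  have h1 : HasDerivAt (fun y : ℝ => (y : ℂ)) 1 t := Complex.ofRealCLM.hasDerivAt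
  have h := ((((h1.const_mul (disp δ D.q₀ (kz D.q₀ (D.xi j)))).const_add (x : ℂ)).const_mul
    (lam D.q₀ (D.xi j))).const_mul (-2 * Complex.I)).cexp.const_mul (D.C j)
  refine h.congr_deriv ?_
  simp only [Y, theta_eq]
  ring

theorem differentiableAt_x {f : ℝ × ℝ → ℂ} (hf : ContDiff ℝ ∞ f) :
    HasDerivAt (fun y => f (y, t)) (deriv (fun y => f (y, t)) x) x :=
  ((hf.comp (contDiff_id.prodMk contDiff_const)).differentiable (by simp) x).hasDerivAt

theorem differentiableAt_t {f : ℝ × ℝ → ℂ} (hf : ContDiff ℝ ∞ f) :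
    HasDerivAt (fun s => f (x, s)) (deriv (fun s => f (x, s)) t) t :=
  ((hf.comp (contDiff_const.prodMk contDiff_id)).differentiable (by simp) t).hasDerivAt

/-! ### The entries of the solution of the Riemann–Hilbert problem -/

/-- Partial fractions dictated by the residue conditions: the residue of the first column at ξ_j is
Y_j times the second column there, that of the second column at ξ_k^* is -Y_k^* times the first. The
first row is obtained from the second by conjugation. -/
noncomputable def phi21 (z : ℂ) : ℂ := D.qm / z + ∑ j, D.Y δ x t j * D.X δ x t j / (z - D.xi j)

noncomputable def phi22 (z : ℂ) : ℂ :=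
  1 - ∑ k, conj (D.Y δ x t k) * D.Z δ x t k / (z - conj (D.xi k))

noncomputable def phi11 (z : ℂ) : ℂ := 1 - ∑ j, D.Y δ x t j * conj (D.Z δ x t j) / (z - D.xi j)

noncomputable def phi12 (z : ℂ) : ℂ :=
  -conj D.qm / z - ∑ k, conj (D.Y δ x t k) * conj (D.X δ x t k) / (z - conj (D.xi k))

theorem phi21_conj_xi (k : Fin N ⊕ Fin N) : D.phi21 δ x t (conj (D.xi k)) = D.Z δ x t k := rfl

theorem phi22_xi (j : Fin N ⊕ Fin N) : D.phi22 δ x t (D.xi j) = D.X δ x t j :=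
  (D.X_eq δ x t j).symm

theorem phi11_eq_conj (z : ℂ) : D.phi11 δ x t z = conj (D.phi22 δ x t (conj z)) := by
  simp [phi11, phi22, map_sum, map_div₀]

theorem phi12_eq_neg_conj (z : ℂ) : D.phi12 δ x t z = -conj (D.phi21 δ x t (conj z)) := by
  simp [phi12, phi21, map_sum, map_div₀]
  ring

theorem phi12_xi (j : Fin N ⊕ Fin N) : D.phi12 δ x t (D.xi j) = -conj (D.Z δ x t j) := by
  rw [phi12_eq_neg_conj, phi21_conj_xi]

theorem phi11_conj_xi (k : Fin N ⊕ Fin N) :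
    D.phi11 δ x t (conj (D.xi k)) = conj (D.X δ x t k) := by
  rw [phi11_eq_conj, Complex.conj_conj, phi22_xi]

theorem two_mul_lam (q₀ : ℝ) (z : ℂ) : 2 * lam q₀ z = z + (q₀ : ℂ) ^ 2 / z := by
  simp only [lam]; ring

/-- The defect of the Lax equation for a candidate derivative `X'`. The terms of order z⁰ cancel
since q = q₋ + ∑ Y_j X_j, leaving a Cauchy sum whose residues are Y_j times the defect of `X'`,
which is the shape of the homogeneous system. -/
theorem lax21_eq_cauchySum (X' : Fin N ⊕ Fin N → ℂ) {z : ℂ} (hz : z ≠ 0)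
    (hξ : ∀ j, z ≠ D.xi j) :
    ∑ j, (-2 * Complex.I * lam D.q₀ (D.xi j) * D.Y δ x t j * D.X δ x t j +
        D.Y δ x t j * X' j) / (z - D.xi j) +
      Complex.I * z * D.phi21 δ x t z - Complex.I * D.potential δ x t * D.phi11 δ x t z =
    ∑ j, D.Y δ x t j * (X' j - (Complex.I * ((D.q₀ : ℂ) ^ 2 / D.xi j) * D.X δ x t j -
      Complex.I * D.potential δ x t * conj (D.Z δ x t j))) / (z - D.xi j) := by
  have h1 : Complex.I * z * D.phi21 δ x t z = Complex.I * D.qm +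
      ∑ j, Complex.I * z * (D.Y δ x t j * D.X δ x t j / (z - D.xi j)) := by
    rw [phi21, mul_add, Finset.mul_sum, mul_assoc, mul_div_cancel₀ _ hz]
  have h2 : Complex.I * D.potential δ x t * D.phi11 δ x t z = Complex.I * D.qm +
      ∑ j, (Complex.I * (D.Y δ x t j * D.X δ x t j) -
      Complex.I * D.potential δ x t * (D.Y δ x t j * conj (D.Z δ x t j) / (z - D.xi j))) := by
    rw [phi11, mul_sub, mul_one, Finset.mul_sum, Finset.sum_sub_distrib]
    nth_rw 1 [potential_eq]
    rw [mul_add, Finset.mul_sum]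
    ring
  rw [h1, h2, add_sub_assoc, add_sub_add_left_eq_sub, ← Finset.sum_sub_distrib,
    ← Finset.sum_add_distrib]
  refine Finset.sum_congr rfl fun j _ => ?_
  have h3 := sub_ne_zero.2 (hξ j)
  have h4 := two_mul_lam D.q₀ (D.xi j)
  rw [show -2 * Complex.I * lam D.q₀ (D.xi j) * D.Y δ x t j * D.X δ x t j =
    -Complex.I * (2 * lam D.q₀ (D.xi j)) * D.Y δ x t j * D.X δ x t j by ring, h4]
  have := D.xi_ne_zero j
  field_simp
  ring

/-- Here the obstruction is the pole at z = 0; it cancels because the entry 22 takes the value q /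
q₋ there, a consequence of the second symmetry. -/
theorem lax22_eq_cauchySum (Z' : Fin N ⊕ Fin N → ℂ) {z : ℂ} (hz : z ≠ 0)
    (hξ : ∀ j, z ≠ conj (D.xi j)) :
    -∑ k, (conj (-2 * Complex.I * lam D.q₀ (D.xi k) * D.Y δ x t k) * D.Z δ x t k +
        conj (D.Y δ x t k) * Z' k) / (z - conj (D.xi k)) -
      Complex.I * ((D.q₀ : ℂ) ^ 2 / z) * D.phi22 δ x t z -
      Complex.I * D.potential δ x t * D.phi12 δ x t z =
    -∑ k, conj (D.Y δ x t k) * (Z' k - (-Complex.I * conj (D.xi k) * D.Z δ x t k +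
      Complex.I * D.potential δ x t * conj (D.X δ x t k))) / (z - conj (D.xi k)) := by
  have hq := D.qm_mul_conj
  have h1 : Complex.I * ((D.q₀ : ℂ) ^ 2 / z) * D.phi22 δ x t z =
      Complex.I * ((D.q₀ : ℂ) ^ 2 / z) - ∑ k, Complex.I * ((D.q₀ : ℂ) ^ 2 / z) *
        (conj (D.Y δ x t k) * D.Z δ x t k / (z - conj (D.xi k))) := by
    rw [phi22, mul_sub, mul_one, Finset.mul_sum]
  have h0 : Complex.I * D.potential δ x t * (-conj D.qm / z) =
      -(Complex.I * ((D.q₀ : ℂ) ^ 2 / z)) - ∑ k, Complex.I * (conj D.qm / z) *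
        (conj (D.Y δ x t k) * D.Z δ x t k * (D.qm / conj (D.xi k))) := by
    rw [← Finset.mul_sum, sum_conj_Y_mul_Z, potential_eq, ← hq]
    field_simp
    ring
  have h2 : Complex.I * D.potential δ x t * D.phi12 δ x t z =
      -(Complex.I * ((D.q₀ : ℂ) ^ 2 / z)) - ∑ k, (Complex.I * (conj D.qm / z) *
        (conj (D.Y δ x t k) * D.Z δ x t k * (D.qm / conj (D.xi k))) +
        Complex.I * D.potential δ x t *
          (conj (D.Y δ x t k) * conj (D.X δ x t k) / (z - conj (D.xi k)))) := by
    rw [phi12, mul_sub, h0, Finset.mul_sum, Finset.sum_add_distrib]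
    ring
  rw [h1, h2]
  rw [show ∀ a b c d : ℂ, -a - (b - c) - (-b - d) = -(a - c - d) by intros; ring,
    ← Finset.sum_sub_distrib, ← Finset.sum_sub_distrib]
  congr 1
  refine Finset.sum_congr rfl fun k _ => ?_
  have h3 := sub_ne_zero.2 (hξ k)
  have h4 := two_mul_lam D.q₀ (conj (D.xi k))
  rw [show conj (-2 * Complex.I * lam D.q₀ (D.xi k) * D.Y δ x t k) * D.Z δ x t k =
    Complex.I * (2 * lam D.q₀ (conj (D.xi k))) * conj (D.Y δ x t k) * D.Z δ x t k by
      simp only [map_mul, map_neg, conj_lam, Complex.conj_I, Complex.conj_ofNat]; ring, h4, ← hq]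
  have := D.conj_xi_ne_zero k
  field_simp
  ring

/-! ### The Lax equation in `x` -/

theorem hasDerivAt_Z_of_hasDerivAt {Y X : ℝ → Fin N ⊕ Fin N → ℂ} {Y' X' : Fin N ⊕ Fin N → ℂ}
    {s : ℝ} (hY : ∀ j, HasDerivAt (fun r => Y r j) (Y' j) s)
    (hX : ∀ j, HasDerivAt (fun r => X r j) (X' j) s) (z : ℂ) :
    HasDerivAt (fun r => D.qm / z + ∑ j, Y r j * X r j / (z - D.xi j))
      (∑ j, (Y' j * X s j + Y s j * X' j) / (z - D.xi j)) s :=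
  (HasDerivAt.fun_sum fun j _ => ((hY j).mul (hX j)).div_const _).const_add _

theorem hasDerivAt_X_of_hasDerivAt {Y Z : ℝ → Fin N ⊕ Fin N → ℂ} {Y' Z' : Fin N ⊕ Fin N → ℂ}
    {s : ℝ} (hY : ∀ j, HasDerivAt (fun r => Y r j) (Y' j) s)
    (hZ : ∀ j, HasDerivAt (fun r => Z r j) (Z' j) s) (z : ℂ) :
    HasDerivAt (fun r => 1 - ∑ k, conj (Y r k) * Z r k / (z - conj (D.xi k)))
      (-∑ k, (conj (Y' k) * Z s k + conj (Y s k) * Z' k) / (z - conj (D.xi k))) s :=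
  (HasDerivAt.fun_sum fun k _ =>
    ((hasDerivAt_conj (hY k)).mul (hZ k)).div_const _).const_sub _

/-- The dressing argument: differentiating both systems and evaluating the two defect formulas at
ξ_k^* and ξ_j shows that the defects of X_x and Z_x solve the homogeneous system. -/
theorem hasDerivAt_X_Z_x :
    (∀ j, HasDerivAt (fun y => D.X δ y t j) (Complex.I * ((D.q₀ : ℂ) ^ 2 / D.xi j) * D.X δ x t j -
      Complex.I * D.potential δ x t * conj (D.Z δ x t j)) x) ∧
    (∀ k, HasDerivAt (fun y => D.Z δ y t k) (-Complex.I * conj (D.xi k) * D.Z δ x t k +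
      Complex.I * D.potential δ x t * conj (D.X δ x t k)) x) := by
  set X' : Fin N ⊕ Fin N → ℂ := fun j => deriv (fun y => D.X δ y t j) x
  set Z' : Fin N ⊕ Fin N → ℂ := fun j => deriv (fun y => D.Z δ y t j) x
  have hX : ∀ j, HasDerivAt (fun y => D.X δ y t j) (X' j) x := fun j =>
    differentiableAt_x x t (D.contDiff_X δ j)
  have hZ : ∀ j, HasDerivAt (fun y => D.Z δ y t j) (Z' j) x := fun j =>
    differentiableAt_x x t (D.contDiff_Z δ j)
  have hY := D.hasDerivAt_Y_x δ x t
  have eZ : ∀ k, Z' k = _ := fun k => (hZ k).unique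
    (D.hasDerivAt_Z_of_hasDerivAt hY hX (conj (D.xi k)))
  have eX : ∀ j, X' j = _ := fun j => (hX j).unique
    (by simpa only [← X_eq] using D.hasDerivAt_X_of_hasDerivAt hY hZ (D.xi j))
  have key := cauchySystem_trivial D.xi (D.Y δ x t)
    (fun j => X' j - (Complex.I * ((D.q₀ : ℂ) ^ 2 / D.xi j) * D.X δ x t j -
      Complex.I * D.potential δ x t * conj (D.Z δ x t j)))
    (fun k => Z' k - (-Complex.I * conj (D.xi k) * D.Z δ x t k +
      Complex.I * D.potential δ x t * conj (D.X δ x t k))) D.xi_injective D.xi_ne_conj_xi ?_ ?_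
  · exact ⟨fun j => (hX j).congr_deriv (sub_eq_zero.1 (congrFun key.1 j)),
      fun j => (hZ j).congr_deriv (sub_eq_zero.1 (congrFun key.2 j))⟩
  · intro k
    rw [← D.lax21_eq_cauchySum δ x t X' (D.conj_xi_ne_zero k)
      (fun j => (D.xi_ne_conj_xi j k).symm), phi21_conj_xi, phi11_conj_xi, eZ k]
    ring
  · intro j
    rw [← D.lax22_eq_cauchySum δ x t Z' (D.xi_ne_zero j) (D.xi_ne_conj_xi j), phi22_xi, phi12_xi,
      eX j]
    ring

theorem hasDerivAt_phi21 {z : ℂ} (hz : z ≠ 0) (hξ : ∀ j, z ≠ D.xi j) :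
    HasDerivAt (fun y => D.phi21 δ y t z) (-Complex.I * z * D.phi21 δ x t z +
      Complex.I * D.potential δ x t * D.phi11 δ x t z) x := by
  refine (D.hasDerivAt_Z_of_hasDerivAt (D.hasDerivAt_Y_x δ x t)
    (D.hasDerivAt_X_Z_x δ x t).1 z).congr_deriv ?_
  have h := D.lax21_eq_cauchySum δ x t (fun j => Complex.I * ((D.q₀ :
    ℂ) ^ 2 / D.xi j) * D.X δ x t j -
      Complex.I * D.potential δ x t * conj (D.Z δ x t j)) hz hξ
  simp only [sub_self, mul_zero, zero_div, Finset.sum_const_zero] at h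
  linear_combination h

theorem hasDerivAt_phi22 {z : ℂ} (hz : z ≠ 0) (hξ : ∀ j, z ≠ conj (D.xi j)) :
    HasDerivAt (fun y => D.phi22 δ y t z) (Complex.I * ((D.q₀ : ℂ) ^ 2 / z) * D.phi22 δ x t z +
      Complex.I * D.potential δ x t * D.phi12 δ x t z) x := by
  refine (D.hasDerivAt_X_of_hasDerivAt (D.hasDerivAt_Y_x δ x t)
    (D.hasDerivAt_X_Z_x δ x t).2 z).congr_deriv ?_
  have h := D.lax22_eq_cauchySum δ x t (fun k => -Complex.I * conj (D.xi k) * D.Z δ x t k +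
      Complex.I * D.potential δ x t * conj (D.X δ x t k)) hz hξ
  simp only [sub_self, mul_zero, zero_div, Finset.sum_const_zero, neg_zero] at h
  linear_combination h

theorem hasDerivAt_phi11 {z : ℂ} (hz : z ≠ 0) (hξ : ∀ j, z ≠ D.xi j) :
    HasDerivAt (fun y => D.phi11 δ y t z) (-Complex.I * ((D.q₀ : ℂ) ^ 2 / z) * D.phi11 δ x t z +
      Complex.I * conj (D.potential δ x t) * D.phi21 δ x t z) x := by
  have h := hasDerivAt_conj (D.hasDerivAt_phi22 δ x t ((map_ne_zero conj).2 hz)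
    fun j hj => hξ j ((starRingEnd ℂ).injective hj))
  simp only [phi11_eq_conj]
  refine h.congr_deriv ?_
  simp [phi12_eq_neg_conj, map_div₀]

theorem hasDerivAt_phi12 {z : ℂ} (hz : z ≠ 0) (hξ : ∀ j, z ≠ conj (D.xi j)) :
    HasDerivAt (fun y => D.phi12 δ y t z) (Complex.I * z * D.phi12 δ x t z +
      Complex.I * conj (D.potential δ x t) * D.phi22 δ x t z) x := by
  have h := (hasDerivAt_conj (D.hasDerivAt_phi21 δ x t ((map_ne_zero conj).2 hz)
    fun j hj => hξ j (by rw [← hj, Complex.conj_conj]))).neg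
  simp only [phi12_eq_neg_conj]
  refine h.congr_deriv ?_
  simp [phi11_eq_conj]
  ring

/-! ### The evolution of the potential -/

/-- If each `Y_j` evolves with frequency `w_j`, the potential evolves by the squared
eigenfunctions. -/
theorem hasDerivAt_potential_of_hasDerivAt {Y X Z : ℝ → Fin N ⊕ Fin N → ℂ} {s : ℝ}
    {w : Fin N ⊕ Fin N → ℂ} (hw : ∀ j, conj (w j) = -w j.swap)
    (hY : ∀ j, HasDerivAt (fun r => Y r j) (-2 * Complex.I * w j * Y s j) s)
    (hX : ∀ j, DifferentiableAt ℝ (fun r => X r j) s)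
    (hZ : ∀ j, DifferentiableAt ℝ (fun r => Z r j) s)
    (eZ : ∀ r k, Z r k = D.qm / conj (D.xi k) + ∑ j, Y r j * X r j / (conj (D.xi k) - D.xi j))
    (eX : ∀ r j, X r j = 1 - ∑ k, conj (Y r k) * Z r k / (D.xi j - conj (D.xi k)))
    (eq : ∀ r, ∑ k, conj (Y r k) * Z r k * (D.qm / conj (D.xi k)) = ∑ j, Y r j * X r j)
    (es : ∀ k, conj (Y s k) * Z s k ^ 2 = Y s k.swap * X s k.swap ^ 2) :
    HasDerivAt (fun r => D.qm + ∑ j, Y r j * X r j)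
      (-2 * Complex.I * ∑ j, w j * Y s j * X s j ^ 2) s := by
  obtain ⟨Y', hY'⟩ : ∃ Y' : Fin N ⊕ Fin N → ℂ, ∀ j, Y' j = -2 * Complex.I * w j * Y s j :=
    ⟨_, fun _ => rfl⟩
  simp only [← hY'] at hY
  set X' : Fin N ⊕ Fin N → ℂ := fun j => deriv (fun r => X r j) s
  set Z' : Fin N ⊕ Fin N → ℂ := fun j => deriv (fun r => Z r j) s
  replace hX : ∀ j, HasDerivAt (fun r => X r j) (X' j) s := fun j => (hX j).hasDerivAt
  replace hZ : ∀ j, HasDerivAt (fun r => Z r j) (Z' j) s := fun j => (hZ j).hasDerivAt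
  have dZ : ∀ k, Z' k = _ := fun k => (hZ k).unique
    (by simpa only [← eZ] using D.hasDerivAt_Z_of_hasDerivAt hY hX (conj (D.xi k)))
  have dX : ∀ j, X' j = _ := fun j => (hX j).unique
    (by simpa only [← eX] using D.hasDerivAt_X_of_hasDerivAt hY hZ (D.xi j))
  have h1 : HasDerivAt (fun r => ∑ j, Y r j * X r j) (∑ j, (Y' j * X s j + Y s j * X' j)) s :=
    HasDerivAt.fun_sum fun j _ => (hY j).mul (hX j)
  have h2 : HasDerivAt (fun r => ∑ k, conj (Y r k) * Z r k * (D.qm / conj (D.xi k)))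
      (∑ k, (conj (Y' k) * Z s k + conj (Y s k) * Z' k) * (D.qm / conj (D.xi k))) s :=
    HasDerivAt.fun_sum fun k _ => ((hasDerivAt_conj (hY k)).mul (hZ k)).mul_const _
  simp only [eq] at h2
  -- q - q₋ has two expressions, as a sum over ξ_j and as a sum over ξ_k^*; their derivatives
  -- coincide.
  have hQ := h2.unique h1
  refine (h1.const_add D.qm).congr_deriv ?_
  -- `X'` is a Cauchy sum of (Y^* Z)'. Exchanging summations moves the antisymmetric kernel onto Y X
  -- and rebuilds Z - q₋/ξ^*; `e2` is the mirror computation.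
  have e1 : ∑ j, Y s j * X s j * X' j =
      ∑ k, (conj (Y' k) * Z s k + conj (Y s k) * Z' k) * (Z s k - D.qm / conj (D.xi k)) := by
    simp only [dX, eZ s, add_sub_cancel_left, Finset.mul_sum, mul_neg, ← Finset.sum_neg_distrib]
    rw [Finset.sum_comm]
    refine Finset.sum_congr rfl fun k _ => Finset.sum_congr rfl fun j _ => ?_
    have h3 := D.xi_sub_conj_xi j k
    rw [← neg_sub (D.xi j)]
    field_simp
  have e2 : ∑ k, conj (Y s k) * Z s k * Z' k =
      ∑ j, (Y' j * X s j + Y s j * X' j) * (X s j - 1) := by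
    have : ∀ j, X s j - 1 = -∑ k, conj (Y s k) * Z s k / (D.xi j - conj (D.xi k)) := by
      intro j; rw [eX s j]; ring
    simp only [dZ, this, Finset.mul_sum, mul_neg, ← Finset.sum_neg_distrib]
    rw [Finset.sum_comm]
    refine Finset.sum_congr rfl fun k _ => Finset.sum_congr rfl fun j _ => ?_
    have h3 := D.xi_sub_conj_xi k j
    rw [← neg_sub (D.xi k)]
    field_simp
  have e3 : ∑ k, conj (Y' k) * Z s k ^ 2 = ∑ j, Y' j * X s j ^ 2 := by
    rw [← (Equiv.sumComm (Fin N) (Fin N)).sum_comp (fun j => Y' j * X s j ^ 2)]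
    refine Finset.sum_congr rfl fun k _ => ?_
    have h3 := es k
    have h4 := hw k
    simp only [hY', map_mul, map_neg, h4, Complex.conj_I, Complex.conj_ofNat,
      Equiv.sumComm_apply]
    linear_combination (-2 * Complex.I * w k.swap) * h3
  have e4 : -2 * Complex.I * ∑ j, w j * Y s j * X s j ^ 2 = ∑ j, Y' j * X s j ^ 2 := by
    rw [Finset.mul_sum]
    exact Finset.sum_congr rfl fun j _ => by rw [hY']; ring
  rw [e4]
  have e5 : ∑ j, (Y' j * X s j ^ 2 + Y s j * X s j * X' j) =
      ∑ j, (Y' j * X s j + Y s j * X' j) * (X s j - 1) +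
      ∑ j, (Y' j * X s j + Y s j * X' j) := by
    rw [← Finset.sum_add_distrib]
    exact Finset.sum_congr rfl fun j _ => by ring
  have e6 : ∑ k, (conj (Y' k) * Z s k ^ 2 + conj (Y s k) * Z s k * Z' k) =
      ∑ k, (conj (Y' k) * Z s k + conj (Y s k) * Z' k) * (Z s k - D.qm / conj (D.xi k)) +
      ∑ k, (conj (Y' k) * Z s k + conj (Y s k) * Z' k) * (D.qm / conj (D.xi k)) := by
    rw [← Finset.sum_add_distrib]
    exact Finset.sum_congr rfl fun j _ => by ring
  rw [Finset.sum_add_distrib] at e5 e6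
  -- Adding `e5` and `e6` cancels the cross terms and leaves 2q' = ∑ Y' X² + ∑ (Y')^* Z², whose two
  -- sums agree by `e3`.
  linear_combination (1 / 2) * (-e5 - e6 + e3 + e1 + e2 - hQ)

theorem hasDerivAt_potential_x : HasDerivAt (fun y => D.potential δ y t)
    (-2 * Complex.I * ∑ j, lam D.q₀ (D.xi j) * D.Y δ x t j * D.X δ x t j ^ 2) x := by
  simp only [potential_eq]
  refine D.hasDerivAt_potential_of_hasDerivAt (Y := fun y => D.Y δ y t)
    (X := fun y => D.X δ y t) (Z := fun y => D.Z δ y t) (w := fun j => lam D.q₀ (D.xi j)) ?_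
    (D.hasDerivAt_Y_x δ x t)
    (fun j => (differentiableAt_x x t (D.contDiff_X δ j)).differentiableAt)
    (fun j => (differentiableAt_x x t (D.contDiff_Z δ j)).differentiableAt)
    (fun y => D.Z_eq δ y t) (fun y => D.X_eq δ y t) (fun y => D.sum_conj_Y_mul_Z δ y t)
    (D.conj_Y_mul_Z_sq δ x t)
  intro j
  have := D.lam_conj_xi_swap j.swap
  rw [Sum.swap_swap] at this
  rw [conj_lam, this]

theorem hasDerivAt_potential_t : HasDerivAt (fun s => D.potential δ x s)
    (-2 * Complex.I * ∑ j, lam D.q₀ (D.xi j) * disp δ D.q₀ (kz D.q₀ (D.xi j)) *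
      D.Y δ x t j * D.X δ x t j ^ 2) t := by
  simp only [potential_eq]
  refine D.hasDerivAt_potential_of_hasDerivAt (Y := fun s => D.Y δ x s)
    (X := fun s => D.X δ x s) (Z := fun s => D.Z δ x s)
    (w := fun j => lam D.q₀ (D.xi j) * disp δ D.q₀ (kz D.q₀ (D.xi j))) ?_
    (D.hasDerivAt_Y_t δ x t)
    (fun j => (differentiableAt_t x t (D.contDiff_X δ j)).differentiableAt)
    (fun j => (differentiableAt_t x t (D.contDiff_Z δ j)).differentiableAt)
    (fun y => D.Z_eq δ x y) (fun y => D.X_eq δ x y) (fun y => D.sum_conj_Y_mul_Z δ x y)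
    (D.conj_Y_mul_Z_sq δ x t)
  intro j
  have h1 := D.lam_conj_xi_swap j.swap
  have h2 := D.kz_conj_xi_swap j.swap
  rw [Sum.swap_swap] at h1 h2
  rw [map_mul, conj_lam, conj_disp, conj_kz, h1, h2]
  ring

end DiscreteData

theorem tendsto_conj {l : Filter ℝ} {f : ℝ → ℂ} {a : ℂ} (h : Tendsto f l (𝓝 a)) :
    Tendsto (fun x => conj (f x)) l (𝓝 (conj a)) :=
  (Complex.continuous_conj.tendsto a).comp h

/-! ### Weakly coupled linear systems -/

/-- An a priori bound by absorption: the total size R satisfies R ≤ K + eR with e → 0, so R is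
eventually bounded, and then the coupling terms tend to zero. -/
theorem tendsto_of_coupling_tendsto_zero {ι : Type*} [Fintype ι] {l : Filter ℝ}
    {u v α β : ℝ → ι → ℂ} {α₀ β₀ : ι → ℂ} {E F : ℝ → ι → ι → ℂ}
    (hu : ∀ x j, u x j = α x j + ∑ k, E x j k * v x k)
    (hv : ∀ x k, v x k = β x k + ∑ j, F x k j * u x j)
    (hα : ∀ j, Tendsto (fun x => α x j) l (𝓝 (α₀ j)))
    (hβ : ∀ j, Tendsto (fun x => β x j) l (𝓝 (β₀ j)))
    (hE : ∀ j k, Tendsto (fun x => E x j k) l (𝓝 0))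
    (hF : ∀ j k, Tendsto (fun x => F x j k) l (𝓝 0)) :
    (∀ j, Tendsto (fun x => u x j) l (𝓝 (α₀ j))) ∧
    (∀ j, Tendsto (fun x => v x j) l (𝓝 (β₀ j))) := by
  set R : ℝ → ℝ := fun x => ∑ j, ‖u x j‖ + ∑ k, ‖v x k‖ with hR
  have hRu : ∀ x j, ‖u x j‖ ≤ R x := fun x j =>
    (Finset.single_le_sum (f := fun j => ‖u x j‖) (fun _ _ => norm_nonneg _)
      (Finset.mem_univ j)).trans (le_add_of_nonneg_right
        (Finset.sum_nonneg fun _ _ => norm_nonneg _))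
  have hRv : ∀ x j, ‖v x j‖ ≤ R x := fun x j =>
    (Finset.single_le_sum (f := fun j => ‖v x j‖) (fun _ _ => norm_nonneg _)
      (Finset.mem_univ j)).trans (le_add_of_nonneg_left
        (Finset.sum_nonneg fun _ _ => norm_nonneg _))
  set K : ℝ → ℝ := fun x => ∑ j, ‖α x j‖ + ∑ k, ‖β x k‖ with hK
  set e : ℝ → ℝ := fun x => ∑ j, ∑ k, ‖E x j k‖ + ∑ k, ∑ j, ‖F x k j‖ with he
  have hRK : ∀ x, R x ≤ K x + e x * R x := by
    intro x
    have h1 : ∑ j, ‖u x j‖ ≤ ∑ j, ‖α x j‖ + (∑ j, ∑ k, ‖E x j k‖) * R x := by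
      rw [Finset.sum_mul, ← Finset.sum_add_distrib]
      refine Finset.sum_le_sum fun j _ => ?_
      rw [hu x j, Finset.sum_mul]
      refine (norm_add_le _ _).trans (add_le_add_right ((norm_sum_le _ _).trans
        (Finset.sum_le_sum fun k _ => ?_)) _)
      rw [norm_mul]
      exact mul_le_mul_of_nonneg_left (hRv x k) (norm_nonneg _)
    have h2 : ∑ k, ‖v x k‖ ≤ ∑ k, ‖β x k‖ + (∑ k, ∑ j, ‖F x k j‖) * R x := by
      rw [Finset.sum_mul, ← Finset.sum_add_distrib]
      refine Finset.sum_le_sum fun k _ => ?_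
      rw [hv x k, Finset.sum_mul]
      refine (norm_add_le _ _).trans (add_le_add_right ((norm_sum_le _ _).trans
        (Finset.sum_le_sum fun j _ => ?_)) _)
      rw [norm_mul]
      exact mul_le_mul_of_nonneg_left (hRu x j) (norm_nonneg _)
    simp only [hR, hK, he] at *
    linarith
  have hKt : Tendsto K l (𝓝 (∑ j, ‖α₀ j‖ + ∑ k, ‖β₀ k‖)) :=
    (tendsto_finsetSum _ fun j _ => (hα j).norm).add (tendsto_finsetSum _ fun j _ => (hβ j).norm)
  have het : Tendsto e l (𝓝 0) := by
    have h : Tendsto e l (𝓝 (∑ j : ι, ∑ k : ι, ‖(0 : ℂ)‖ + ∑ k : ι, ∑ j : ι, ‖(0 : ℂ)‖)) :=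
      (tendsto_finsetSum _ fun j _ => tendsto_finsetSum _ fun k _ => (hE j k).norm).add
      (tendsto_finsetSum _ fun j _ => tendsto_finsetSum _ fun k _ => (hF j k).norm)
    simpa using h
  -- Once e ≤ 1/2 and K is within 1 of its limit, half of R is absorbed on the left.
  have hRb : ∀ᶠ x in l, R x ≤ 2 * (∑ j, ‖α₀ j‖ + ∑ k, ‖β₀ k‖ + 1) := by
    filter_upwards [hKt.eventually_le_const (lt_add_one _),
      het.eventually_le_const (show (0 : ℝ) < 1 / 2 by norm_num)] with x h1 h2
    have h3 := hRK x
    have h4 : 0 ≤ R x := by positivity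
    nlinarith
  have hub : ∀ j, IsBoundedUnder (· ≤ ·) l (norm ∘ fun x => u x j) := fun j =>
    ⟨_, eventually_map.2 (hRb.mono fun x hx => (hRu x j).trans hx)⟩
  have hvb : ∀ j, IsBoundedUnder (· ≤ ·) l (norm ∘ fun x => v x j) := fun j =>
    ⟨_, eventually_map.2 (hRb.mono fun x hx => (hRv x j).trans hx)⟩
  constructor
  · intro j
    simp only [hu]
    simpa using (hα j).add (tendsto_finsetSum _ fun k _ => (hE j k).zero_mul_isBoundedUnder_le
      (hvb k))
  · intro k
    simp only [hv]
    simpa using (hβ k).add (tendsto_finsetSum _ fun j _ => (hF k j).zero_mul_isBoundedUnder_le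
      (hub j))

/-! ### Partial fractions of a Blaschke-type product -/

theorem exists_prod_eq_one_add_cauchySum {ι : Type*} [DecidableEq ι] (a b : ι → ℂ)
    (hb : Function.Injective b) (S : Finset ι) :
    ∃ τ : ι → ℂ, ∀ z, (∀ j, z ≠ b j) →
      ∏ j ∈ S, (z - a j) / (z - b j) = 1 + ∑ j ∈ S, τ j / (z - b j) := by
  induction S using Finset.induction_on with
  | empty => exact ⟨0, by simp⟩
  | insert m S hm ih =>
    obtain ⟨τ, hτ⟩ := ih
    -- The new factor is 1 + (b_m - a_m)/(z - b_m): an old residue is multiplied by its value at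
    -- b_k, and the residue at b_m is b_m - a_m times the old product, in partial fractions, at b_m.
    refine ⟨fun k => if k = m then (b m - a m) * (1 - ∑ k ∈ S, τ k / (b k - b m))
      else τ k * (1 + (b m - a m) / (b k - b m)), fun z hz => ?_⟩
    rw [Finset.prod_insert hm, Finset.sum_insert hm, hτ z hz]
    beta_reduce
    rw [if_pos rfl]
    have hzm := sub_ne_zero.2 (hz m)
    have h1 : ∀ k ∈ S, (if k = m then (b m - a m) * (1 - ∑ k ∈ S, τ k / (b k - b m))
        else τ k * (1 + (b m - a m) / (b k - b m))) / (z - b k) =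
        (z - a m) / (z - b m) * (τ k / (z - b k)) +
          (b m - a m) / (z - b m) * (τ k / (b k - b m)) := by
      intro k hk
      have hkm : k ≠ m := fun h => hm (h ▸ hk)
      rw [if_neg hkm]
      have h2 := sub_ne_zero.2 (hz k)
      have h3 := sub_ne_zero.2 (hb.ne hkm)
      field_simp
      ring
    rw [Finset.sum_congr rfl h1, Finset.sum_add_distrib, ← Finset.mul_sum, ← Finset.mul_sum]
    field_simp
    ring

/-! ### The scattering coefficients and their partial fractions -/

namespace DiscreteData

variable {N : ℕ} (D : DiscreteData N) (δ x t : ℝ)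

/-- The scattering coefficient `s₁₁` (trace formula). -/
noncomputable def s11 (z : ℂ) : ℂ := ∏ j, (z - D.xi j) / (z - conj (D.xi j))

noncomputable def s22 (z : ℂ) : ℂ := ∏ j, (z - conj (D.xi j)) / (z - D.xi j)

theorem s22_eq_conj (z : ℂ) : D.s22 z = conj (D.s11 (conj z)) := by
  simp [s22, s11, map_prod, map_div₀]

theorem conj_xi_injective : Function.Injective fun j => conj (D.xi j) :=
  (starRingEnd ℂ).injective.comp D.xi_injective

/-- The residues of `s₁₁` at `ξ_k^*`. -/
noncomputable def tau : Fin N ⊕ Fin N → ℂ :=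
  (exists_prod_eq_one_add_cauchySum D.xi (fun j => conj (D.xi j)) D.conj_xi_injective
    Finset.univ).choose

theorem s11_eq {z : ℂ} (hz : ∀ j, z ≠ conj (D.xi j)) :
    D.s11 z = 1 + ∑ k, D.tau k / (z - conj (D.xi k)) :=
  (exists_prod_eq_one_add_cauchySum D.xi (fun j => conj (D.xi j)) D.conj_xi_injective
    Finset.univ).choose_spec z hz

theorem s22_eq {z : ℂ} (hz : ∀ j, z ≠ D.xi j) :
    D.s22 z = 1 + ∑ k, conj (D.tau k) / (z - D.xi k) := by
  rw [s22_eq_conj, s11_eq _ fun j h => hz j ((starRingEnd ℂ).injective h)]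
  simp [map_sum, map_div₀]

theorem s11_eq_zero_iff {z : ℂ} (hz : ∀ j, z ≠ conj (D.xi j)) :
    D.s11 z = 0 ↔ ∃ j, z = D.xi j := by
  simp [s11, Finset.prod_eq_zero_iff, sub_eq_zero, hz]

theorem s22_eq_zero_iff {z : ℂ} (hz : ∀ j, z ≠ D.xi j) :
    D.s22 z = 0 ↔ ∃ j, z = conj (D.xi j) := by
  simp [s22, Finset.prod_eq_zero_iff, sub_eq_zero, hz]

theorem s11_xi (j : Fin N ⊕ Fin N) : D.s11 (D.xi j) = 0 :=
  (D.s11_eq_zero_iff (D.xi_ne_conj_xi j)).2 ⟨j, rfl⟩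

theorem s11_mul_s22 {z : ℂ} (hz : ∀ j, z ≠ conj (D.xi j)) (hz' : ∀ j, z ≠ D.xi j) :
    D.s11 z * D.s22 z = 1 := by
  rw [s11, s22, ← Finset.prod_mul_distrib]
  refine Finset.prod_eq_one fun j _ => ?_
  rw [div_mul_div_comm, mul_comm, div_self]
  exact mul_ne_zero (sub_ne_zero.2 (hz j)) (sub_ne_zero.2 (hz' j))

theorem analyticAt_s11 {z : ℂ} (hz : ∀ j, z ≠ conj (D.xi j)) : AnalyticAt ℂ D.s11 z := by
  unfold s11
  refine Finset.analyticAt_fun_prod _ fun j _ => ?_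
  exact (analyticAt_id.sub analyticAt_const).div (analyticAt_id.sub analyticAt_const)
    (sub_ne_zero.2 (hz j))

theorem analyticAt_s22 {z : ℂ} (hz : ∀ j, z ≠ D.xi j) : AnalyticAt ℂ D.s22 z := by
  unfold s22
  refine Finset.analyticAt_fun_prod _ fun j _ => ?_
  exact (analyticAt_id.sub analyticAt_const).div (analyticAt_id.sub analyticAt_const)
    (sub_ne_zero.2 (hz j))

/-- The derivative of `s₁₁` at `ξ_j`. -/
noncomputable def ds11 (j : Fin N ⊕ Fin N) : ℂ := -∑ k, D.tau k / (D.xi j - conj (D.xi k)) ^ 2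

theorem hasDerivAt_s11 (j : Fin N ⊕ Fin N) : HasDerivAt D.s11 (D.ds11 j) (D.xi j) := by
  have h1 : D.s11 =ᶠ[𝓝 (D.xi j)] fun z => 1 + ∑ k, D.tau k / (z - conj (D.xi k)) := by
    have : ∀ᶠ z in 𝓝 (D.xi j), ∀ k, z ≠ conj (D.xi k) :=
      eventually_all.2 fun k => isOpen_ne.mem_nhds (D.xi_ne_conj_xi j k)
    exact this.mono fun z hz => D.s11_eq hz
  refine HasDerivAt.congr_of_eventuallyEq ?_ h1
  have h2 : ∀ k ∈ Finset.univ, HasDerivAt (fun z => D.tau k / (z - conj (D.xi k)))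
      (-(D.tau k / (D.xi j - conj (D.xi k)) ^ 2)) (D.xi j) := by
    intro k _
    have h3 := D.xi_sub_conj_xi j k
    have := ((hasDerivAt_id (D.xi j)).sub_const (conj (D.xi k))).inv h3
    simp only [div_eq_mul_inv]
    refine (this.const_mul (D.tau k)).congr_deriv ?_
    simp only [id]
    field_simp
  refine ((HasDerivAt.fun_sum h2).const_add 1).congr_deriv ?_
  rw [ds11, Finset.sum_neg_distrib]

/-- With the factor z - ξ_j split off, the derivative is the value of the remaining product, nonzero
since the ξ are distinct and avoid all ξ^*. -/
theorem ds11_ne_zero (j : Fin N ⊕ Fin N) : D.ds11 j ≠ 0 := by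
  set h : ℂ → ℂ := fun z => (z - conj (D.xi j))⁻¹ *
    ∏ i ∈ Finset.univ.erase j, (z - D.xi i) / (z - conj (D.xi i)) with hh
  have e : D.s11 = fun z => (z - D.xi j) * h z := by
    funext z
    rw [s11, ← Finset.mul_prod_erase _ _ (Finset.mem_univ j), hh]
    ring
  have hd : DifferentiableAt ℂ h (D.xi j) := by
    refine AnalyticAt.differentiableAt ?_
    refine ((analyticAt_id.sub analyticAt_const).inv (D.xi_sub_conj_xi j j)).mul
      (Finset.analyticAt_fun_prod _ fun i _ => ?_)
    exact (analyticAt_id.sub analyticAt_const).div (analyticAt_id.sub analyticAt_const)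
      (D.xi_sub_conj_xi j i)
  have h1 := (((hasDerivAt_id (D.xi j)).sub_const (D.xi j)).mul hd.hasDerivAt)
  have h2 : D.ds11 j = h (D.xi j) := by
    refine (D.hasDerivAt_s11 j).unique (e ▸ h1.congr_deriv ?_)
    simp
  rw [h2, hh]
  refine mul_ne_zero (inv_ne_zero (D.xi_sub_conj_xi j j)) (Finset.prod_ne_zero_iff.2 fun i hi => ?_)
  exact div_ne_zero (sub_ne_zero.2 (D.xi_injective.ne (Finset.ne_of_mem_erase hi).symm))
    (D.xi_sub_conj_xi j i)

theorem hasDerivAt_s22 (k : Fin N ⊕ Fin N) :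
    HasDerivAt D.s22 (conj (D.ds11 k)) (conj (D.xi k)) := by
  have h : D.s22 = conj ∘ D.s11 ∘ conj := by funext z; exact D.s22_eq_conj z
  rw [h]
  exact HasDerivAt.conj_conj (D.hasDerivAt_s11 k)

/-- The zero of s₁₁ at ξ_j, read off its partial fractions. -/
theorem sum_tau_div (j : Fin N ⊕ Fin N) : ∑ k, D.tau k / (D.xi j - conj (D.xi k)) = -1 := by
  have h1 := D.s11_eq (D.xi_ne_conj_xi j)
  rw [s11_xi] at h1
  linear_combination -h1

/-- The divided difference of `s₁₁` at two of its zeros. -/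
theorem sum_tau_div_mul (i j : Fin N ⊕ Fin N) :
    ∑ k, D.tau k / ((conj (D.xi k) - D.xi i) * (D.xi j - conj (D.xi k))) =
      if i = j then D.ds11 j else 0 := by
  split_ifs with h
  · subst h
    rw [ds11, ← Finset.sum_neg_distrib]
    refine Finset.sum_congr rfl fun k _ => ?_
    have h1 := D.xi_sub_conj_xi i k
    rw [← neg_sub (D.xi i)]
    field_simp
  · have h1 := sub_ne_zero.2 (D.xi_injective.ne h)
    have h2 : ∀ k, D.tau k / ((conj (D.xi k) - D.xi i) * (D.xi j - conj (D.xi k))) =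
        (D.tau k / (D.xi i - conj (D.xi k)) - D.tau k / (D.xi j - conj (D.xi k))) /
          (D.xi i - D.xi j) := by
      intro k
      have h3 := D.xi_sub_conj_xi i k
      have h4 := D.xi_sub_conj_xi j k
      rw [← neg_sub (D.xi i)]
      field_simp
      ring
    simp only [h2]
    rw [← Finset.sum_div, Finset.sum_sub_distrib, sum_tau_div, sum_tau_div, sub_self, zero_div]

theorem s11_zero_eq : D.s11 0 = 1 - ∑ k, D.tau k / conj (D.xi k) := by
  rw [s11_eq _ fun j => (D.conj_xi_ne_zero j).symm, sub_eq_add_neg, ← Finset.sum_neg_distrib]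
  simp [div_neg]

/-- At z = 0 both members of a pair z_n, -q₀²/z_n^* contribute the same factor z_n / z_n^*, whence
the square. -/
theorem qp_eq : D.qp = D.qm * D.s11 0 := by
  rw [qp, s11, Fintype.prod_sum_type, ← Finset.prod_mul_distrib]
  congr 1
  refine Finset.prod_congr rfl fun n _ => ?_
  have h0 := D.q₀_ne_zero
  have h1 := D.ev_ne_zero n
  have h2 := D.conj_ev_ne_zero n
  simp only [xi_inl, xi_inr, map_div₀, map_neg, map_pow, Complex.conj_conj, Complex.conj_ofReal]
  field_simp
  ring_nf

theorem norm_qp : ‖D.qp‖ = D.q₀ := by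
  rw [qp, norm_mul, D.norm_qm, norm_prod, Finset.prod_eq_one, mul_one]
  intro n _
  have := norm_ne_zero_iff.2 (D.ev_ne_zero n)
  simp [this]

/-! ### The Riemann–Hilbert problem normalized at `x → +∞` -/

/-- Partial fractions of s₁₁ φ₂₁: the zeros of s₁₁ cancel the poles ξ_j, its poles create ξ_k^* with
residue τ_k φ₂₁(ξ_k^*) = τ_k Z_k, and at 0 the factor s₁₁(0) turns q₋ into q₊. The other entries are
analogous, with s₂₂ for the second column. -/
noncomputable def psi21 (z : ℂ) : ℂ := D.qp / z + ∑ k, D.tau k * D.Z δ x t k / (z - conj (D.xi k))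

noncomputable def psi22 (z : ℂ) : ℂ := 1 + ∑ j, conj (D.tau j) * D.X δ x t j / (z - D.xi j)

noncomputable def psi11 (z : ℂ) : ℂ :=
  1 + ∑ k, D.tau k * conj (D.X δ x t k) / (z - conj (D.xi k))

noncomputable def psi12 (z : ℂ) : ℂ :=
  -conj D.qp / z - ∑ j, conj (D.tau j) * conj (D.Z δ x t j) / (z - D.xi j)

theorem psi11_eq_conj (z : ℂ) : D.psi11 δ x t z = conj (D.psi22 δ x t (conj z)) := by
  simp [psi11, psi22, map_sum, map_div₀]

theorem psi12_eq_neg_conj (z : ℂ) : D.psi12 δ x t z = -conj (D.psi21 δ x t (conj z)) := by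
  simp [psi12, psi21, map_sum, map_div₀]
  ring

/-- In the product of the two Cauchy sums the residues at ξ_j carry the factor s₁₁(ξ_j) - 1 = -1,
which removes the poles of φ₂₁. -/
theorem psi21_eq {z : ℂ} (h0 : z ≠ 0) (hz : ∀ j, z ≠ conj (D.xi j)) (hz' : ∀ j, z ≠ D.xi j) :
    D.psi21 δ x t z = D.s11 z * D.phi21 δ x t z := by
  have h1 := cauchySum_mul_cauchySum (fun j => D.Y δ x t j * D.X δ x t j) D.tau D.xi
    (fun k => conj (D.xi k)) D.xi_ne_conj_xi z hz' hz
  have h2 : ∀ k, ∑ j, D.Y δ x t j * D.X δ x t j / (conj (D.xi k) - D.xi j) =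
      D.Z δ x t k - D.qm / conj (D.xi k) := by intro k; rw [Z_eq]; ring
  simp only [sum_tau_div, h2, mul_neg, mul_one, Finset.sum_neg_distrib] at h1
  have h3 : ∑ k, D.tau k / (z - conj (D.xi k)) * (D.Z δ x t k - D.qm / conj (D.xi k)) =
      ∑ k, D.tau k * D.Z δ x t k / (z - conj (D.xi k)) -
      D.qm / z * (∑ k, D.tau k / conj (D.xi k) + ∑ k, D.tau k / (z - conj (D.xi k))) := by
    rw [← Finset.sum_add_distrib, Finset.mul_sum, ← Finset.sum_sub_distrib]
    refine Finset.sum_congr rfl fun k _ => ?_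
    have h4 := sub_ne_zero.2 (hz k)
    have h5 := D.conj_xi_ne_zero k
    field_simp
    ring
  rw [h3] at h1
  rw [psi21, phi21, s11_eq _ hz, qp_eq, s11_zero_eq]
  linear_combination -h1

theorem psi22_eq {z : ℂ} (hz : ∀ j, z ≠ conj (D.xi j)) (hz' : ∀ j, z ≠ D.xi j) :
    D.psi22 δ x t z = D.s22 z * D.phi22 δ x t z := by
  have h1 := cauchySum_mul_cauchySum (fun j => conj (D.tau j))
    (fun k => conj (D.Y δ x t k) * D.Z δ x t k) D.xi
    (fun k => conj (D.xi k)) D.xi_ne_conj_xi z hz' hz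
  have h2 : ∀ j, ∑ k, conj (D.Y δ x t k) * D.Z δ x t k / (D.xi j - conj (D.xi k)) =
      1 - D.X δ x t j := by intro k; rw [X_eq]; ring
  have h3 : ∀ k, ∑ j, conj (D.tau j) / (conj (D.xi k) - D.xi j) = -1 := by
    intro k
    have := congrArg conj (D.sum_tau_div k)
    simpa [map_sum, map_div₀] using this
  simp only [h2, h3, mul_neg, mul_one, Finset.sum_neg_distrib, mul_sub,
    Finset.sum_sub_distrib] at h1
  have h4 : ∑ j, conj (D.tau j) / (z - D.xi j) * D.X δ x t j =
      ∑ j, conj (D.tau j) * D.X δ x t j / (z - D.xi j) :=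
    Finset.sum_congr rfl fun j _ => by ring
  rw [h4] at h1
  rw [psi22, phi22, s22_eq _ hz']
  linear_combination h1

theorem psi11_eq {z : ℂ} (hz : ∀ j, z ≠ conj (D.xi j)) (hz' : ∀ j, z ≠ D.xi j) :
    D.psi11 δ x t z = D.s11 z * D.phi11 δ x t z := by
  rw [psi11_eq_conj, psi22_eq, s22_eq_conj, phi11_eq_conj, map_mul, Complex.conj_conj,
    Complex.conj_conj]
  · exact fun j h => hz' j ((starRingEnd ℂ).injective h)
  · exact fun j h => hz j (by rw [← h, Complex.conj_conj])

theorem psi12_eq {z : ℂ} (h0 : z ≠ 0) (hz : ∀ j, z ≠ conj (D.xi j)) (hz' : ∀ j, z ≠ D.xi j) :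
    D.psi12 δ x t z = D.s22 z * D.phi12 δ x t z := by
  rw [psi12_eq_neg_conj, psi21_eq, s22_eq_conj, phi12_eq_neg_conj, map_mul, mul_neg]
  · exact (map_ne_zero _).2 h0
  · exact fun j h => hz' j ((starRingEnd ℂ).injective h)
  · exact fun j h => hz j (by rw [← h, Complex.conj_conj])

/-- At ξ_j a zero of s₁₁ meets a simple pole of φ₂₁, leaving s₁₁'(ξ_j) times the residue;
algebraically, the divided differences of s₁₁ act as a Kronecker delta. This is the norming
relation, and its reading as a formula for X_j involves 1/Y_j. -/
theorem psi21_xi (j : Fin N ⊕ Fin N) :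
    D.psi21 δ x t (D.xi j) = D.ds11 j * D.Y δ x t j * D.X δ x t j := by
  have h0 := D.xi_ne_zero j
  have h1 : ∀ k, D.tau k * D.Z δ x t k / (D.xi j - conj (D.xi k)) =
      D.qm / D.xi j * (D.tau k / conj (D.xi k) + D.tau k / (D.xi j - conj (D.xi k))) +
      ∑ i, D.Y δ x t i * D.X δ x t i *
        (D.tau k / ((conj (D.xi k) - D.xi i) * (D.xi j - conj (D.xi k)))) := by
    intro k
    have h3 := D.conj_xi_ne_zero k
    have h4 := D.xi_sub_conj_xi j k
    rw [Z_eq, mul_add, add_div, Finset.mul_sum, Finset.sum_div]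
    congr 1
    · field_simp
      ring
    · refine Finset.sum_congr rfl fun i _ => ?_
      have h5 := D.conj_xi_sub_xi i k
      field_simp
  simp only [psi21, h1]
  rw [Finset.sum_add_distrib, Finset.sum_comm, ← Finset.mul_sum, Finset.sum_add_distrib,
    sum_tau_div, qp_eq, s11_zero_eq]
  simp only [← Finset.mul_sum, sum_tau_div_mul, mul_ite, mul_zero]
  rw [Finset.sum_ite_eq' Finset.univ j]
  simp only [Finset.mem_univ, if_true]
  ring

theorem psi22_conj_xi (l : Fin N ⊕ Fin N) :
    D.psi22 δ x t (conj (D.xi l)) = -(conj (D.ds11 l) * conj (D.Y δ x t l) * D.Z δ x t l) := by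
  have h1 : ∀ j, conj (D.tau j) * D.X δ x t j / (conj (D.xi l) - D.xi j) =
      conj (D.tau j) / (conj (D.xi l) - D.xi j) -
      ∑ k, conj (D.Y δ x t k) * D.Z δ x t k *
        (conj (D.tau j) / ((D.xi j - conj (D.xi k)) * (conj (D.xi l) - D.xi j))) := by
    intro j
    have h4 := D.conj_xi_sub_xi j l
    rw [X_eq, mul_sub, mul_one, sub_div, Finset.mul_sum, Finset.sum_div]
    congr 1
    refine Finset.sum_congr rfl fun k _ => ?_
    have h5 := D.xi_sub_conj_xi j k
    field_simp
  have h2 : ∑ j, conj (D.tau j) / (conj (D.xi l) - D.xi j) = -1 := by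
    have := congrArg conj (D.sum_tau_div l)
    simpa [map_sum, map_div₀] using this
  have h3 : ∀ k, ∑ j, conj (D.tau j) / ((D.xi j - conj (D.xi k)) * (conj (D.xi l) - D.xi j)) =
      if k = l then conj (D.ds11 l) else 0 := by
    intro k
    have := congrArg conj (D.sum_tau_div_mul k l)
    simpa [map_sum, map_div₀, apply_ite] using this
  simp only [psi22, h1]
  rw [Finset.sum_sub_distrib, Finset.sum_comm, h2]
  simp only [← Finset.mul_sum, h3, mul_ite, mul_zero]
  rw [Finset.sum_ite_eq' Finset.univ l]
  simp only [Finset.mem_univ, if_true]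
  ring

theorem psi11_xi (j : Fin N ⊕ Fin N) :
    D.psi11 δ x t (D.xi j) = D.ds11 j * D.Y δ x t j * -conj (D.Z δ x t j) := by
  rw [psi11_eq_conj, psi22_conj_xi]
  simp

theorem psi12_conj_xi (k : Fin N ⊕ Fin N) : D.psi12 δ x t (conj (D.xi k)) =
    -(conj (D.ds11 k) * conj (D.Y δ x t k) * conj (D.X δ x t k)) := by
  rw [psi12_eq_neg_conj, Complex.conj_conj, psi21_xi]
  simp

/-- The potential as the 1/z coefficient of ψ₂₁ at infinity, unchanged since s₁₁ → 1. In this form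
no growing Y_j occurs, as the limit x → +∞ requires. -/
theorem potential_eq_qp_add : D.potential δ x t = D.qp + ∑ k, D.tau k * D.Z δ x t k := by
  have h1 : ∀ k, D.tau k * D.Z δ x t k = D.qm * (D.tau k / conj (D.xi k)) -
      ∑ i, D.Y δ x t i * D.X δ x t i * (D.tau k / (D.xi i - conj (D.xi k))) := by
    intro k
    rw [Z_eq, mul_add, Finset.mul_sum, sub_eq_add_neg, ← Finset.sum_neg_distrib]
    congr 1
    · ring
    · refine Finset.sum_congr rfl fun i _ => ?_
      rw [← neg_sub (D.xi i), div_neg]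
      ring
  simp only [h1]
  rw [Finset.sum_sub_distrib, Finset.sum_comm]
  simp only [← Finset.mul_sum, sum_tau_div]
  rw [potential_eq, qp_eq, s11_zero_eq]
  simp
  ring

/-! ### Limits as `x → ±∞` -/

/-- Im λ = (|z|² - q₀²) Im z / (2|z|²), whose sign defines D⁺. Thus |Y_j| decays at -∞ and grows at
+∞. -/
theorem lam_im_pos {q₀ : ℝ} {z : ℂ} (hz : z ∈ Dplus q₀) : 0 < (lam q₀ z).im := by
  have hz0 : z ≠ 0 := by rintro rfl; simp [Dplus] at hz
  have hn : 0 < ‖z‖ := norm_pos_iff.2 hz0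
  have h1 : (lam q₀ z).im = (‖z‖ ^ 2 - q₀ ^ 2) * z.im / (2 * ‖z‖ ^ 2) := by
    have : lam q₀ z = ((1 / 2 : ℝ) : ℂ) * z + ((q₀ ^ 2 / (2 * ‖z‖ ^ 2) : ℝ) : ℂ) * conj z := by
      have h3 : conj z ≠ 0 := (map_ne_zero _).2 hz0
      have h2 : ((2 * ‖z‖ ^ 2 : ℝ) : ℂ) = 2 * (z * conj z) := by
        rw [Complex.mul_conj, Complex.normSq_eq_norm_sq]; push_cast; ring
      rw [Complex.ofReal_div (q₀ ^ 2), h2, lam]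
      push_cast
      field_simp
    rw [this, Complex.add_im, Complex.im_ofReal_mul, Complex.im_ofReal_mul, Complex.conj_im]
    field_simp
    ring
  rw [h1]
  exact div_pos hz (by positivity)

theorem Y_eq_mul_exp (j : Fin N ⊕ Fin N) : D.Y δ x t j =
    D.Y δ 0 t j * Complex.exp (-2 * Complex.I * lam D.q₀ (D.xi j) * x) := by
  simp only [Y, theta_eq]
  rw [mul_assoc (D.C j), ← Complex.exp_add]
  congr 2
  push_cast
  ring

theorem norm_Y (j : Fin N ⊕ Fin N) : ‖D.Y δ x t j‖ =
    ‖D.Y δ 0 t j‖ * Real.exp (2 * (lam D.q₀ (D.xi j)).im * x) := by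
  rw [Y_eq_mul_exp, norm_mul, Complex.norm_exp]
  congr 2
  simp

theorem tendsto_Y_atBot (j : Fin N ⊕ Fin N) :
    Tendsto (fun x => D.Y δ x t j) atBot (𝓝 0) := by
  rw [tendsto_zero_iff_norm_tendsto_zero]
  have h : (fun x => ‖D.Y δ x t j‖) = fun x => ‖D.Y δ 0 t j‖ *
      Real.exp (2 * (lam D.q₀ (D.xi j)).im * x) := funext fun y => D.norm_Y δ y t j
  rw [h]
  suffices Tendsto (fun x => 2 * (lam D.q₀ (D.xi j)).im * x) atBot atBot by
    simpa using (Real.tendsto_exp_atBot.comp this).const_mul ‖D.Y δ 0 t j‖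
  exact tendsto_id.const_mul_atBot (mul_pos two_pos (lam_im_pos (D.xi_mem_Dplus j)))

theorem tendsto_inv_Y_atTop (j : Fin N ⊕ Fin N) :
    Tendsto (fun x => (D.Y δ x t j)⁻¹) atTop (𝓝 0) := by
  rw [tendsto_zero_iff_norm_tendsto_zero]
  have h : (fun x => ‖(D.Y δ x t j)⁻¹‖) = (fun x => ‖D.Y δ 0 t j‖ *
      Real.exp (2 * (lam D.q₀ (D.xi j)).im * x))⁻¹ :=
    funext fun y => by rw [norm_inv, D.norm_Y δ y t j, Pi.inv_apply]
  rw [h]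
  refine Tendsto.inv_tendsto_atTop ?_
  refine (Real.tendsto_exp_atTop.comp ?_).const_mul_atTop (norm_pos_iff.2 (D.Y_ne_zero δ 0 t j))
  exact tendsto_id.const_mul_atTop (mul_pos two_pos (lam_im_pos (D.xi_mem_Dplus j)))

theorem tendsto_X_Z_atBot :
    (∀ j, Tendsto (fun x => D.X δ x t j) atBot (𝓝 1)) ∧
    (∀ k, Tendsto (fun x => D.Z δ x t k) atBot (𝓝 (D.qm / conj (D.xi k)))) := by
  refine tendsto_of_coupling_tendsto_zero (α := fun _ _ => 1)
    (β := fun _ k => D.qm / conj (D.xi k))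
    (E := fun x j k => -(conj (D.Y δ x t k) / (D.xi j - conj (D.xi k))))
    (F := fun x k j => D.Y δ x t j / (conj (D.xi k) - D.xi j)) ?_ ?_
    (fun _ => tendsto_const_nhds) (fun _ => tendsto_const_nhds) ?_ ?_
  · intro x j
    rw [X_eq, sub_eq_add_neg, ← Finset.sum_neg_distrib]
    congr 1
    exact Finset.sum_congr rfl fun k _ => by ring
  · intro x k
    rw [Z_eq]
    congr 1
    exact Finset.sum_congr rfl fun k _ => by ring
  · intro j k
    simpa using ((tendsto_conj (D.tendsto_Y_atBot δ t k)).div_const (D.xi j - conj (D.xi k))).neg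
  · intro j k
    simpa using (D.tendsto_Y_atBot δ t k).div_const (conj (D.xi j) - D.xi k)

/-- The norming relations ψ₂₁(ξ_j) = s₁₁'(ξ_j) Y_j X_j and their conjugate partners, solved for X
and Z, form an equivalent system with coupling of order 1/Y_j, which is weak at +∞. -/
theorem tendsto_X_Z_atTop :
    (∀ j, Tendsto (fun x => D.X δ x t j) atTop (𝓝 0)) ∧
    (∀ k, Tendsto (fun x => D.Z δ x t k) atTop (𝓝 0)) := by
  have hY : ∀ j, Tendsto (fun x => (D.ds11 j * D.Y δ x t j)⁻¹) atTop (𝓝 0) := by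
    intro j
    simp only [mul_inv]
    simpa using (D.tendsto_inv_Y_atTop δ t j).const_mul (D.ds11 j)⁻¹
  have hYc : ∀ j, Tendsto (fun x => -(conj (D.ds11 j * D.Y δ x t j))⁻¹) atTop (𝓝 0) := by
    intro j
    simpa using (tendsto_conj (hY j)).neg
  refine tendsto_of_coupling_tendsto_zero (α₀ := fun _ => 0) (β₀ := fun _ => 0)
    (α := fun x j => (D.ds11 j * D.Y δ x t j)⁻¹ * (D.qp / D.xi j))
    (β := fun x k => -(conj (D.ds11 k * D.Y δ x t k))⁻¹)
    (E := fun x j k => (D.ds11 j * D.Y δ x t j)⁻¹ * (D.tau k / (D.xi j - conj (D.xi k))))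
    (F := fun x k j => -(conj (D.ds11 k * D.Y δ x t k))⁻¹ *
      (conj (D.tau j) / (conj (D.xi k) - D.xi j))) ?_ ?_
    (fun j => by simpa using (hY j).mul_const (D.qp / D.xi j)) hYc
    (fun j k => by simpa using (hY j).mul_const (D.tau k / (D.xi j - conj (D.xi k))))
    (fun k j => by simpa using (hYc k).mul_const (conj (D.tau j) / (conj (D.xi k) - D.xi j)))
  · intro x j
    have h1 := D.psi21_xi δ x t j
    have h2 := mul_ne_zero (D.ds11_ne_zero j) (D.Y_ne_zero δ x t j)
    have h3 : D.X δ x t j = (D.ds11 j * D.Y δ x t j)⁻¹ * D.psi21 δ x t (D.xi j) := by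
      rw [h1, inv_mul_cancel_left₀ h2]
    rw [h3, psi21, mul_add, Finset.mul_sum]
    congr 1
    exact Finset.sum_congr rfl fun k _ => by ring
  · intro x k
    have h1 := D.psi22_conj_xi δ x t k
    have h2 : conj (D.ds11 k * D.Y δ x t k) ≠ 0 :=
      (map_ne_zero _).2 (mul_ne_zero (D.ds11_ne_zero k) (D.Y_ne_zero δ x t k))
    have h3 : D.Z δ x t k = -(conj (D.ds11 k * D.Y δ x t k))⁻¹ *
        D.psi22 δ x t (conj (D.xi k)) := by
      rw [h1, ← map_mul, neg_mul_neg, inv_mul_cancel_left₀ h2]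
    rw [h3, psi22, mul_add, mul_one, Finset.mul_sum]
    congr 1
    exact Finset.sum_congr rfl fun k _ => by ring

theorem tendsto_potential_atBot : Tendsto (fun x => D.potential δ x t) atBot (𝓝 D.qm) := by
  simp only [potential_eq]
  simpa using tendsto_const_nhds.add (tendsto_finsetSum Finset.univ fun j _ =>
    (D.tendsto_Y_atBot δ t j).mul ((D.tendsto_X_Z_atBot δ t).1 j))

theorem tendsto_potential_atTop : Tendsto (fun x => D.potential δ x t) atTop (𝓝 D.qp) := by
  simp only [potential_eq_qp_add]
  simpa using tendsto_const_nhds.add (tendsto_finsetSum Finset.univ fun j _ =>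
    ((D.tendsto_X_Z_atTop δ t).2 j).const_mul (D.tau j))

theorem tendsto_phi21_atBot (z : ℂ) :
    Tendsto (fun x => D.phi21 δ x t z) atBot (𝓝 (D.qm / z)) := by
  simp only [phi21]
  simpa using tendsto_const_nhds.add (tendsto_finsetSum Finset.univ fun j _ =>
    ((D.tendsto_Y_atBot δ t j).mul ((D.tendsto_X_Z_atBot δ t).1 j)).div_const (z - D.xi j))

theorem tendsto_phi22_atBot (z : ℂ) : Tendsto (fun x => D.phi22 δ x t z) atBot (𝓝 1) := by
  have h : ∀ k, Tendsto (fun x => conj (D.Y δ x t k)) atBot (𝓝 0) := fun k => by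
    simpa using tendsto_conj (D.tendsto_Y_atBot δ t k)
  simp only [phi22]
  simpa using tendsto_const_nhds.sub (tendsto_finsetSum Finset.univ fun j _ =>
    ((h j).mul ((D.tendsto_X_Z_atBot δ t).2 j)).div_const (z - conj (D.xi j)))

theorem tendsto_psi21_atTop (z : ℂ) :
    Tendsto (fun x => D.psi21 δ x t z) atTop (𝓝 (D.qp / z)) := by
  simp only [psi21]
  simpa using tendsto_const_nhds.add (tendsto_finsetSum Finset.univ fun j _ =>
    (((D.tendsto_X_Z_atTop δ t).2 j).const_mul (D.tau j)).div_const (z - conj (D.xi j)))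

theorem tendsto_psi22_atTop (z : ℂ) : Tendsto (fun x => D.psi22 δ x t z) atTop (𝓝 1) := by
  simp only [psi22]
  simpa using tendsto_const_nhds.add (tendsto_finsetSum Finset.univ fun j _ =>
    (((D.tendsto_X_Z_atTop δ t).1 j).const_mul (conj (D.tau j))).div_const (z - D.xi j))

theorem tendsto_phi11_atBot (z : ℂ) : Tendsto (fun x => D.phi11 δ x t z) atBot (𝓝 1) := by
  simp only [phi11_eq_conj]
  simpa using tendsto_conj (D.tendsto_phi22_atBot δ t (conj z))

theorem tendsto_phi12_atBot (z : ℂ) :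
    Tendsto (fun x => D.phi12 δ x t z) atBot (𝓝 (-conj D.qm / z)) := by
  simp only [phi12_eq_neg_conj]
  simpa [map_div₀, neg_div] using (tendsto_conj (D.tendsto_phi21_atBot δ t (conj z))).neg

theorem tendsto_psi11_atTop (z : ℂ) : Tendsto (fun x => D.psi11 δ x t z) atTop (𝓝 1) := by
  simp only [psi11_eq_conj]
  simpa using tendsto_conj (D.tendsto_psi22_atTop δ t (conj z))

theorem tendsto_psi12_atTop (z : ℂ) :
    Tendsto (fun x => D.psi12 δ x t z) atTop (𝓝 (-conj D.qp / z)) := by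
  simp only [psi12_eq_neg_conj]
  simpa [map_div₀, neg_div] using (tendsto_conj (D.tendsto_psi21_atTop δ t (conj z))).neg

/-! ### The determinant -/

/-- The diagonal coefficients in the equations of the two columns cancel in the Wronskian, so it is
constant in x; its value is the determinant of Y₋, the limit at -∞. -/
theorem det_phi {z : ℂ} (hz : z ≠ 0) (hξ : ∀ j, z ≠ D.xi j) (hξ' : ∀ j, z ≠ conj (D.xi j)) :
    D.phi11 δ x t z * D.phi22 δ x t z - D.phi21 δ x t z * D.phi12 δ x t z =
      1 + (D.q₀ : ℂ) ^ 2 / z ^ 2 := by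
  set w : ℝ → ℂ := fun y => D.phi11 δ y t z * D.phi22 δ y t z - D.phi21 δ y t z * D.phi12 δ y t z
  have hw : ∀ y, HasDerivAt w 0 y := by
    intro y
    refine (((D.hasDerivAt_phi11 δ y t hz hξ).mul (D.hasDerivAt_phi22 δ y t hz hξ')).sub
      ((D.hasDerivAt_phi21 δ y t hz hξ).mul (D.hasDerivAt_phi12 δ y t hz hξ'))).congr_deriv ?_
    ring
  have hconst : ∀ y, w y = w x := fun y =>
    is_const_of_deriv_eq_zero (fun y => (hw y).differentiableAt) (fun y => (hw y).deriv) y x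
  have hlim : Tendsto w atBot (𝓝 (1 * 1 - D.qm / z * (-conj D.qm / z))) :=
    ((D.tendsto_phi11_atBot δ t z).mul (D.tendsto_phi22_atBot δ t z)).sub
      ((D.tendsto_phi21_atBot δ t z).mul (D.tendsto_phi12_atBot δ t z))
  have h : w x = 1 * 1 - D.qm / z * (-conj D.qm / z) :=
    tendsto_nhds_unique (tendsto_const_nhds.congr fun y => (hconst y).symm) hlim
  refine h.trans ?_
  rw [← D.qm_mul_conj]
  field_simp
  ring

end DiscreteData

set_option linter.unusedSimpArgs false

/-! ### The recursion for the squared eigenfunctions -/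

theorem eq_of_hasDerivAt_zero_of_tendsto {f : ℝ → ℂ} {L : ℂ} (hf : ∀ x, HasDerivAt f 0 x)
    (hL : Tendsto f atBot (𝓝 L)) (x : ℝ) : f x = L := by
  have hconst : ∀ y, f y = f x := fun y =>
    is_const_of_deriv_eq_zero (fun y => (hf y).differentiableAt) (fun y => (hf y).deriv) y x
  exact tendsto_nhds_unique (tendsto_const_nhds.congr fun y => (hconst y).symm) hL

/-- The coefficients `c_m` and `a_m` of `k^{-m}` (`p_n` is the `n`-th derivative of the
potential) in the entries `21` and `11` of a solution `Ω` of
`Ω_x = [i k σ₃ + Q, Ω]`, `Ω² = -(k² + q₀²)`, that decay as `x → -∞`. -/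
structure IsLaxHierarchy (q₀ qm : ℂ) (p : ℕ → ℝ → ℂ) (a c : ℕ → ℝ → ℂ) : Prop where
  norm_sq : qm * conj qm = q₀ ^ 2
  conj_q₀ : conj q₀ = q₀
  deriv_p : ∀ n x, HasDerivAt (p n) (p (n + 1) x) x
  deriv_q : ∀ x, HasDerivAt (p 0) (-2 * c 1 x) x
  deriv_c : ∀ m x, 1 ≤ m → HasDerivAt (c m)
    (-2 * Complex.I * c (m + 1) x + 2 * Complex.I * (p 0 x * a m x)) x
  deriv_a : ∀ m x, 1 ≤ m → HasDerivAt (a m)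
    (Complex.I * (conj (p 0 x) * c m x + p 0 x * conj (c m x))) x
  lim_q : Tendsto (p 0) atBot (𝓝 qm)
  lim_c : ∀ m, 1 ≤ m → Tendsto (c m) atBot (𝓝 0)
  lim_a : ∀ m, 1 ≤ m → Tendsto (a m) atBot (𝓝 0)

namespace IsLaxHierarchy

variable {q₀ qm : ℂ} {p : ℕ → ℝ → ℂ} {a c : ℕ → ℝ → ℂ}

/-- The derivative of a_m is i times a real function and a_m vanishes at -∞. -/
theorem conj_a (h : IsLaxHierarchy q₀ qm p a c) (m : ℕ) (hm : 1 ≤ m) (x : ℝ) :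
    conj (a m x) = -a m x := by
  have h1 : a m x + conj (a m x) = 0 := by
    refine eq_of_hasDerivAt_zero_of_tendsto (f := fun x => a m x + conj (a m x)) (fun x => ?_) ?_ x
    · refine ((h.deriv_a m x hm).add (hasDerivAt_conj (h.deriv_a m x hm))).congr_deriv ?_
      simp
      ring
    · simpa using (h.lim_a m hm).add (tendsto_conj (h.lim_a m hm))
  linear_combination h1

theorem deriv_conj_p (h : IsLaxHierarchy q₀ qm p a c) (n : ℕ) (x : ℝ) :
    HasDerivAt (fun y => conj (p n y)) (conj (p (n + 1) x)) x :=
  hasDerivAt_conj (h.deriv_p n x)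

theorem deriv_conj_q (h : IsLaxHierarchy q₀ qm p a c) (x : ℝ) :
    HasDerivAt (fun x => conj (p 0 x)) (-2 * conj (c 1 x)) x := by
  simpa [Complex.conj_ofNat] using hasDerivAt_conj (h.deriv_q x)

theorem deriv_conj_c (h : IsLaxHierarchy q₀ qm p a c) (m : ℕ) (x : ℝ) (hm : 1 ≤ m) : HasDerivAt
    (fun x => conj (c m x))
    (2 * Complex.I * conj (c (m + 1) x) + 2 * Complex.I * (conj (p 0 x) * a m x)) x := by
  refine (hasDerivAt_conj (h.deriv_c m x hm)).congr_deriv ?_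
  simp [Complex.conj_ofNat, h.conj_a m hm]

/-- The k⁰ coefficient of Ω₁₁² + Ω₁₂ Ω₂₁ = -(k² + q₀²), where Ω₁₂ has coefficients -c_m^*. It is
constant in x by the Lax equation and is evaluated at -∞, which integrates a_1 in closed form. The
formulas for a_2 to a_5 come from the next powers of 1/k. -/
theorem a_one (h : IsLaxHierarchy q₀ qm p a c) (x : ℝ) : a 1 x = Complex.I *
    ((q₀ ^ 2 - p 0 x * conj (p 0 x)) / 2) := by
  have h1 : 2 * Complex.I * a 1 x - p 0 x * conj (p 0 x) = -q₀ ^ 2 := by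
    refine eq_of_hasDerivAt_zero_of_tendsto
      (f := fun x => 2 * Complex.I * a 1 x - p 0 x * conj (p 0 x)) (fun x => ?_) ?_ x
    · refine (((h.deriv_a 1 x le_rfl).const_mul (2 * Complex.I)).sub
        ((h.deriv_q x).mul (h.deriv_conj_q x))).congr_deriv ?_
      linear_combination (2 * (conj (p 0 x) * c 1 x + p 0 x * conj (c 1 x))) * Complex.I_mul_I
    · simpa [h.norm_sq] using ((h.lim_a 1 le_rfl).const_mul (2 * Complex.I)).sub
        (h.lim_q.mul (tendsto_conj h.lim_q))
  linear_combination (-Complex.I / 2) * h1 + (a 1 x) * Complex.I_mul_I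

theorem a_two (h : IsLaxHierarchy q₀ qm p a c) (x : ℝ) : a 2 x = (p 0 x * conj (c 1 x) - conj
    (p 0 x) * c 1 x) / 2 := by
  have h1 : 2 * a 2 x - p 0 x * conj (c 1 x) + conj (p 0 x) * c 1 x = 0 := by
    refine eq_of_hasDerivAt_zero_of_tendsto
      (f := fun x => 2 * a 2 x - p 0 x * conj (c 1 x) + conj (p 0 x) * c 1 x) (fun x => ?_) ?_ x
    · refine ((((h.deriv_a 2 x one_le_two).const_mul 2).sub
        ((h.deriv_q x).mul (h.deriv_conj_c 1 x le_rfl))).add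
        ((h.deriv_conj_q x).mul (h.deriv_c 1 x le_rfl))).congr_deriv ?_
      ring
    · simpa using (((h.lim_a 2 one_le_two).const_mul 2).sub
        (h.lim_q.mul (tendsto_conj (h.lim_c 1 le_rfl)))).add
        ((tendsto_conj h.lim_q).mul (h.lim_c 1 le_rfl))
  linear_combination (1 / 2) * h1

theorem a_three (h : IsLaxHierarchy q₀ qm p a c) (x : ℝ) : a 3 x = Complex.I / 2 *
    (a 1 x ^ 2 - c 1 x * conj (c 1 x) +
    Complex.I * (conj (p 0 x) * c 2 x - p 0 x * conj (c 2 x))) := by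
  have h1 : 2 * Complex.I * a 3 x + a 1 x ^ 2 - c 1 x * conj (c 1 x) +
      Complex.I * (conj (p 0 x) * c 2 x - p 0 x * conj (c 2 x)) = 0 := by
    refine eq_of_hasDerivAt_zero_of_tendsto (f := fun x => 2 * Complex.I * a 3 x + a 1 x ^ 2 -
      c 1 x * conj (c 1 x) + Complex.I * (conj (p 0 x) * c 2 x - p 0 x * conj (c 2 x)))
      (fun x => ?_) ?_ x
    · refine (((((h.deriv_a 3 x (by norm_num)).const_mul (2 * Complex.I)).add
        ((h.deriv_a 1 x le_rfl).pow 2)).sub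
        ((h.deriv_c 1 x le_rfl).mul (h.deriv_conj_c 1 x le_rfl))).add
        ((((h.deriv_conj_q x).mul (h.deriv_c 2 x one_le_two)).sub
        ((h.deriv_q x).mul (h.deriv_conj_c 2 x one_le_two))).const_mul Complex.I)).congr_deriv ?_
      push_cast
      linear_combination (0 : ℂ) * Complex.I_mul_I
    · simpa using ((((h.lim_a 3 (by norm_num)).const_mul (2 * Complex.I)).add
        ((h.lim_a 1 le_rfl).pow 2)).sub
        ((h.lim_c 1 le_rfl).mul (tendsto_conj (h.lim_c 1 le_rfl)))).add
        ((((tendsto_conj h.lim_q).mul (h.lim_c 2 one_le_two)).sub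
        (h.lim_q.mul (tendsto_conj (h.lim_c 2 one_le_two)))).const_mul Complex.I)
  linear_combination (-Complex.I / 2) * h1 + a 3 x * Complex.I_mul_I

theorem a_four (h : IsLaxHierarchy q₀ qm p a c) (x : ℝ) : a 4 x = Complex.I / 2 * (2 *
    (a 1 x * a 2 x) -
    (c 1 x * conj (c 2 x) + c 2 x * conj (c 1 x)) +
    Complex.I * (conj (p 0 x) * c 3 x - p 0 x * conj (c 3 x))) := by
  have h1 : 2 * Complex.I * a 4 x + 2 * (a 1 x * a 2 x) -
      (c 1 x * conj (c 2 x) + c 2 x * conj (c 1 x)) +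
      Complex.I * (conj (p 0 x) * c 3 x - p 0 x * conj (c 3 x)) = 0 := by
    refine eq_of_hasDerivAt_zero_of_tendsto (f := fun x => 2 * Complex.I * a 4 x +
      2 * (a 1 x * a 2 x) - (c 1 x * conj (c 2 x) + c 2 x * conj (c 1 x)) +
      Complex.I * (conj (p 0 x) * c 3 x - p 0 x * conj (c 3 x))) (fun x => ?_) ?_ x
    · refine (((((h.deriv_a 4 x (by norm_num)).const_mul (2 * Complex.I)).add
        (((h.deriv_a 1 x le_rfl).mul (h.deriv_a 2 x one_le_two)).const_mul 2)).sub
        (((h.deriv_c 1 x le_rfl).mul (h.deriv_conj_c 2 x one_le_two)).add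
        ((h.deriv_c 2 x one_le_two).mul (h.deriv_conj_c 1 x le_rfl)))).add
        ((((h.deriv_conj_q x).mul (h.deriv_c 3 x (by norm_num))).sub
        ((h.deriv_q x).mul (h.deriv_conj_c 3 x (by norm_num)))).const_mul
          Complex.I)).congr_deriv ?_
      linear_combination (0 : ℂ) * Complex.I_mul_I
    · simpa using ((((h.lim_a 4 (by norm_num)).const_mul (2 * Complex.I)).add
        (((h.lim_a 1 le_rfl).mul (h.lim_a 2 one_le_two)).const_mul 2)).sub
        (((h.lim_c 1 le_rfl).mul (tendsto_conj (h.lim_c 2 one_le_two))).add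
        ((h.lim_c 2 one_le_two).mul (tendsto_conj (h.lim_c 1 le_rfl))))).add
        ((((tendsto_conj h.lim_q).mul (h.lim_c 3 (by norm_num))).sub
        (h.lim_q.mul (tendsto_conj (h.lim_c 3 (by norm_num))))).const_mul Complex.I)
  linear_combination (-Complex.I / 2) * h1 + a 4 x * Complex.I_mul_I

theorem a_five (h : IsLaxHierarchy q₀ qm p a c) (x : ℝ) : a 5 x = Complex.I / 2 * (2 *
    (a 1 x * a 3 x) + a 2 x ^ 2 -
    (c 1 x * conj (c 3 x) + c 2 x * conj (c 2 x) + c 3 x * conj (c 1 x)) +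
    Complex.I * (conj (p 0 x) * c 4 x - p 0 x * conj (c 4 x))) := by
  have h1 : 2 * Complex.I * a 5 x + 2 * (a 1 x * a 3 x) + a 2 x ^ 2 -
      (c 1 x * conj (c 3 x) + c 2 x * conj (c 2 x) + c 3 x * conj (c 1 x)) +
      Complex.I * (conj (p 0 x) * c 4 x - p 0 x * conj (c 4 x)) = 0 := by
    refine eq_of_hasDerivAt_zero_of_tendsto (f := fun x => 2 * Complex.I * a 5 x +
      2 * (a 1 x * a 3 x) + a 2 x ^ 2 -
      (c 1 x * conj (c 3 x) + c 2 x * conj (c 2 x) + c 3 x * conj (c 1 x)) +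
      Complex.I * (conj (p 0 x) * c 4 x - p 0 x * conj (c 4 x))) (fun x => ?_) ?_ x
    · refine ((((((h.deriv_a 5 x (by norm_num)).const_mul (2 * Complex.I)).add
        (((h.deriv_a 1 x le_rfl).mul (h.deriv_a 3 x (by norm_num))).const_mul 2)).add
        ((h.deriv_a 2 x one_le_two).pow 2)).sub
        ((((h.deriv_c 1 x le_rfl).mul (h.deriv_conj_c 3 x (by norm_num))).add
        ((h.deriv_c 2 x one_le_two).mul (h.deriv_conj_c 2 x one_le_two))).add
        ((h.deriv_c 3 x (by norm_num)).mul (h.deriv_conj_c 1 x le_rfl)))).add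
        ((((h.deriv_conj_q x).mul (h.deriv_c 4 x (by norm_num))).sub
        ((h.deriv_q x).mul (h.deriv_conj_c 4 x (by norm_num)))).const_mul
          Complex.I)).congr_deriv ?_
      push_cast
      linear_combination (0 : ℂ) * Complex.I_mul_I
    · simpa using (((((h.lim_a 5 (by norm_num)).const_mul (2 * Complex.I)).add
        (((h.lim_a 1 le_rfl).mul (h.lim_a 3 (by norm_num))).const_mul 2)).add
        ((h.lim_a 2 one_le_two).pow 2)).sub
        ((((h.lim_c 1 le_rfl).mul (tendsto_conj (h.lim_c 3 (by norm_num)))).add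
        ((h.lim_c 2 one_le_two).mul (tendsto_conj (h.lim_c 2 one_le_two)))).add
        ((h.lim_c 3 (by norm_num)).mul (tendsto_conj (h.lim_c 1 le_rfl))))).add
        ((((tendsto_conj h.lim_q).mul (h.lim_c 4 (by norm_num))).sub
        (h.lim_q.mul (tendsto_conj (h.lim_c 4 (by norm_num))))).const_mul Complex.I)
  linear_combination (-Complex.I / 2) * h1 + a 5 x * Complex.I_mul_I

/-! ### The coefficients in terms of the derivatives of the potential -/

/-- The recursion c_{m+1} = q a_m + (i/2) c_m', arranged so that c_m may be differentiated through
an explicit formula. -/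
theorem c_succ_eq (h : IsLaxHierarchy q₀ qm p a c) {m : ℕ} (hm : 1 ≤ m) {x : ℝ} {f : ℝ → ℂ}
    {c' r : ℂ} (hf : ∀ y, c m y = f y) (hc : HasDerivAt f c' x)
    (e : p 0 x * a m x + Complex.I / 2 * c' = r) : c (m + 1) x = r := by
  rw [← e, hc.unique (funext hf ▸ h.deriv_c m x hm)]
  linear_combination (c (m + 1) x - p 0 x * a m x) * Complex.I_mul_I

theorem I_pow_five : Complex.I ^ 5 = Complex.I := by
  rw [pow_succ, Complex.I_pow_four, one_mul]

theorem c_one (h : IsLaxHierarchy q₀ qm p a c) (x : ℝ) : c 1 x = -(1 / 2) * p 1 x := by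
  rw [(h.deriv_p 0 x).unique (h.deriv_q x)]
  ring

theorem c_two (h : IsLaxHierarchy q₀ qm p a c) (x : ℝ) : c 2 x =
    Complex.I * ((-1) / 2 * (p 0 x ^ 2 * conj (p 0 x)) + 1 / 2 * (q₀ ^ 2 * p 0 x) + (-1) / 4 *
      (p 2 x)) := by
  apply h.c_succ_eq (by norm_num) h.c_one
  -- The value of the derivative is still a metavariable; the rules follow the syntax of the formula
  -- and fill it in.
  · repeat' first
      | exact h.deriv_p _ _
      | exact h.deriv_conj_p _ _
      | exact hasDerivAt_const _ _
      | with_reducible apply HasDerivAt.fun_pow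
      | with_reducible apply HasDerivAt.fun_mul
  · simp only [h.a_one, map_add, map_mul, map_neg, map_div₀, map_one, map_pow,
      Complex.conj_conj, Complex.conj_I, Complex.conj_ofNat, h.conj_q₀, Nat.cast_ofNat]
    ring_nf

theorem c_three (h : IsLaxHierarchy q₀ qm p a c) (x : ℝ) : c 3 x =
    3 / 4 * (p 0 x * p 1 x * conj (p 0 x)) + (-1) / 4 * (q₀ ^ 2 * p 1 x) + 1 / 8 * (p 3 x) := by
  apply h.c_succ_eq (by norm_num) h.c_two
  · repeat' first
      | exact h.deriv_p _ _
      | exact h.deriv_conj_p _ _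
      | exact hasDerivAt_const _ _
      | with_reducible apply HasDerivAt.fun_pow
      | with_reducible apply HasDerivAt.fun_mul
      | with_reducible apply HasDerivAt.fun_add
  · simp only [h.a_two, h.a_one, h.c_one, map_add, map_mul, map_neg, map_div₀, map_one, map_pow,
      Complex.conj_conj, Complex.conj_I, Complex.conj_ofNat, h.conj_q₀, Nat.cast_ofNat]
    ring_nf
    simp only [Complex.I_sq, Complex.I_pow_three, Complex.I_pow_four, I_pow_five]
    ring

theorem c_four (h : IsLaxHierarchy q₀ qm p a c) (x : ℝ) : c 4 x =
    Complex.I * (3 / 8 * (p 0 x ^ 3 * conj (p 0 x) ^ 2) + (-1) / 4 * (q₀ ^ 2 * p 0 x ^ 2 * conj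
      (p 0 x)) +
    1 / 8 * (p 0 x ^ 2 * conj (p 2 x)) + 1 / 4 * (p 0 x * p 1 x * conj (p 1 x)) +
    1 / 2 * (p 0 x * p 2 x * conj (p 0 x)) + (-1) / 8 * (q₀ ^ 4 * p 0 x) +
    3 / 8 * (p 1 x ^ 2 * conj (p 0 x)) + (-1) / 8 * (q₀ ^ 2 * p 2 x) + 1 / 16 * (p 4 x)) := by
  apply h.c_succ_eq (by norm_num) h.c_three
  · repeat' first
      | exact h.deriv_p _ _
      | exact h.deriv_conj_p _ _
      | exact hasDerivAt_const _ _
      | with_reducible apply HasDerivAt.fun_pow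
      | with_reducible apply HasDerivAt.fun_mul
      | with_reducible apply HasDerivAt.fun_add
  · simp only [h.a_three, h.a_two, h.a_one, h.c_two, h.c_one, map_add, map_mul, map_neg,
    map_div₀, map_one, map_pow,
      Complex.conj_conj, Complex.conj_I, Complex.conj_ofNat, h.conj_q₀, Nat.cast_ofNat]
    ring_nf
    simp only [Complex.I_sq, Complex.I_pow_three, Complex.I_pow_four, I_pow_five]
    ring

theorem c_five (h : IsLaxHierarchy q₀ qm p a c) (x : ℝ) : c 5 x =
    (-15) / 16 * (p 0 x ^ 2 * p 1 x * conj (p 0 x) ^ 2) +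
    3 / 8 * (q₀ ^ 2 * p 0 x * p 1 x * conj (p 0 x)) +
    (-5) / 16 * (p 0 x * p 1 x * conj (p 2 x)) + (-5) / 16 * (p 0 x * p 2 x * conj (p 1 x)) +
    (-5) / 16 * (p 0 x * p 3 x * conj (p 0 x)) + (-5) / 16 * (p 1 x ^ 2 * conj (p 1 x)) +
    (-5) / 8 * (p 1 x * p 2 x * conj (p 0 x)) + 1 / 16 * (q₀ ^ 4 * p 1 x) +
    1 / 16 * (q₀ ^ 2 * p 3 x) + (-1) / 32 * (p 5 x) := by
  apply h.c_succ_eq (by norm_num) h.c_four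
  · repeat' first
      | exact h.deriv_p _ _
      | exact h.deriv_conj_p _ _
      | exact hasDerivAt_const _ _
      | with_reducible apply HasDerivAt.fun_pow
      | with_reducible apply HasDerivAt.fun_mul
      | with_reducible apply HasDerivAt.fun_add
  · simp only [h.a_four, h.a_three, h.a_two, h.a_one, h.c_three, h.c_two, h.c_one, map_add,
    map_mul, map_neg, map_div₀, map_one, map_pow,
      Complex.conj_conj, Complex.conj_I, Complex.conj_ofNat, h.conj_q₀, Nat.cast_ofNat]
    ring_nf
    simp only [Complex.I_sq, Complex.I_pow_three, Complex.I_pow_four, I_pow_five]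
    ring

theorem c_six (h : IsLaxHierarchy q₀ qm p a c) (x : ℝ) : c 6 x =
    Complex.I * ((-5) / 16 * (p 0 x ^ 4 * conj (p 0 x) ^ 3) +
    3 / 16 * (q₀ ^ 2 * p 0 x ^ 3 * conj (p 0 x) ^ 2) +
    (-5) / 16 * (p 0 x ^ 3 * conj (p 0 x) * conj (p 2 x)) +
    (-5) / 32 * (p 0 x ^ 3 * conj (p 1 x) ^ 2) +
    (-15) / 16 * (p 0 x ^ 2 * p 1 x * conj (p 0 x) * conj (p 1 x)) +
    (-25) / 32 * (p 0 x ^ 2 * p 2 x * conj (p 0 x) ^ 2) +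
    1 / 16 * (q₀ ^ 4 * p 0 x ^ 2 * conj (p 0 x)) +
    1 / 16 * (q₀ ^ 2 * p 0 x ^ 2 * conj (p 2 x)) + (-1) / 32 * (p 0 x ^ 2 * conj (p 4 x)) +
    (-35) / 32 * (p 0 x * p 1 x ^ 2 * conj (p 0 x) ^ 2) +
    1 / 8 * (q₀ ^ 2 * p 0 x * p 1 x * conj (p 1 x)) +
    (-1) / 8 * (p 0 x * p 1 x * conj (p 3 x)) +
    1 / 4 * (q₀ ^ 2 * p 0 x * p 2 x * conj (p 0 x)) +
    (-11) / 32 * (p 0 x * p 2 x * conj (p 2 x)) +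
    (-9) / 32 * (p 0 x * p 3 x * conj (p 1 x)) + (-3) / 16 * (p 0 x * p 4 x * conj (p 0 x)) +
    1 / 16 * (q₀ ^ 6 * p 0 x) + 3 / 16 * (q₀ ^ 2 * p 1 x ^ 2 * conj (p 0 x)) +
    (-5) / 16 * (p 1 x ^ 2 * conj (p 2 x)) + (-25) / 32 * (p 1 x * p 2 x * conj (p 1 x)) +
    (-15) / 32 * (p 1 x * p 3 x * conj (p 0 x)) + (-5) / 16 * (p 2 x ^ 2 * conj (p 0 x)) +
    1 / 32 * (q₀ ^ 4 * p 2 x) + 1 / 32 * (q₀ ^ 2 * p 4 x) + (-1) / 64 * (p 6 x)) := by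
  apply h.c_succ_eq (by norm_num) h.c_five
  · repeat' first
      | exact h.deriv_p _ _
      | exact h.deriv_conj_p _ _
      | exact hasDerivAt_const _ _
      | with_reducible apply HasDerivAt.fun_pow
      | with_reducible apply HasDerivAt.fun_mul
      | with_reducible apply HasDerivAt.fun_add
  · simp only [h.a_five, h.a_four, h.a_three, h.a_two, h.a_one, h.c_four, h.c_three, h.c_two,
    h.c_one, map_add, map_mul, map_neg, map_div₀, map_one, map_pow,
      Complex.conj_conj, Complex.conj_I, Complex.conj_ofNat, h.conj_q₀, Nat.cast_ofNat]
    ring_nf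
    simp only [Complex.I_sq, Complex.I_pow_three, Complex.I_pow_four, I_pow_five]
    ring

end IsLaxHierarchy

namespace DiscreteData
variable {N : ℕ} (D : DiscreteData N) (δ : ℝ)

/-! ### The potential solves the equation -/

/-- The powers k(ξ_j)^(m-1) are the coefficients of k^(-m) in 1/(k - k(ξ_j)). Only m ≥ 1 is
meaningful, so the truncated subtraction is harmless. -/
noncomputable def laxC (m : ℕ) (x t : ℝ) : ℂ := Complex.I * ∑ j,
  lam D.q₀ (D.xi j) * kz D.q₀ (D.xi j) ^ (m - 1) * (D.Y δ x t j * D.X δ x t j ^ 2)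

noncomputable def laxA (m : ℕ) (x t : ℝ) : ℂ := -(Complex.I * ∑ j,
  lam D.q₀ (D.xi j) * kz D.q₀ (D.xi j) ^ (m - 1) *
    (D.Y δ x t j * D.X δ x t j * conj (D.Z δ x t j)))

/-- Conjugation leads to sums over ξ_j^*; the second symmetry and a swap of the index halves bring
them back to the ξ_j. -/
theorem conj_laxC (m : ℕ) (x t : ℝ) : conj (D.laxC δ m x t) = Complex.I * ∑ j,
    lam D.q₀ (D.xi j) * kz D.q₀ (D.xi j) ^ (m - 1) *
      (D.Y δ x t j * conj (D.Z δ x t j) ^ 2) := by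
  rw [laxC, map_mul, map_sum, Complex.conj_I, neg_mul, ← mul_neg, ← Finset.sum_neg_distrib,
    ← (Equiv.sumComm (Fin N) (Fin N)).sum_comp]
  congr 1
  refine Finset.sum_congr rfl fun j _ => ?_
  have h1 := D.lam_conj_xi_swap j
  have h2 := D.kz_conj_xi_swap j
  have h3 := congrArg conj (D.conj_Y_mul_Z_sq δ x t j)
  simp only [map_mul, map_pow, Complex.conj_conj, conj_lam, conj_kz, Equiv.sumComm_apply] at h3 ⊢
  rw [h3, h1, h2]
  ring

theorem hasDerivAt_conj_Z (x t : ℝ) (k : Fin N ⊕ Fin N) :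
    HasDerivAt (fun y => conj (D.Z δ y t k)) (Complex.I * D.xi k * conj (D.Z δ x t k) -
      Complex.I * conj (D.potential δ x t) * D.X δ x t k) x := by
  refine (hasDerivAt_conj ((D.hasDerivAt_X_Z_x δ x t).2 k)).congr_deriv ?_
  simp
  ring

theorem hasDerivAt_iteratedDeriv {f : ℝ → ℂ} (hf : ContDiff ℝ ∞ f) (n : ℕ) (x : ℝ) :
    HasDerivAt (iteratedDeriv n f) (iteratedDeriv (n + 1) f x) x := by
  rw [iteratedDeriv_succ]
  refine (hf.differentiable_iteratedDeriv n ?_ x).hasDerivAt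
  exact_mod_cast ENat.natCast_lt_top n

/-- Since q₀²/ξ = λ - k, the rate -2iλ of Y and twice the rate i(λ - k) of X add up to -2ik, which
raises the moment by one. -/
theorem hasDerivAt_laxC (m : ℕ) (x t : ℝ) (hm : 1 ≤ m) :
    HasDerivAt (fun y => D.laxC δ m y t) (-2 * Complex.I * D.laxC δ (m + 1) x t +
      2 * Complex.I * (D.potential δ x t * D.laxA δ m x t)) x := by
  obtain ⟨m, rfl⟩ := Nat.exists_eq_add_of_le' hm
  have hX := (D.hasDerivAt_X_Z_x δ x t).1
  refine ((HasDerivAt.fun_sum fun j _ => ((D.hasDerivAt_Y_x δ x t j).fun_mul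
    ((hX j).fun_pow 2)).const_mul (lam D.q₀ (D.xi j) * kz D.q₀ (D.xi j) ^ m)).const_mul
    Complex.I).congr_deriv ?_
  simp only [laxC, laxA, Nat.add_sub_cancel, Finset.mul_sum,
    ← Finset.sum_add_distrib, ← Finset.sum_neg_distrib]
  refine Finset.sum_congr rfl fun j _ => ?_
  have h1 : (D.q₀ : ℂ) ^ 2 / D.xi j = lam D.q₀ (D.xi j) - kz D.q₀ (D.xi j) := by
    simp only [lam, kz]; ring
  rw [h1]
  push_cast
  ring

/-- The diagonal rates -2iλ of Y, i(λ - k) of X and iξ = i(λ + k) of Z^* cancel, so only the terms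
with the potential remain. -/
theorem hasDerivAt_laxA (m : ℕ) (x t : ℝ) (hm : 1 ≤ m) :
    HasDerivAt (fun y => D.laxA δ m y t) (Complex.I * (conj (D.potential δ x t) * D.laxC δ m x t +
      D.potential δ x t * conj (D.laxC δ m x t))) x := by
  obtain ⟨m, rfl⟩ := Nat.exists_eq_add_of_le' hm
  have hX := (D.hasDerivAt_X_Z_x δ x t).1
  refine ((HasDerivAt.fun_sum fun j _ => (((D.hasDerivAt_Y_x δ x t j).fun_mul
    (hX j)).fun_mul (D.hasDerivAt_conj_Z δ x t j)).const_mul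
    (lam D.q₀ (D.xi j) * kz D.q₀ (D.xi j) ^ m)).const_mul
    Complex.I).fun_neg.congr_deriv ?_
  rw [conj_laxC]
  simp only [laxC, Nat.add_sub_cancel, Finset.mul_sum,
    ← Finset.sum_add_distrib, ← Finset.sum_neg_distrib]
  refine Finset.sum_congr rfl fun j _ => ?_
  have h1 : (D.q₀ : ℂ) ^ 2 / D.xi j = lam D.q₀ (D.xi j) - kz D.q₀ (D.xi j) := by
    simp only [lam, kz]; ring
  have h2 : D.xi j = lam D.q₀ (D.xi j) + kz D.q₀ (D.xi j) := by
    simp only [lam, kz]; ring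
  rw [h1]
  linear_combination (-Complex.I ^ 2 * lam D.q₀ (D.xi j) * kz D.q₀ (D.xi j) ^ m *
    D.Y δ x t j * D.X δ x t j * conj (D.Z δ x t j)) * h2

theorem tendsto_laxC_atBot (m : ℕ) (t : ℝ) :
    Tendsto (fun x => D.laxC δ m x t) atBot (𝓝 0) := by
  simpa [laxC] using ((tendsto_finsetSum Finset.univ fun j _ =>
    ((D.tendsto_Y_atBot δ t j).mul (((D.tendsto_X_Z_atBot δ t).1 j).pow 2)).const_mul
    (lam D.q₀ (D.xi j) * kz D.q₀ (D.xi j) ^ (m - 1))).const_mul Complex.I)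

theorem tendsto_laxA_atBot (m : ℕ) (t : ℝ) :
    Tendsto (fun x => D.laxA δ m x t) atBot (𝓝 0) := by
  simpa [laxA] using ((tendsto_finsetSum Finset.univ fun j _ =>
    (((D.tendsto_Y_atBot δ t j).mul ((D.tendsto_X_Z_atBot δ t).1 j)).mul
    (tendsto_conj ((D.tendsto_X_Z_atBot δ t).2 j))).const_mul
    (lam D.q₀ (D.xi j) * kz D.q₀ (D.xi j) ^ (m - 1))).const_mul Complex.I).neg

theorem hasDerivAt_potential_laxC (x t : ℝ) :
    HasDerivAt (fun y => D.potential δ y t) (-2 * D.laxC δ 1 x t) x := by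
  refine (D.hasDerivAt_potential_x δ x t).congr_deriv ?_
  simp only [laxC, le_refl, tsub_eq_zero_of_le, pow_zero, mul_one, mul_assoc]

theorem contDiff_potential_x (t : ℝ) : ContDiff ℝ ∞ fun y => D.potential δ y t :=
  ContDiff.comp (g := fun p : ℝ × ℝ => D.potential δ p.1 p.2) (f := fun y : ℝ => (y, t))
    (D.contDiff_potential δ) (contDiff_id.prodMk contDiff_const)

theorem isLaxHierarchy (t : ℝ) : IsLaxHierarchy D.q₀ D.qm
    (fun n => iteratedDeriv n fun y => D.potential δ y t)
    (fun m x => D.laxA δ m x t) (fun m x => D.laxC δ m x t) := by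
  have h0 : iteratedDeriv 0 (fun y => D.potential δ y t) = fun y => D.potential δ y t :=
    iteratedDeriv_zero
  refine ⟨D.qm_mul_conj, Complex.conj_ofReal _, ?_, fun x => ?_, fun m x hm => ?_,
    fun m x hm => ?_, ?_, fun m _ => D.tendsto_laxC_atBot δ m t,
    fun m _ => D.tendsto_laxA_atBot δ m t⟩
  · exact fun n x => hasDerivAt_iteratedDeriv (D.contDiff_potential_x δ t) n x
  · rw [h0]
    exact D.hasDerivAt_potential_laxC δ x t
  · rw [h0]
    exact D.hasDerivAt_laxC δ m x t hm
  · rw [h0]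
    exact D.hasDerivAt_laxA δ m x t hm
  · rw [h0]
    exact D.tendsto_potential_atBot δ t

theorem hasDerivAt_potential_t_laxC (x t : ℝ) : HasDerivAt (fun s => D.potential δ x s)
    (-2 * (32 * δ * D.laxC δ 6 x t - 16 * δ * (D.q₀ : ℂ) ^ 2 * D.laxC δ 4 x t +
      (12 * δ * (D.q₀ : ℂ) ^ 4 + 1) * D.laxC δ 2 x t)) t := by
  refine (D.hasDerivAt_potential_t δ x t).congr_deriv ?_
  simp only [laxC, Finset.mul_sum, ← Finset.sum_add_distrib, ← Finset.sum_sub_distrib]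
  refine Finset.sum_congr rfl fun j _ => ?_
  simp only [disp]
  ring

/-- The weights 32, -16q₀², 12q₀⁴ in the phase cancel the lower-order q₀-terms of c_6 and c_4; what
survives of the δ-part is the sextic term and -20 q₀⁶ q. -/
theorem solvesGaugedSNLS : SolvesGaugedSNLS δ D.q₀ (D.potential δ) := by
  intro x t
  have h := D.isLaxHierarchy δ t
  have h2 : D.laxC δ 2 x t = _ := h.c_two x
  have h4 : D.laxC δ 4 x t = _ := h.c_four x
  have h6 : D.laxC δ 6 x t = _ := h.c_six x
  have h0 : D.potential δ x t = iteratedDeriv 0 (fun y => D.potential δ y t) x := by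
    rw [iteratedDeriv_zero]
  rw [(D.hasDerivAt_potential_t_laxC δ x t).deriv, h2, h4, h6]
  simp only [sexticTerm, dx]
  rw [h0]
  -- Conjugates are replaced before the derivatives that they contain; the claim becomes a
  -- polynomial identity in independent letters.
  generalize conj (iteratedDeriv 0 (fun y => D.potential δ y t) x) = r0
  generalize conj (iteratedDeriv 1 (fun y => D.potential δ y t) x) = r1
  generalize conj (iteratedDeriv 2 (fun y => D.potential δ y t) x) = r2
  generalize conj (iteratedDeriv 3 (fun y => D.potential δ y t) x) = r3
  generalize conj (iteratedDeriv 4 (fun y => D.potential δ y t) x) = r4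
  generalize (iteratedDeriv 0 (fun y => D.potential δ y t) x) = p0
  generalize (iteratedDeriv 1 (fun y => D.potential δ y t) x) = p1
  generalize (iteratedDeriv 2 (fun y => D.potential δ y t) x) = p2
  generalize (iteratedDeriv 3 (fun y => D.potential δ y t) x) = p3
  generalize (iteratedDeriv 4 (fun y => D.potential δ y t) x) = p4
  generalize (iteratedDeriv 6 (fun y => D.potential δ y t) x) = p6
  have hI : ∀ P Q R a b c : ℂ, Complex.I * (-2 * (a * (Complex.I * P) - b * (Complex.I * Q) +
      c * (Complex.I * R))) = 2 * (a * P - b * Q + c * R) := fun P Q R a b c => by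
    linear_combination (-2 * (a * P - b * Q + c * R)) * Complex.I_mul_I
  rw [hI]
  ring

end DiscreteData

/-! ### Jost columns -/

theorem hasDerivAt_exp_theta (δ q₀ x t : ℝ) (c z : ℂ) :
    HasDerivAt (fun y : ℝ => Complex.exp (c * Complex.I * theta δ q₀ y t z))
      (Complex.exp (c * Complex.I * theta δ q₀ x t z) * (c * Complex.I * lam q₀ z)) x := by
  have h1 : HasDerivAt (fun y : ℝ => (y : ℂ)) 1 x := Complex.ofRealCLM.hasDerivAt
  simpa [DiscreteData.theta_eq] using
    (((h1.add_const (DiscreteData.disp δ q₀ (kz q₀ z) * t)).const_mul (lam q₀ z)).const_mul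
      (c * Complex.I)).cexp

/-- Removing the factor e^{iθ} shifts the diagonal ±ik by -iλ, and k - λ = -q₀²/z, k + λ = z. For
the second column the shift is +iλ. -/
theorem isJostColumn_zero {δ q₀ : ℝ} {q : ℝ → ℝ → ℂ} {qb : ℂ} {l : Filter ℝ} {t : ℝ} {z : ℂ}
    {v : ℝ → Fin 2 → ℂ}
    (h0 : ∀ x, HasDerivAt (fun y => v y 0)
      (-Complex.I * ((q₀ : ℂ) ^ 2 / z) * v x 0 + Complex.I * conj (q x t) * v x 1) x)
    (h1 : ∀ x, HasDerivAt (fun y => v y 1)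
      (-Complex.I * z * v x 1 + Complex.I * q x t * v x 0) x)
    (l0 : Tendsto (fun x => v x 0) l (𝓝 1)) (l1 : Tendsto (fun x => v x 1) l (𝓝 (qb / z))) :
    IsJostColumn δ q₀ q qb l t z 0 v where
  lax x := by
    rw [hasDerivAt_pi, Fin.forall_fin_two]
    have hE := hasDerivAt_exp_theta δ q₀ x t (eps 0) z
    constructor
    · refine (hE.mul (h0 x)).congr_deriv ?_
      simp only [laxX, eps, Matrix.mulVec, dotProduct, Fin.sum_univ_two, Pi.smul_apply,
        smul_eq_mul, kz, lam, Matrix.of_apply, Matrix.cons_val_zero, Matrix.cons_val_one,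
        Matrix.cons_val', Matrix.cons_val_fin_one]
      ring
    · refine (hE.mul (h1 x)).congr_deriv ?_
      simp only [laxX, eps, Matrix.mulVec, dotProduct, Fin.sum_univ_two, Pi.smul_apply,
        smul_eq_mul, kz, lam, Matrix.of_apply, Matrix.cons_val_zero, Matrix.cons_val_one,
        Matrix.cons_val', Matrix.cons_val_fin_one]
      ring
  lim := by
    rw [tendsto_pi_nhds, Fin.forall_fin_two]
    exact ⟨by simpa [asympY] using l0, by simpa [asympY] using l1⟩

theorem isJostColumn_one {δ q₀ : ℝ} {q : ℝ → ℝ → ℂ} {qb : ℂ} {l : Filter ℝ} {t : ℝ} {z : ℂ}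
    {v : ℝ → Fin 2 → ℂ}
    (h0 : ∀ x, HasDerivAt (fun y => v y 0)
      (Complex.I * z * v x 0 + Complex.I * conj (q x t) * v x 1) x)
    (h1 : ∀ x, HasDerivAt (fun y => v y 1)
      (Complex.I * ((q₀ : ℂ) ^ 2 / z) * v x 1 + Complex.I * q x t * v x 0) x)
    (l0 : Tendsto (fun x => v x 0) l (𝓝 (-conj qb / z)))
    (l1 : Tendsto (fun x => v x 1) l (𝓝 1)) :
    IsJostColumn δ q₀ q qb l t z 1 v where
  lax x := by
    rw [hasDerivAt_pi, Fin.forall_fin_two]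
    have hE := hasDerivAt_exp_theta δ q₀ x t (eps 1) z
    constructor
    · refine (hE.mul (h0 x)).congr_deriv ?_
      simp only [laxX, eps, Matrix.mulVec, dotProduct, Fin.sum_univ_two, Pi.smul_apply,
        smul_eq_mul, kz, lam, Matrix.of_apply, Matrix.cons_val_zero, Matrix.cons_val_one,
        Matrix.cons_val', Matrix.cons_val_fin_one]
      ring
    · refine (hE.mul (h1 x)).congr_deriv ?_
      simp only [laxX, eps, Matrix.mulVec, dotProduct, Fin.sum_univ_two, Pi.smul_apply,
        smul_eq_mul, kz, lam, Matrix.of_apply, Matrix.cons_val_zero, Matrix.cons_val_one,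
        Matrix.cons_val', Matrix.cons_val_fin_one]
      ring
  lim := by
    rw [tendsto_pi_nhds, Fin.forall_fin_two]
    exact ⟨by simpa [asympY] using l0, by simpa [asympY] using l1⟩

namespace DiscreteData
variable {N : ℕ} (D : DiscreteData N) (δ : ℝ)

theorem ne_conj_xi_of_mem {z : ℂ} (hz : z ∈ Dplus D.q₀ ∪ contour D.q₀) (j : Fin N ⊕ Fin N) :
    z ≠ conj (D.xi j) := by
  rintro rfl
  rcases hz with h | h
  · exact notMem_Dminus_of_mem_Dplus h (D.conj_xi_mem_Dminus j)
  · exact notMem_contour_of_mem_Dminus (D.conj_xi_mem_Dminus j) h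

theorem ne_xi_of_mem {z : ℂ} (hz : z ∈ Dminus D.q₀ ∪ contour D.q₀) (j : Fin N ⊕ Fin N) :
    z ≠ D.xi j := by
  rintro rfl
  rcases hz with h | h
  · exact notMem_Dminus_of_mem_Dplus (D.xi_mem_Dplus j) h
  · exact notMem_contour_of_mem_Dplus (D.xi_mem_Dplus j) h

/-- Away from the ξ_j the first ψ-column is a constant multiple of the first φ-column. At ξ_j, where
φ has a pole, it is a constant times Y_j times the second φ-column, and the rate -2iλ of Y_j
converts one column equation into the other. -/
theorem hasDerivAt_psi11 (x t : ℝ) {z : ℂ} (hz : z ≠ 0) (hξ : ∀ j, z ≠ conj (D.xi j)) :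
    HasDerivAt (fun y => D.psi11 δ y t z) (-Complex.I * ((D.q₀ : ℂ) ^ 2 / z) * D.psi11 δ x t z +
      Complex.I * conj (D.potential δ x t) * D.psi21 δ x t z) x := by
  by_cases h : ∃ j, z = D.xi j
  · obtain ⟨j, rfl⟩ := h
    have e : ∀ y, D.psi11 δ y t (D.xi j) =
        D.ds11 j * (D.Y δ y t j * D.phi12 δ y t (D.xi j)) := fun y => by
      rw [psi11_xi, phi12_xi, mul_assoc]
    simp only [e]
    refine (((D.hasDerivAt_Y_x δ x t j).mul
      (D.hasDerivAt_phi12 δ x t hz hξ)).const_mul _).congr_deriv ?_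
    rw [psi21_xi, ← phi22_xi]
    linear_combination (-Complex.I * D.ds11 j * D.Y δ x t j * D.phi12 δ x t (D.xi j)) *
      two_mul_lam D.q₀ (D.xi j)
  · push Not at h
    have e : ∀ y, D.psi11 δ y t z = D.s11 z * D.phi11 δ y t z := fun y => D.psi11_eq δ y t hξ h
    simp only [e, D.psi21_eq δ x t hz hξ h]
    exact ((D.hasDerivAt_phi11 δ x t hz h).const_mul _).congr_deriv (by ring)

theorem hasDerivAt_psi21 (x t : ℝ) {z : ℂ} (hz : z ≠ 0) (hξ : ∀ j, z ≠ conj (D.xi j)) :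
    HasDerivAt (fun y => D.psi21 δ y t z) (-Complex.I * z * D.psi21 δ x t z +
      Complex.I * D.potential δ x t * D.psi11 δ x t z) x := by
  by_cases h : ∃ j, z = D.xi j
  · obtain ⟨j, rfl⟩ := h
    have e : ∀ y, D.psi21 δ y t (D.xi j) =
        D.ds11 j * (D.Y δ y t j * D.phi22 δ y t (D.xi j)) := fun y => by
      rw [psi21_xi, phi22_xi, mul_assoc]
    simp only [e]
    refine (((D.hasDerivAt_Y_x δ x t j).mul
      (D.hasDerivAt_phi22 δ x t hz hξ)).const_mul _).congr_deriv ?_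
    rw [psi11_xi, ← phi12_xi]
    linear_combination (-Complex.I * D.ds11 j * D.Y δ x t j * D.phi22 δ x t (D.xi j)) *
      two_mul_lam D.q₀ (D.xi j)
  · push Not at h
    have e : ∀ y, D.psi21 δ y t z = D.s11 z * D.phi21 δ y t z :=
      fun y => D.psi21_eq δ y t hz hξ h
    simp only [e, D.psi11_eq δ x t hξ h]
    exact ((D.hasDerivAt_phi21 δ x t hz h).const_mul _).congr_deriv (by ring)

theorem hasDerivAt_psi22 (x t : ℝ) {z : ℂ} (hz : z ≠ 0) (hξ : ∀ j, z ≠ D.xi j) :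
    HasDerivAt (fun y => D.psi22 δ y t z) (Complex.I * ((D.q₀ : ℂ) ^ 2 / z) * D.psi22 δ x t z +
      Complex.I * D.potential δ x t * D.psi12 δ x t z) x := by
  have h := hasDerivAt_conj (D.hasDerivAt_psi11 δ x t ((map_ne_zero conj).2 hz)
    fun j hj => hξ j ((starRingEnd ℂ).injective hj))
  have e : ∀ y, D.psi22 δ y t z = conj (D.psi11 δ y t (conj z)) := fun y => by
    simp [psi11_eq_conj]
  simp only [e, psi12_eq_neg_conj]
  refine h.congr_deriv ?_
  simp [map_div₀]

theorem hasDerivAt_psi12 (x t : ℝ) {z : ℂ} (hz : z ≠ 0) (hξ : ∀ j, z ≠ D.xi j) :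
    HasDerivAt (fun y => D.psi12 δ y t z) (Complex.I * z * D.psi12 δ x t z +
      Complex.I * conj (D.potential δ x t) * D.psi22 δ x t z) x := by
  have h := (hasDerivAt_conj (D.hasDerivAt_psi21 δ x t ((map_ne_zero conj).2 hz)
    fun j hj => hξ j ((starRingEnd ℂ).injective hj))).neg
  have e : D.psi22 δ x t z = conj (D.psi11 δ x t (conj z)) := by
    simp [psi11_eq_conj]
  simp only [e, psi12_eq_neg_conj]
  refine h.congr_deriv ?_
  simp
  ring

/-! ### The Jost matrices and the scattering matrix -/

noncomputable def muMinus (x t : ℝ) (z : ℂ) : Matrix (Fin 2) (Fin 2) ℂ :=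
  !![D.phi11 δ x t z, D.phi12 δ x t z; D.phi21 δ x t z, D.phi22 δ x t z]

noncomputable def muPlus (x t : ℝ) (z : ℂ) : Matrix (Fin 2) (Fin 2) ℂ :=
  !![D.psi11 δ x t z, D.psi12 δ x t z; D.psi21 δ x t z, D.psi22 δ x t z]

noncomputable def scat (z : ℂ) : Matrix (Fin 2) (Fin 2) ℂ := !![D.s11 z, 0; 0, D.s22 z]

theorem wronskian_psi_phi (x t : ℝ) {z : ℂ} (hz : z ≠ 0) (h : z ∈ Dplus D.q₀ ∪ contour D.q₀) :
    (1 + (D.q₀ : ℂ) ^ 2 / z ^ 2) * D.s11 z =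
      D.psi11 δ x t z * D.phi22 δ x t z - D.psi21 δ x t z * D.phi12 δ x t z := by
  have hξ := D.ne_conj_xi_of_mem h
  by_cases h : ∃ j, z = D.xi j
  · obtain ⟨j, rfl⟩ := h
    rw [s11_xi, psi11_xi, psi21_xi, phi12_xi, phi22_xi]
    ring
  · push Not at h
    rw [D.psi11_eq δ x t hξ h, D.psi21_eq δ x t hz hξ h, ← D.det_phi δ x t hz h hξ]
    ring

theorem wronskian_phi_psi (x t : ℝ) {z : ℂ} (hz : z ≠ 0) (h : z ∈ Dminus D.q₀ ∪ contour D.q₀) :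
    (1 + (D.q₀ : ℂ) ^ 2 / z ^ 2) * D.s22 z =
      D.phi11 δ x t z * D.psi22 δ x t z - D.phi21 δ x t z * D.psi12 δ x t z := by
  have h' : conj z ∈ Dplus D.q₀ ∪ contour D.q₀ := by
    rcases h with h | h
    · exact .inl (conj_mem_Dplus_iff.2 h)
    · exact .inr (conj_mem_contour_iff.2 h)
  have h1 := congrArg conj (D.wronskian_psi_phi δ x t ((map_ne_zero conj).2 hz) h')
  simp only [map_mul, map_add, map_sub, map_div₀, map_pow, map_one, Complex.conj_conj,
    Complex.conj_ofReal, ← s22_eq_conj] at h1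
  rw [h1]
  simp only [psi11_eq_conj, phi11_eq_conj, psi12_eq_neg_conj, phi12_eq_neg_conj,
    Complex.conj_conj, map_neg]
  ring

theorem conj_Y (x t : ℝ) (k : Fin N ⊕ Fin N) : conj (D.Y δ x t k) =
    conj (D.C k) * Complex.exp (2 * Complex.I * theta δ D.q₀ x t (conj (D.xi k))) := by
  simp [Y, ← Complex.exp_conj, Complex.conj_ofNat, conj_theta]

theorem isReflectionless :
    IsReflectionless D δ (D.potential δ) (D.muMinus δ) (D.muPlus δ) D.scat where
  jost_minus_one t z hz h := by
    have hξ := D.ne_xi_of_mem h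
    exact isJostColumn_zero (fun x => D.hasDerivAt_phi11 δ x t hz hξ)
      (fun x => D.hasDerivAt_phi21 δ x t hz hξ) (D.tendsto_phi11_atBot δ t z)
      (D.tendsto_phi21_atBot δ t z)
  jost_minus_two t z hz h := by
    have hξ := D.ne_conj_xi_of_mem h
    exact isJostColumn_one (fun x => D.hasDerivAt_phi12 δ x t hz hξ)
      (fun x => D.hasDerivAt_phi22 δ x t hz hξ) (D.tendsto_phi12_atBot δ t z)
      (D.tendsto_phi22_atBot δ t z)
  jost_plus_one t z hz h := by
    have hξ := D.ne_conj_xi_of_mem h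
    exact isJostColumn_zero (fun x => D.hasDerivAt_psi11 δ x t hz hξ)
      (fun x => D.hasDerivAt_psi21 δ x t hz hξ) (D.tendsto_psi11_atTop δ t z)
      (D.tendsto_psi21_atTop δ t z)
  jost_plus_two t z hz h := by
    have hξ := D.ne_xi_of_mem h
    exact isJostColumn_one (fun x => D.hasDerivAt_psi12 δ x t hz hξ)
      (fun x => D.hasDerivAt_psi22 δ x t hz hξ) (D.tendsto_psi12_atTop δ t z)
      (D.tendsto_psi22_atTop δ t z)
  scattering x t z hz h := by
    have h1 := D.ne_conj_xi_of_mem (.inr h)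
    have h2 := D.ne_xi_of_mem (.inr h)
    ext i j
    fin_cases i <;> fin_cases j <;>
      simp [muPlus, muMinus, scat, Matrix.mul_apply, D.psi11_eq δ x t h1 h2,
        D.psi12_eq δ x t hz h1 h2, D.psi21_eq δ x t hz h1 h2, D.psi22_eq δ x t h1 h2, mul_comm]
  wronskian_one x t z hz h := D.wronskian_psi_phi δ x t hz h
  wronskian_two x t z hz h := D.wronskian_phi_psi δ x t hz h
  reflectionless z _ h := by
    have h1 := D.s11_mul_s22 (D.ne_conj_xi_of_mem (.inr h)) (D.ne_xi_of_mem (.inr h))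
    exact ⟨left_ne_zero_of_mul_eq_one h1, right_ne_zero_of_mul_eq_one h1,
      zero_div _, zero_div _⟩
  analytic_one z h := D.analyticAt_s11 (D.ne_conj_xi_of_mem (.inl h))
  analytic_two z h := D.analyticAt_s22 (D.ne_xi_of_mem (.inl h))
  zeros_one z h := D.s11_eq_zero_iff (D.ne_conj_xi_of_mem (.inl h))
  zeros_two z h := D.s22_eq_zero_iff (D.ne_xi_of_mem (.inl h))
  simple_one n := by
    have h : deriv D.s11 (D.xi n) ≠ 0 := (D.hasDerivAt_s11 n).deriv ▸ D.ds11_ne_zero n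
    exact h
  simple_two n := by
    have h : deriv D.s22 (conj (D.xi n)) ≠ 0 :=
      (D.hasDerivAt_s22 n).deriv ▸ (map_ne_zero _).2 (D.ds11_ne_zero n)
    exact h
  norming n := by
    have h : deriv (fun z => D.scat z 0 0) (D.xi n) = D.ds11 n := (D.hasDerivAt_s11 n).deriv
    -- b_n = C_n s₁₁'(ξ_n): all dependence on x and t sits in the exponential factor of Y_n.
    refine ⟨D.C n * D.ds11 n, ?_, fun x t => ?_⟩
    · rw [h, mul_div_cancel_right₀ _ (D.ds11_ne_zero n)]
    · rw [Fin.forall_fin_two]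
      change D.psi11 δ x t (D.xi n) = _ * D.phi12 δ x t (D.xi n) ∧
        D.psi21 δ x t (D.xi n) = _ * D.phi22 δ x t (D.xi n)
      rw [psi11_xi, psi21_xi, phi12_xi, phi22_xi, Y]
      constructor <;> ring
  norming_tilde n := by
    have h : deriv (fun z => D.scat z 1 1) (conj (D.xi n)) = conj (D.ds11 n) :=
      (D.hasDerivAt_s22 n).deriv
    refine ⟨D.Ctilde n * conj (D.ds11 n), ?_, fun x t => ?_⟩
    · rw [h, mul_div_cancel_right₀ _ ((map_ne_zero _).2 (D.ds11_ne_zero n))]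
    · rw [Fin.forall_fin_two]
      change D.psi12 δ x t (conj (D.xi n)) = _ * D.phi11 δ x t (conj (D.xi n)) ∧
        D.psi22 δ x t (conj (D.xi n)) = _ * D.phi21 δ x t (conj (D.xi n))
      rw [psi12_conj_xi, psi22_conj_xi, phi21_conj_xi, phi11_conj_xi, conj_Y]
      simp only [Ctilde]
      constructor <;> ring

end DiscreteData

/-! ### Cauchy sums as functions of `z` -/

section CauchySum
variable {ι : Type*} [Fintype ι] (r a : ι → ℂ)

theorem analyticAt_cauchySum {z : ℂ} (hz : ∀ j, z ≠ a j) :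
    AnalyticAt ℂ (fun w => ∑ j, r j / (w - a j)) z :=
  Finset.analyticAt_fun_sum _ fun j _ => analyticAt_const.fun_div
    (analyticAt_id.fun_sub analyticAt_const) (sub_ne_zero.2 (hz j))

theorem hasSimplePole_of_eq_cauchySum {a : ι → ℂ} (ha : Function.Injective a) {f h : ℂ → ℂ} (n : ι)
    (hh : AnalyticAt ℂ h (a n)) (hf : ∀ᶠ z in 𝓝[≠] (a n), f z = h z + ∑ j, r j / (z - a j)) :
    HasSimplePole f (a n) (r n) := by
  classical
  refine ⟨fun z => h z + ∑ j ∈ Finset.univ.erase n, r j / (z - a j), ?_, ?_⟩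
  · refine hh.fun_add (Finset.analyticAt_fun_sum _ fun j hj => analyticAt_const.fun_div
      (analyticAt_id.fun_sub analyticAt_const) (sub_ne_zero.2 ?_))
    exact ha.ne (Finset.ne_of_mem_erase hj).symm
  · filter_upwards [hf] with z hz
    rw [hz, ← Finset.add_sum_erase _ _ (Finset.mem_univ n)]
    ring

theorem isBigO_div_sub_cobounded (r a : ℂ) :
    (fun z => r / (z - a)) =O[Bornology.cobounded ℂ] (fun z => z⁻¹) := by
  have h : Tendsto (fun z : ℂ => 1 - a * z⁻¹) (Bornology.cobounded ℂ) (𝓝 1) := by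
    simpa using (tendsto_inv₀_cobounded (α := ℂ)).const_mul a |>.const_sub 1
  have h1 : Tendsto (fun z : ℂ => r * (1 - a * z⁻¹)⁻¹) (Bornology.cobounded ℂ) (𝓝 r) := by
    simpa using (h.inv₀ one_ne_zero).const_mul r
  have h2 := (h1.isBigO_one ℂ).mul (Asymptotics.isBigO_refl (fun z : ℂ => z⁻¹) _)
  refine (h2.congr' ?_ ?_)
  · filter_upwards [Bornology.eventually_ne_cobounded (0 : ℂ)] with z hz
    rw [mul_assoc, ← mul_inv, sub_mul, one_mul, mul_assoc, inv_mul_cancel₀ hz, mul_one,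
      div_eq_mul_inv]
  · exact .of_forall fun z => one_mul _

theorem isBigO_cauchySum_cobounded :
    (fun z => ∑ j, r j / (z - a j)) =O[Bornology.cobounded ℂ] (fun z => z⁻¹) :=
  Asymptotics.IsBigO.fun_sum fun j _ => isBigO_div_sub_cobounded (r j) (a j)

end CauchySum

namespace DiscreteData
variable {N : ℕ} (D : DiscreteData N) (δ : ℝ) (x t : ℝ)

/-! ### The assembled matrix solves the Riemann–Hilbert problem -/

theorem assembled_of_mem_Dplus {z : ℂ} (h : z ∈ Dplus D.q₀) :
    assembled D.q₀ (D.muMinus δ) (D.muPlus δ) D.scat x t z =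
      !![D.psi11 δ x t z / D.s11 z, D.phi12 δ x t z;
         D.psi21 δ x t z / D.s11 z, D.phi22 δ x t z] := by
  simp [assembled, h, muMinus, muPlus, scat]

theorem assembled_of_notMem_Dplus {z : ℂ} (h : z ∉ Dplus D.q₀) :
    assembled D.q₀ (D.muMinus δ) (D.muPlus δ) D.scat x t z =
      !![D.phi11 δ x t z, D.psi12 δ x t z / D.s22 z;
         D.phi21 δ x t z, D.psi22 δ x t z / D.s22 z] := by
  simp [assembled, h, muMinus, muPlus, scat]

/-- Division by s₁₁ or s₂₂ undoes the passage from φ to ψ, so off the poles both branches are the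
same rational matrix and there is no jump. -/
theorem assembled_eq_muMinus {z : ℂ} (h0 : z ≠ 0) (hz : ∀ n, z ≠ D.xi n)
    (hz' : ∀ n, z ≠ conj (D.xi n)) :
    assembled D.q₀ (D.muMinus δ) (D.muPlus δ) D.scat x t z = D.muMinus δ x t z := by
  have h1 : D.s11 z ≠ 0 := left_ne_zero_of_mul_eq_one (D.s11_mul_s22 hz' hz)
  have h2 : D.s22 z ≠ 0 := right_ne_zero_of_mul_eq_one (D.s11_mul_s22 hz' hz)
  by_cases h : z ∈ Dplus D.q₀
  · rw [assembled_of_mem_Dplus _ _ _ _ h, psi11_eq _ _ _ _ hz' hz, psi21_eq _ _ _ _ h0 hz' hz,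
      mul_div_cancel_left₀ _ h1, mul_div_cancel_left₀ _ h1, muMinus]
  · rw [assembled_of_notMem_Dplus _ _ _ _ h, psi12_eq _ _ _ _ h0 hz' hz, psi22_eq _ _ _ _ hz' hz,
      mul_div_cancel_left₀ _ h2, mul_div_cancel_left₀ _ h2, muMinus]

theorem eventually_assembled_eq_muMinus {l : Filter ℂ} (h0 : ∀ᶠ z in l, z ≠ 0)
    (h : ∀ᶠ z in l, ∀ n, z ≠ D.xi n ∧ z ≠ conj (D.xi n)) :
    ∀ᶠ z in l, assembled D.q₀ (D.muMinus δ) (D.muPlus δ) D.scat x t z = D.muMinus δ x t z := by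
  filter_upwards [h0, h] with z h1 h2
  exact D.assembled_eq_muMinus δ x t h1 (fun n => (h2 n).1) fun n => (h2 n).2

theorem eventually_ne_poles {z : ℂ} (hz : ∀ n, z ≠ D.xi n) (hz' : ∀ n, z ≠ conj (D.xi n)) :
    ∀ᶠ w in 𝓝 z, ∀ n, w ≠ D.xi n ∧ w ≠ conj (D.xi n) :=
  eventually_all.2 fun n => (eventually_ne_nhds (hz n)).and (eventually_ne_nhds (hz' n))

theorem eventually_ne_nhdsNE (z a : ℂ) : ∀ᶠ w in 𝓝[≠] z, w ≠ a := by
  rcases eq_or_ne z a with rfl | h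
  · exact eventually_mem_nhdsWithin
  · exact eventually_nhdsWithin_of_eventually_nhds (eventually_ne_nhds h)

theorem eventually_punctured_ne_poles (z : ℂ) :
    ∀ᶠ w in 𝓝[≠] z, ∀ n, w ≠ D.xi n ∧ w ≠ conj (D.xi n) :=
  eventually_all.2 fun _ => (eventually_ne_nhdsNE _ _).and (eventually_ne_nhdsNE _ _)

theorem analyticAt_phi21 {z : ℂ} (h0 : z ≠ 0) (hz : ∀ n, z ≠ D.xi n) :
    AnalyticAt ℂ (D.phi21 δ x t) z :=
  (analyticAt_const.fun_div analyticAt_id h0).fun_add (analyticAt_cauchySum _ _ hz)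

theorem analyticAt_phi11 {z : ℂ} (hz : ∀ n, z ≠ D.xi n) : AnalyticAt ℂ (D.phi11 δ x t) z :=
  analyticAt_const.fun_sub (analyticAt_cauchySum _ _ hz)

theorem analyticAt_phi22 {z : ℂ} (hz : ∀ n, z ≠ conj (D.xi n)) :
    AnalyticAt ℂ (D.phi22 δ x t) z :=
  analyticAt_const.fun_sub (analyticAt_cauchySum _ (fun n => conj (D.xi n)) hz)

theorem analyticAt_phi12 {z : ℂ} (h0 : z ≠ 0) (hz : ∀ n, z ≠ conj (D.xi n)) :
    AnalyticAt ℂ (D.phi12 δ x t) z :=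
  (analyticAt_const.fun_div analyticAt_id h0).fun_sub
    (analyticAt_cauchySum _ (fun n => conj (D.xi n)) hz)

theorem analyticAt_muMinus {z : ℂ} (h0 : z ≠ 0) (hz : ∀ n, z ≠ D.xi n)
    (hz' : ∀ n, z ≠ conj (D.xi n)) (i j : Fin 2) :
    AnalyticAt ℂ (fun w => D.muMinus δ x t w i j) z := by
  fin_cases i <;> fin_cases j
  · exact D.analyticAt_phi11 δ x t hz
  · exact D.analyticAt_phi12 δ x t h0 hz'
  · exact D.analyticAt_phi21 δ x t h0 hz
  · exact D.analyticAt_phi22 δ x t hz'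

theorem continuousAt_muMinus {z : ℂ} (h0 : z ≠ 0) (hz : ∀ n, z ≠ D.xi n)
    (hz' : ∀ n, z ≠ conj (D.xi n)) : ContinuousAt (D.muMinus δ x t) z :=
  continuousAt_pi.2 fun i => continuousAt_pi.2 fun j =>
    (D.analyticAt_muMinus δ x t h0 hz hz' i j).continuousAt

theorem isRHPSolution_assembled : IsRHPSolution D δ (reflection D.scat) x t
    (assembled D.q₀ (D.muMinus δ) (D.muPlus δ) D.scat x t) where
  analytic z h hz hz' i j := by
    have h0 : z ≠ 0 := by
      rintro rfl
      exact h (.inl rfl)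
    refine (D.analyticAt_muMinus δ x t h0 hz hz' i j).congr ?_
    filter_upwards [D.eventually_assembled_eq_muMinus δ x t (isOpen_ne.mem_nhds h0)
      (D.eventually_ne_poles hz hz')] with w hw
    rw [hw]
  regular_plus n i := by
    have h : ∀ᶠ w in 𝓝 (D.xi n), w ∈ Dplus D.q₀ :=
      (isOpen_Dplus _).mem_nhds (D.xi_mem_Dplus n)
    fin_cases i
    · exact (D.analyticAt_phi12 δ x t (D.xi_ne_zero n) (D.xi_ne_conj_xi n)).congr
        (h.mono fun w hw => by simp [D.assembled_of_mem_Dplus δ x t hw])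
    · exact (D.analyticAt_phi22 δ x t (D.xi_ne_conj_xi n)).congr
        (h.mono fun w hw => by simp [D.assembled_of_mem_Dplus δ x t hw])
  residue_plus n i := by
    have h := D.eventually_assembled_eq_muMinus δ x t
      (eventually_ne_nhdsNE _ _)
      (D.eventually_punctured_ne_poles (D.xi n))
    rw [D.assembled_of_mem_Dplus δ x t (D.xi_mem_Dplus n)]
    fin_cases i
    · have h1 := hasSimplePole_of_eq_cauchySum (fun j => -(D.Y δ x t j * conj (D.Z δ x t j)))
        D.xi_injective n (f := fun w => assembled D.q₀ (D.muMinus δ) (D.muPlus δ) D.scat x t w 0 0)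
        (h := fun _ => 1) analyticAt_const (h.mono fun w hw => by
          simp [hw, muMinus, phi11, neg_div, sub_eq_add_neg])
      simpa [phi12_xi, Y] using h1
    · have h1 := hasSimplePole_of_eq_cauchySum (fun j => D.Y δ x t j * D.X δ x t j)
        D.xi_injective n (f := fun w => assembled D.q₀ (D.muMinus δ) (D.muPlus δ) D.scat x t w 1 0)
        (h := fun w => D.qm / w) (analyticAt_const.fun_div analyticAt_id (D.xi_ne_zero n))
        (h.mono fun w hw => by simp [hw, muMinus, phi21])
      simpa [phi22_xi, Y] using h1
  regular_minus n i := by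
    have h : ∀ᶠ w in 𝓝 (conj (D.xi n)), w ∉ Dplus D.q₀ :=
      ((isOpen_Dminus _).eventually_mem (D.conj_xi_mem_Dminus n)).mono fun w hw hw' =>
        notMem_Dminus_of_mem_Dplus hw' hw
    have hξ : ∀ j, conj (D.xi n) ≠ D.xi j := fun j => (D.xi_ne_conj_xi j n).symm
    fin_cases i
    · exact (D.analyticAt_phi11 δ x t hξ).congr
        (h.mono fun w hw => by simp [D.assembled_of_notMem_Dplus δ x t hw])
    · exact (D.analyticAt_phi21 δ x t (D.conj_xi_ne_zero n) hξ).congr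
        (h.mono fun w hw => by simp [D.assembled_of_notMem_Dplus δ x t hw])
  residue_minus n i := by
    have h := D.eventually_assembled_eq_muMinus δ x t
      (eventually_ne_nhdsNE _ _)
      (D.eventually_punctured_ne_poles (conj (D.xi n)))
    have hn : conj (D.xi n) ∉ Dplus D.q₀ := fun hw' =>
      notMem_Dminus_of_mem_Dplus hw' (D.conj_xi_mem_Dminus n)
    rw [D.assembled_of_notMem_Dplus δ x t hn]
    fin_cases i
    · have h1 := hasSimplePole_of_eq_cauchySum
        (fun j => -(conj (D.Y δ x t j) * conj (D.X δ x t j)))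
        D.conj_xi_injective n
        (f := fun w => assembled D.q₀ (D.muMinus δ) (D.muPlus δ) D.scat x t w 0 1)
        (h := fun w => -conj D.qm / w)
        (analyticAt_const.fun_div analyticAt_id (D.conj_xi_ne_zero n)) (h.mono fun w hw => by
          simp [hw, muMinus, phi12, neg_div, sub_eq_add_neg])
      simpa [phi11_conj_xi, conj_Y, Ctilde] using h1
    · have h1 := hasSimplePole_of_eq_cauchySum (fun j => -(conj (D.Y δ x t j) * D.Z δ x t j))
        D.conj_xi_injective n
        (f := fun w => assembled D.q₀ (D.muMinus δ) (D.muPlus δ) D.scat x t w 1 1)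
        (h := fun _ => 1) analyticAt_const
        (h.mono fun w hw => by simp [hw, muMinus, phi22, neg_div, sub_eq_add_neg])
      simpa [phi21_conj_xi, conj_Y, Ctilde] using h1
  jump_condition s hs h0 := by
    have h1 := D.ne_conj_xi_of_mem (.inr hs)
    have h2 := D.ne_xi_of_mem (.inr hs)
    have h : Tendsto (assembled D.q₀ (D.muMinus δ) (D.muPlus δ) D.scat x t) (𝓝 s)
        (𝓝 (D.muMinus δ x t s)) := by
      refine (D.continuousAt_muMinus δ x t h0 h2 h1).congr' ?_
      filter_upwards [D.eventually_assembled_eq_muMinus δ x t (isOpen_ne.mem_nhds h0)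
        (D.eventually_ne_poles h2 h1)] with w hw
      rw [hw]
    refine ⟨_, _, h.mono_left nhdsWithin_le_nhds, h.mono_left nhdsWithin_le_nhds, ?_⟩
    have hj : jump δ D.q₀ (reflection D.scat) x t s = 0 := by
      ext i j
      fin_cases i <;> fin_cases j <;> simp [jump, reflection, scat]
    rw [hj, sub_zero, mul_one]
  at_infinity i j := by
    refine Asymptotics.IsBigO.mono ?_ inf_le_left
    have h := D.eventually_assembled_eq_muMinus δ x t (l := Bornology.cobounded ℂ)
      (Bornology.eventually_ne_cobounded 0)
      (eventually_all.2 fun n => (Bornology.eventually_ne_cobounded _).and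
        (Bornology.eventually_ne_cobounded _))
    have hz : ∀ r : ℂ, (fun z => r / z) =O[Bornology.cobounded ℂ] (fun z : ℂ => z⁻¹) := fun r => by
      simpa using isBigO_div_sub_cobounded r 0
    fin_cases i <;> fin_cases j
    · refine (isBigO_cauchySum_cobounded (fun j => -(D.Y δ x t j * conj (D.Z δ x t j)))
        D.xi).congr' (h.mono fun w hw => ?_) EventuallyEq.rfl
      simp [hw, muMinus, phi11, neg_div]
    · refine ((hz (-conj D.qm)).add (isBigO_cauchySum_cobounded
        (fun j => -(conj (D.Y δ x t j) * conj (D.X δ x t j))) fun j => conj (D.xi j))).congr'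
        (h.mono fun w hw => ?_) EventuallyEq.rfl
      simp [hw, muMinus, phi12, neg_div, sub_eq_add_neg]
    · refine ((hz D.qm).add (isBigO_cauchySum_cobounded
        (fun j => D.Y δ x t j * D.X δ x t j) D.xi)).congr'
        (h.mono fun w hw => ?_) EventuallyEq.rfl
      simp [hw, muMinus, phi21]
    · refine (isBigO_cauchySum_cobounded (fun j => -(conj (D.Y δ x t j) * D.Z δ x t j))
        fun j => conj (D.xi j)).congr' (h.mono fun w hw => ?_) EventuallyEq.rfl
      simp [hw, muMinus, phi22, neg_div]
  at_zero i j := by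
    have h0 : ∀ᶠ z : ℂ in 𝓝[(contour D.q₀)ᶜ] 0, z ≠ 0 :=
      eventually_mem_nhdsWithin.mono fun z hz h => hz (.inl (by simp [h]))
    have h := D.eventually_assembled_eq_muMinus δ x t h0
      ((D.eventually_ne_poles (fun n => (D.xi_ne_zero n).symm)
        fun n => (D.conj_xi_ne_zero n).symm).filter_mono nhdsWithin_le_nhds)
    have hc : ∀ {f : ℂ → ℂ}, AnalyticAt ℂ f 0 → f =O[𝓝[(contour D.q₀)ᶜ] 0] fun _ => (1 : ℂ) :=
      fun hf => (hf.continuousAt.tendsto.mono_left nhdsWithin_le_nhds).isBigO_one ℂ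
    fin_cases i <;> fin_cases j
    · refine (hc (D.analyticAt_phi11 δ x t fun n => (D.xi_ne_zero n).symm)).congr'
        (h.mono fun w hw => ?_) EventuallyEq.rfl
      simp [hw, muMinus, polePart]
    · refine (hc (analyticAt_cauchySum (fun j => -(conj (D.Y δ x t j) * conj (D.X δ x t j)))
        (fun j => conj (D.xi j)) fun n => (D.conj_xi_ne_zero n).symm)).congr'
        (h.mono fun w hw => ?_) EventuallyEq.rfl
      simp [hw, muMinus, phi12, polePart, neg_div]
      ring
    · refine (hc (analyticAt_cauchySum (fun j => D.Y δ x t j * D.X δ x t j) D.xi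
        fun n => (D.xi_ne_zero n).symm)).congr' (h.mono fun w hw => ?_) EventuallyEq.rfl
      simp [hw, muMinus, phi21, polePart]
    · refine (hc (D.analyticAt_phi22 δ x t fun n => (D.conj_xi_ne_zero n).symm)).congr'
        (h.mono fun w hw => ?_) EventuallyEq.rfl
      simp [hw, muMinus, polePart]

theorem mulVec_muMinus : (1 + D.A δ x t).mulVec (fun n => D.muMinus δ x t (D.xi n) 1 1) =
    D.B δ x t := by
  have h : (fun n => D.muMinus δ x t (D.xi n) 1 1) = D.X δ x t :=
    funext fun n => D.phi22_xi δ x t n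
  rw [h]
  exact D.mulVec_X δ x t

end DiscreteData

/-! ### Painlevé's theorem on removable lines -/

/-- Cauchy–Goursat asks for differentiability only in the open rectangle, so the real axis may run
along an edge. -/
theorem boundary_rect_eq_zero {f : ℂ → ℂ} {U : Set ℂ}
    (hc : ContinuousOn f U) (hd : ∀ z ∈ U, z.im ≠ 0 → DifferentiableAt ℂ f z) {z w : ℂ}
    (hzw : Complex.Rectangle z w ⊆ U) {a b : ℝ} (ha : a ∈ Set.uIcc z.im w.im)
    (hb : b ∈ Set.uIcc z.im w.im) (h0 : 0 ∉ Set.Ioo (min a b) (max a b)) :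
    (∫ x : ℝ in z.re..w.re, f (x + a * Complex.I)) -
      (∫ x : ℝ in z.re..w.re, f (x + b * Complex.I)) +
      Complex.I * (∫ y : ℝ in a..b, f (w.re + y * Complex.I)) -
      Complex.I * ∫ y : ℝ in a..b, f (z.re + y * Complex.I) = 0 := by
  have hsub : Set.uIcc a b ⊆ Set.uIcc z.im w.im := Set.uIcc_subset_uIcc ha hb
  have hR : Set.uIcc z.re w.re ×ℂ Set.uIcc a b ⊆ U := fun u hu => hzw ⟨hu.1, hsub hu.2⟩
  have h := Complex.integral_boundary_rect_eq_zero_of_continuousOn_of_differentiableOn f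
    ⟨z.re, a⟩ ⟨w.re, b⟩ (hc.mono hR) fun u hu => by
      refine (hd u (hR ⟨Set.Ioo_subset_Icc_self hu.1, Set.Ioo_subset_Icc_self hu.2⟩)
        fun h => h0 ?_).differentiableWithinAt
      have := hu.2
      rwa [Set.mem_preimage, h] at this
  simpa using h

theorem differentiableOn_of_continuousOn_of_im_ne_zero {f : ℂ → ℂ} {U : Set ℂ} (hU : IsOpen U)
    (hc : ContinuousOn f U) (hd : ∀ z ∈ U, z.im ≠ 0 → DifferentiableAt ℂ f z) :
    DifferentiableOn ℂ f U := by
  refine (Complex.isConservativeOn_and_continuousOn_iff_isDifferentiableOn hU).1 ⟨?_, hc⟩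
  intro z w hzw
  rw [← add_eq_zero_iff_eq_neg, Complex.wedgeIntegral_add_wedgeIntegral_eq]
  simp only [smul_eq_mul]
  -- A rectangle meeting the real axis is cut along it; the integrals over the cut cancel, and
  -- Morera's theorem applies.
  by_cases h0 : (0 : ℝ) ∈ Set.uIcc z.im w.im
  · have h1 := boundary_rect_eq_zero hc hd hzw Set.left_mem_uIcc h0 (by
      rcases le_total z.im 0 with h | h <;> simp [h])
    have h2 := boundary_rect_eq_zero hc hd hzw h0 Set.right_mem_uIcc (by
      rcases le_total w.im 0 with h | h <;> simp [h])
    have hi : ∀ c ∈ Set.uIcc z.re w.re, ∀ a ∈ Set.uIcc z.im w.im, ∀ b ∈ Set.uIcc z.im w.im,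
        IntervalIntegrable (fun y : ℝ => f (c + y * Complex.I)) MeasureTheory.volume a b := by
      intro c hcc a ha b hb
      refine (hc.comp (by fun_prop) fun y hy => hzw ⟨?_, ?_⟩).intervalIntegrable
      · simpa using hcc
      · simpa using Set.uIcc_subset_uIcc ha hb hy
    rw [← intervalIntegral.integral_add_adjacent_intervals
        (hi _ Set.right_mem_uIcc _ Set.left_mem_uIcc _ h0)
        (hi _ Set.right_mem_uIcc _ h0 _ Set.right_mem_uIcc),
      ← intervalIntegral.integral_add_adjacent_intervals
        (hi _ Set.left_mem_uIcc _ Set.left_mem_uIcc _ h0)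
        (hi _ Set.left_mem_uIcc _ h0 _ Set.right_mem_uIcc)]
    linear_combination h1 + h2
  · exact boundary_rect_eq_zero hc hd hzw Set.left_mem_uIcc Set.right_mem_uIcc
      fun h => h0 (Set.Ioo_subset_Icc_self h)

/-- The local inverse of φ straightens the curve Im φ = 0 to the real axis, where Painlevé's theorem
applies to f ∘ φ⁻¹. -/
theorem analyticAt_of_continuous_of_im_ne_zero {f φ : ℂ → ℂ} {s : ℂ} (hφ : AnalyticAt ℂ φ s)
    (hφ' : deriv φ s ≠ 0) (hc : ∀ᶠ z in 𝓝 s, ContinuousAt f z)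
    (hd : ∀ᶠ z in 𝓝 s, (φ z).im ≠ 0 → DifferentiableAt ℂ f z) : AnalyticAt ℂ f s := by
  set ψ := hφ.hasStrictDerivAt.localInverse _ _ _ hφ' with hψ
  have hψa : AnalyticAt ℂ ψ (φ s) := hφ.analyticAt_localInverse hφ'
  have hψs : ψ (φ s) = s := HasStrictFDerivAt.localInverse_apply_image ..
  have ht : Tendsto ψ (𝓝 (φ s)) (𝓝 s) := by simpa [ContinuousAt, hψs] using hψa.continuousAt
  have hr : ∀ᶠ w in 𝓝 (φ s), φ (ψ w) = w := HasStrictDerivAt.eventually_right_inverse ..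
  have hl : ∀ᶠ z in 𝓝 s, ψ (φ z) = z := HasStrictDerivAt.eventually_left_inverse ..
  obtain ⟨U, hU, hUo, hsU⟩ := eventually_nhds_iff.1
    (((hψa.eventually_analyticAt.and hr).and (ht.eventually hc)).and (ht.eventually hd))
  have h : DifferentiableOn ℂ (f ∘ ψ) U := by
    refine differentiableOn_of_continuousOn_of_im_ne_zero hUo (fun w hw => ?_) fun w hw him => ?_
    · obtain ⟨⟨⟨h1, -⟩, h3⟩, -⟩ := hU w hw
      exact (h3.comp h1.continuousAt).continuousWithinAt
    · obtain ⟨⟨⟨h1, h2⟩, -⟩, h4⟩ := hU w hw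
      exact (h4 (by rwa [h2])).comp w h1.differentiableAt
  refine (((h.analyticAt (hUo.mem_nhds hsU)).comp hφ)).congr ?_
  filter_upwards [hl] with z hz
  simp [hz]

/-! ### Removing the contour -/

theorem dense_contour_compl {q₀ : ℝ} (hq : 0 < q₀) : Dense (contour q₀)ᶜ := by
  have h1 : Dense ({z : ℂ | z.im = 0}ᶜ) := by
    rw [← interior_eq_empty_iff_dense_compl]
    have : {z : ℂ | z.im = 0} = Complex.im ⁻¹' {0} := rfl
    rw [this, Complex.interior_preimage_im, interior_singleton, Set.preimage_empty]
  have h2 : Dense (Metric.sphere (0 : ℂ) q₀)ᶜ := by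
    rw [← interior_eq_empty_iff_dense_compl]
    exact interior_sphere _ hq.ne'
  have h3 : (contour q₀)ᶜ = {z : ℂ | z.im = 0}ᶜ ∩ (Metric.sphere (0 : ℂ) q₀)ᶜ := by
    ext z
    simp [contour, not_or]
  rw [h3]
  exact h1.inter_of_isOpen_right h2 Metric.isClosed_sphere.isOpen_compl

theorem isOpen_contour_compl {q₀ : ℝ} (hq : 0 < q₀) : IsOpen (contour q₀)ᶜ :=
  contour_compl hq ▸ (isOpen_Dplus q₀).union (isOpen_Dminus q₀)

theorem lam_im_eq_zero_of_mem_contour {q₀ : ℝ} (hq : 0 < q₀) {z : ℂ} (hz : z ∈ contour q₀) :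
    (lam q₀ z).im = 0 := by
  rw [← Complex.conj_eq_iff_im, DiscreteData.conj_lam]
  rcases hz with h | h
  · rw [Complex.conj_eq_iff_im.2 h]
  · have hz0 : z ≠ 0 := by
      rintro rfl
      simp at h
      exact hq.ne h
    have h1 : z * conj z = (q₀ : ℂ) ^ 2 := by
      rw [Complex.mul_conj, Complex.normSq_eq_norm_sq, h]
      push_cast
      rfl
    have h2 : conj z ≠ 0 := (map_ne_zero _).2 hz0
    simp only [lam, ← h1]
    field_simp
    ring

/-- Σ minus the origin lies in Im λ = 0, so one coordinate λ straightens the line and the circle at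
once. It fails only at the two crossings ±q₀, which are isolated. -/
theorem exists_analyticOnNhd_of_tendsto_contour {q₀ : ℝ} (hq : 0 < q₀) {f : ℂ → ℂ} {U : Set ℂ}
    (hU : IsOpen U) (h0 : (0 : ℂ) ∉ U) (hf : ∀ z ∈ U, z ∉ contour q₀ → AnalyticAt ℂ f z)
    (hl : ∀ s ∈ U, s ∈ contour q₀ → ∃ l, Tendsto f (𝓝[(contour q₀)ᶜ] s) (𝓝 l)) :
    ∃ g : ℂ → ℂ, AnalyticOnNhd ℂ g U ∧ ∀ z ∈ U, z ∉ contour q₀ → g z = f z := by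
  have hD := dense_contour_compl hq
  have hO := isOpen_contour_compl hq
  set g := extendFrom (contour q₀)ᶜ f with hg
  have hgf : ∀ z ∈ U, z ∉ contour q₀ → g z = f z := fun z hz hzc =>
    extendFrom_eq (hD z) ((hf z hz hzc).continuousAt.tendsto.mono_left nhdsWithin_le_nhds)
  have hgc : ContinuousOn g U := by
    refine continuousOn_extendFrom (fun z _ => hD z) fun z hz => ?_
    by_cases hzc : z ∈ contour q₀
    · exact hl z hz hzc
    · exact ⟨_, (hf z hz hzc).continuousAt.tendsto.mono_left nhdsWithin_le_nhds⟩
  have hga : ∀ z ∈ U, z ∉ contour q₀ → AnalyticAt ℂ g z := by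
    intro z hz hzc
    refine (hf z hz hzc).congr ?_
    filter_upwards [hU.mem_nhds hz, hO.mem_nhds hzc] with w hw hwc
    exact (hgf w hw hwc).symm
  have hgc' : ∀ z ∈ U, ContinuousAt g z := fun z hz => hgc.continuousAt (hU.mem_nhds hz)
  have key : ∀ z ∈ U, z ^ 2 ≠ (q₀ : ℂ) ^ 2 → AnalyticAt ℂ g z := by
    intro z hz hzq
    have hz0 : z ≠ 0 := fun h => h0 (h ▸ hz)
    have hd : HasDerivAt (lam q₀) ((1 - (q₀ : ℂ) ^ 2 / z ^ 2) / 2) z := by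
      refine (((hasDerivAt_id z).add ((hasDerivAt_inv hz0).const_mul ((q₀ : ℂ) ^ 2))).div_const
        2).congr_deriv ?_
      ring
    have ha : AnalyticAt ℂ (lam q₀) z :=
      (analyticAt_id.fun_add (analyticAt_const.fun_div analyticAt_id hz0)).fun_div
        analyticAt_const two_ne_zero
    refine analyticAt_of_continuous_of_im_ne_zero ha ?_ ?_ ?_
    · rw [hd.deriv]
      refine div_ne_zero (fun h => hzq ?_) two_ne_zero
      rw [sub_eq_zero, eq_comm, div_eq_one_iff_eq (pow_ne_zero 2 hz0)] at h
      exact h.symm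
    · filter_upwards [hU.mem_nhds hz] with w hw using hgc' w hw
    · filter_upwards [hU.mem_nhds hz] with w hw him
      exact (hga w hw fun h => him (lam_im_eq_zero_of_mem_contour hq h)).differentiableAt
  refine ⟨g, fun z hz => ?_, hgf⟩
  -- At ±q₀ the derivative of λ vanishes; there the extension is continuous and analytic on a
  -- punctured neighbourhood.
  by_cases hzq : z ^ 2 = (q₀ : ℂ) ^ 2
  · refine Complex.analyticAt_of_differentiable_on_punctured_nhds_of_continuousAt ?_ (hgc' z hz)
    have hne : ∀ᶠ w in 𝓝[≠] z, w ≠ (q₀ : ℂ) ∧ w ≠ -(q₀ : ℂ) :=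
      (DiscreteData.eventually_ne_nhdsNE z _).and (DiscreteData.eventually_ne_nhdsNE z _)
    filter_upwards [nhdsWithin_le_nhds (hU.mem_nhds hz), hne] with w hw hwq
    refine (key w hw fun h => ?_).differentiableAt
    rcases sq_eq_sq_iff_eq_or_eq_neg.1 h with h | h
    exacts [hwq.1 h, hwq.2 h]
  · exact key z hz hzq

/-! ### Rational functions with prescribed poles -/

theorem norm_le_of_dense {S V : Set ℂ} (hS : Dense S) (hV : IsOpen V) {g : ℂ → ℂ}
    (hg : ContinuousOn g V) {K : ℝ} (h : ∀ z ∈ V, z ∈ S → ‖g z‖ ≤ K) {z : ℂ} (hz : z ∈ V) :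
    ‖g z‖ ≤ K := by
  have h1 : z ∈ closure (V ∩ S) := hS.open_subset_closure_inter hV hz
  have h2 : ContinuousWithinAt (fun w => ‖g w‖) (V ∩ S) z :=
    ((hg z hz).norm).mono Set.inter_subset_left
  exact h2.closure_le h1 continuousWithinAt_const fun w hw => h w hw.1 hw.2

theorem exists_differentiable_of_removable {g : ℂ → ℂ}
    (hg : ∀ z, ∃ h : ℂ → ℂ, AnalyticAt ℂ h z ∧ ∀ᶠ w in 𝓝[≠] z, g w = h w) :
    ∃ E : ℂ → ℂ, Differentiable ℂ E ∧ ∀ z, ContinuousAt g z → E z = g z := by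
  have hlim : ∀ {h : ℂ → ℂ} {z : ℂ}, ContinuousAt h z → (∀ᶠ w in 𝓝[≠] z, g w = h w) →
      limUnder (𝓝[≠] z) g = h z := fun hh he =>
    ((hh.tendsto.mono_left nhdsWithin_le_nhds).congr' (he.mono fun _ => Eq.symm)).limUnder_eq
  refine ⟨fun z => limUnder (𝓝[≠] z) g, fun z => ?_, fun z hz => hlim hz (.of_forall fun _ => rfl)⟩
  obtain ⟨h, hh, he⟩ := hg z
  refine (hh.congr ?_).differentiableAt
  have h1 : ∀ᶠ w in 𝓝 z, w ≠ z → g w = h w := eventually_nhdsWithin_iff.1 he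
  filter_upwards [h1.eventually_nhds, hh.eventually_analyticAt] with w hw hwa
  refine (hlim hwa.continuousAt ?_).symm
  rcases eq_or_ne w z with rfl | hne
  · exact he
  · filter_upwards [nhdsWithin_le_nhds hw, nhdsWithin_le_nhds (eventually_ne_nhds hne)] with v h2 h3
    exact h2 h3

theorem exists_analyticAt_of_bounded {g : ℂ → ℂ} {V : Set ℂ} {c : ℂ} {K : ℝ} (hV : V ∈ 𝓝 c)
    (hd : DifferentiableOn ℂ g (V \ {c})) (hK : ∀ z ∈ V \ {c}, ‖g z‖ ≤ K) :
    ∃ h : ℂ → ℂ, AnalyticAt ℂ h c ∧ ∀ᶠ w in 𝓝[≠] c, g w = h w := by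
  refine ⟨_, (Complex.differentiableOn_update_limUnder_of_bddAbove hV hd
    ⟨K, ?_⟩).analyticAt hV, ?_⟩
  · rintro _ ⟨z, hz, rfl⟩
    exact hK z hz
  · filter_upwards [self_mem_nhdsWithin] with w hw
    rw [Function.update_of_ne hw]

/-- Liouville: the difference of f and the rational function with the same singular parts extends
across the contour, the poles and 0 to an entire function that vanishes at infinity. -/
theorem eq_cauchySum_of_contour {ι : Type*} [Fintype ι] {q₀ : ℝ} (hq : 0 < q₀) {f : ℂ → ℂ}
    {r a : ι → ℂ} (ha : Function.Injective a) (hac : ∀ n, a n ∉ contour q₀) {d c : ℂ}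
    (hf : ∀ z ∉ contour q₀, (∀ n, z ≠ a n) → AnalyticAt ℂ f z)
    (hp : ∀ n, HasSimplePole f (a n) (r n))
    (hl : ∀ s ∈ contour q₀, s ≠ 0 → ∃ l, Tendsto f (𝓝[(contour q₀)ᶜ] s) (𝓝 l))
    (hinf : (fun z => f z - d) =O[Bornology.cobounded ℂ ⊓ 𝓟 (contour q₀)ᶜ] fun z => z⁻¹)
    (hzero : (fun z => f z - c / z) =O[𝓝[(contour q₀)ᶜ] 0] fun _ => (1 : ℂ)) {z : ℂ}
    (hz : z ∉ contour q₀) (hza : ∀ n, z ≠ a n) :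
    f z = d + c / z + ∑ n, r n / (z - a n) := by
  have hD := dense_contour_compl hq
  have hO := isOpen_contour_compl hq
  have h0c : (0 : ℂ) ∈ contour q₀ := .inl rfl
  have ha0 : ∀ n, (0 : ℂ) ≠ a n := fun n h => hac n (h ▸ h0c)
  set R : ℂ → ℂ := fun z => d + c / z + ∑ n, r n / (z - a n) with hR
  set F : ℂ → ℂ := fun z => f z - R z with hF
  have hRa : ∀ z, z ≠ 0 → (∀ n, z ≠ a n) → AnalyticAt ℂ R z := fun z h1 h2 =>
    (analyticAt_const.fun_add (analyticAt_const.fun_div analyticAt_id h1)).fun_add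
      (analyticAt_cauchySum r a h2)
  have hFa : ∀ z ∉ contour q₀, (∀ n, z ≠ a n) → AnalyticAt ℂ F z := fun z h1 h2 =>
    (hf z h1 h2).fun_sub (hRa z (fun h => h1 (h ▸ h0c)) h2)
  set U : Set ℂ := {z | z ≠ 0 ∧ ∀ n, z ≠ a n} with hU
  have hUo : IsOpen U := by
    have : U = {0}ᶜ ∩ (Set.range a)ᶜ := by
      ext z
      simp [hU, eq_comm]
    rw [this]
    exact isClosed_singleton.isOpen_compl.inter (Set.finite_range a).isClosed.isOpen_compl
  obtain ⟨g, hgU, hgF⟩ := exists_analyticOnNhd_of_tendsto_contour hq (f := F) hUo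
    (fun h => h.1 rfl) (fun z h1 h2 => hFa z h2 h1.2) fun s h1 h2 => by
      obtain ⟨l, h⟩ := hl s h2 h1.1
      exact ⟨_, h.sub ((hRa s h1.1 h1.2).continuousAt.tendsto.mono_left nhdsWithin_le_nhds)⟩
  have hrem : ∀ z, ∃ h : ℂ → ℂ, AnalyticAt ℂ h z ∧ ∀ᶠ w in 𝓝[≠] z, g w = h w := by
    intro z
    by_cases hzU : z ∈ U
    · exact ⟨g, hgU z hzU, .of_forall fun _ => rfl⟩
    by_cases hz0 : z = 0
    · subst hz0
      have hb : F =O[𝓝[(contour q₀)ᶜ] 0] fun _ => (1 : ℂ) := by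
        have h1 : AnalyticAt ℂ (fun z => d + ∑ n, r n / (z - a n)) 0 :=
          analyticAt_const.fun_add (analyticAt_cauchySum r a ha0)
        refine (hzero.sub ((h1.continuousAt.tendsto.mono_left nhdsWithin_le_nhds).isBigO_one
          ℂ)).congr_left fun z => ?_
        simp only [hF, hR]
        ring
      obtain ⟨K, hK⟩ := hb.bound
      obtain ⟨V, hV, hVo, h0V⟩ := eventually_nhds_iff.1 (eventually_nhdsWithin_iff.1 hK)
      obtain ⟨W, hW, hWo, h0W⟩ := eventually_nhds_iff.1
        (eventually_all.2 fun n => eventually_ne_nhds (ha0 n))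
      have hsub : (V ∩ W) \ {0} ⊆ U := fun w hw => ⟨hw.2, hW w hw.1.2⟩
      -- The bound near 0 is known only off the contour; density and continuity carry it to the
      -- whole punctured neighbourhood. The same device is used at infinity.
      refine exists_analyticAt_of_bounded (V := V ∩ W) (K := K)
        ((hVo.inter hWo).mem_nhds ⟨h0V, h0W⟩) (hgU.differentiableOn.mono hsub) fun w hw => ?_
      refine norm_le_of_dense hD ((hVo.inter hWo).sdiff isClosed_singleton)
        (hgU.continuousOn.mono hsub) (fun v hv hvc => ?_) hw
      rw [hgF v (hsub hv) hvc]
      simpa using hV v hv.1.1 hvc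
    · have : ∃ n, z = a n := by
        by_contra! h
        exact hzU ⟨hz0, h⟩
      obtain ⟨n, rfl⟩ := this
      obtain ⟨p, hpa, hpe⟩ := hp n
      obtain ⟨p', hpa', hpe'⟩ := hasSimplePole_of_eq_cauchySum r ha n (f := R)
        (h := fun z => d + c / z)
        (analyticAt_const.fun_add (analyticAt_const.fun_div analyticAt_id hz0))
        (.of_forall fun _ => rfl)
      refine ⟨fun w => p w - p' w, hpa.fun_sub hpa', ?_⟩
      filter_upwards [hpe, hpe', nhdsWithin_le_nhds (hO.mem_nhds (hac n)),
        nhdsWithin_le_nhds (eventually_ne_nhds hz0),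
        eventually_all.2 fun m => DiscreteData.eventually_ne_nhdsNE (a n)
          (a m)] with w h1 h2 h3 h4 h5
      rw [hgF w ⟨h4, h5⟩ h3]
      simp only [hF, h1, h2]
      ring
  obtain ⟨E, hE, hEg⟩ := exists_differentiable_of_removable hrem
  have hEF : ∀ z ∉ contour q₀, (∀ n, z ≠ a n) → E z = F z := fun z h1 h2 => by
    have hzU : z ∈ U := ⟨fun h => h1 (h ▸ h0c), h2⟩
    rw [hEg z (hgU z hzU).continuousAt, hgF z hzU h1]
  have hFinf : Tendsto F (Bornology.cobounded ℂ ⊓ 𝓟 (contour q₀)ᶜ) (𝓝 0) := by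
    have h1 : (fun z : ℂ => c / z) =O[Bornology.cobounded ℂ] fun z => z⁻¹ := by
      simpa using isBigO_div_sub_cobounded c 0
    have h2 : F =O[Bornology.cobounded ℂ ⊓ 𝓟 (contour q₀)ᶜ] fun z => z⁻¹ := by
      refine (hinf.sub ((h1.add (isBigO_cauchySum_cobounded r a)).mono inf_le_left)).congr_left
        fun z => ?_
      simp only [hF, hR]
      ring
    exact h2.trans_tendsto (tendsto_inv₀_cobounded.mono_left inf_le_left)
  have hEinf : Tendsto E (cocompact ℂ) (𝓝 0) := by
    rw [← Metric.cobounded_eq_cocompact, Metric.tendsto_nhds]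
    intro ε hε
    have h1 : ∀ᶠ z in Bornology.cobounded ℂ, z ∈ (contour q₀)ᶜ → ‖E z‖ ≤ ε / 2 := by
      have h2 := hFinf.eventually (Metric.closedBall_mem_nhds 0 (half_pos hε))
      rw [eventually_inf_principal] at h2
      filter_upwards [h2, eventually_all.2 fun n =>
        Bornology.eventually_ne_cobounded (a n)] with w h3 h4 h5
      rw [hEF w h5 h4]
      simpa using h3 h5
    obtain ⟨ρ, -, hρ⟩ := (Filter.hasBasis_cobounded_norm (E := ℂ)).eventually_iff.1 h1
    filter_upwards [(Filter.hasBasis_cobounded_norm (E := ℂ)).mem_of_mem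
      (i := ρ + 1) trivial] with w hw
    have hV : IsOpen {z : ℂ | ρ < ‖z‖} := isOpen_lt continuous_const continuous_norm
    have := norm_le_of_dense hD hV hE.continuous.continuousOn
      (fun z hz hzc => hρ (show z ∈ {z : ℂ | ρ ≤ ‖z‖} from le_of_lt (show ρ < ‖z‖ from hz)) hzc)
      (show w ∈ {z : ℂ | ρ < ‖z‖} from (lt_add_one ρ).trans_le hw)
    simpa using this.trans_lt (half_lt_self hε)
  have h := hE.apply_eq_of_tendsto_cocompact z hEinf
  rw [hEF z hz hza] at h
  exact sub_eq_zero.1 h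

/-! ### Solutions of the Riemann–Hilbert problem without jump -/

/-- Σ is invariant under conjugation, so ρ̃ vanishes with ρ, the jump matrix is zero and the limits
from D⁺ and D⁻ coincide. -/
theorem IsRHPSolution.exists_tendsto {N : ℕ} {D : DiscreteData N} {δ : ℝ} {ρ : ℂ → ℂ} {x t : ℝ}
    {Φ : ℂ → Matrix (Fin 2) (Fin 2) ℂ} (h : IsRHPSolution D δ ρ x t Φ)
    (hρ : ∀ s ∈ contour D.q₀, ρ s = 0) {s : ℂ} (hs : s ∈ contour D.q₀) (h0 : s ≠ 0) (i j : Fin 2) :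
    ∃ l, Tendsto (fun z => Φ z i j) (𝓝[(contour D.q₀)ᶜ] s) (𝓝 l) := by
  obtain ⟨P, R, hP, hR, e⟩ := h.jump_condition s hs h0
  have hj : jump δ D.q₀ ρ x t s = 0 := by
    ext i j
    fin_cases i <;> fin_cases j <;>
      simp [jump, hρ s hs, hρ (conj s) (conj_mem_contour_iff.2 hs)]
  rw [hj, sub_zero, mul_one] at e
  subst e
  have h1 : Tendsto Φ (𝓝[(contour D.q₀)ᶜ] s) (𝓝 R) := by
    rw [contour_compl D.q₀_pos, nhdsWithin_union]
    exact hP.sup hR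
  exact ⟨R i j, (tendsto_pi_nhds.1 (tendsto_pi_nhds.1 h1 i) j)⟩

theorem IsRHPSolution.col_zero_eq {N : ℕ} {D : DiscreteData N} {δ : ℝ} {ρ : ℂ → ℂ} {x t : ℝ}
    {Φ : ℂ → Matrix (Fin 2) (Fin 2) ℂ} (h : IsRHPSolution D δ ρ x t Φ)
    (hρ : ∀ s ∈ contour D.q₀, ρ s = 0) {z : ℂ} (hz : z ∉ contour D.q₀) (hzξ : ∀ n, z ≠ D.xi n) :
    Φ z 1 0 = D.qm / z + ∑ n, D.Y δ x t n * Φ (D.xi n) 1 1 / (z - D.xi n) := by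
  have h1 := eq_cauchySum_of_contour D.q₀_pos (f := fun z => Φ z 1 0) (d := 0) (c := D.qm)
    D.xi_injective (fun n => notMem_contour_of_mem_Dplus (D.xi_mem_Dplus n))
    (fun w hw hwξ => ?_) (fun n => h.residue_plus n 1)
    (fun s hs h0 => h.exists_tendsto hρ hs h0 1 0) (by simpa using h.at_infinity 1 0)
    (by simpa [polePart] using h.at_zero 1 0) hz hzξ
  · simpa [DiscreteData.Y] using h1
  · by_cases hw' : ∀ n, w ≠ conj (D.xi n)
    · exact h.analytic w hw hwξ hw' 1 0
    · push Not at hw'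
      obtain ⟨n, rfl⟩ := hw'
      exact h.regular_minus n 1

theorem IsRHPSolution.col_one_eq {N : ℕ} {D : DiscreteData N} {δ : ℝ} {ρ : ℂ → ℂ} {x t : ℝ}
    {Φ : ℂ → Matrix (Fin 2) (Fin 2) ℂ} (h : IsRHPSolution D δ ρ x t Φ)
    (hρ : ∀ s ∈ contour D.q₀, ρ s = 0) {z : ℂ} (hz : z ∉ contour D.q₀)
    (hzξ : ∀ n, z ≠ conj (D.xi n)) :
    Φ z 1 1 = 1 - ∑ n, conj (D.Y δ x t n) * Φ (conj (D.xi n)) 1 0 / (z - conj (D.xi n)) := by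
  have h1 := eq_cauchySum_of_contour D.q₀_pos (f := fun z => Φ z 1 1) (d := 1) (c := 0)
    D.conj_xi_injective
    (fun n => notMem_contour_of_mem_Dminus (D.conj_xi_mem_Dminus n))
    (fun w hw hwξ => ?_) (fun n => h.residue_minus n 1)
    (fun s hs h0 => h.exists_tendsto hρ hs h0 1 1) (by simpa using h.at_infinity 1 1)
    (by simpa [polePart] using h.at_zero 1 1) hz hzξ
  · rw [h1]
    simp [DiscreteData.conj_Y, DiscreteData.Ctilde, neg_div, sub_eq_add_neg]
  · by_cases hw' : ∀ n, w ≠ D.xi n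
    · exact h.analytic w hw hw' hwξ 1 1
    · push Not at hw'
      obtain ⟨n, rfl⟩ := hw'
      exact h.regular_plus n 1

theorem IsRHPSolution.mulVec_eq {N : ℕ} {D : DiscreteData N} {δ : ℝ} {ρ : ℂ → ℂ} {x t : ℝ}
    {Φ : ℂ → Matrix (Fin 2) (Fin 2) ℂ} (h : IsRHPSolution D δ ρ x t Φ)
    (hρ : ∀ s ∈ contour D.q₀, ρ s = 0) :
    (1 + D.A δ x t).mulVec (fun n => Φ (D.xi n) 1 1) = D.B δ x t :=
  (D.mulVec_eq_B_iff δ x t _ (fun k => Φ (conj (D.xi k)) 1 0) fun k =>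
    h.col_zero_eq hρ (notMem_contour_of_mem_Dminus (D.conj_xi_mem_Dminus k))
      fun n => (D.xi_ne_conj_xi n k).symm).2 fun j =>
    h.col_one_eq hρ (notMem_contour_of_mem_Dplus (D.xi_mem_Dplus j)) (D.xi_ne_conj_xi j)

theorem tendsto_mul_div_sub_cobounded (r a : ℂ) :
    Tendsto (fun z => z * (r / (z - a))) (Bornology.cobounded ℂ) (𝓝 r) := by
  have h : Tendsto (fun z : ℂ => 1 - a * z⁻¹) (Bornology.cobounded ℂ) (𝓝 1) := by
    simpa using (tendsto_inv₀_cobounded (α := ℂ)).const_mul a |>.const_sub 1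
  have h1 : Tendsto (fun z : ℂ => r * (1 - a * z⁻¹)⁻¹) (Bornology.cobounded ℂ) (𝓝 r) := by
    simpa using (h.inv₀ one_ne_zero).const_mul r
  refine h1.congr' ?_
  filter_upwards [Bornology.eventually_ne_cobounded (0 : ℂ)] with z hz
  have : z - a = z * (1 - a * z⁻¹) := by field_simp
  rw [this, div_eq_mul_inv, mul_inv]
  field_simp

theorem IsRHPSolution.tendsto_potential {N : ℕ} {D : DiscreteData N} {δ : ℝ} {ρ : ℂ → ℂ} {x t : ℝ}
    {Φ : ℂ → Matrix (Fin 2) (Fin 2) ℂ} (h : IsRHPSolution D δ ρ x t Φ)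
    (hρ : ∀ s ∈ contour D.q₀, ρ s = 0) :
    Tendsto (fun z => z * Φ z 1 0) (Bornology.cobounded ℂ ⊓ 𝓟 (contour D.q₀)ᶜ)
      (𝓝 (D.potential δ x t)) := by
  have hX : ∀ n, Φ (D.xi n) 1 1 = D.X δ x t n :=
    fun n => congrFun (D.eq_X_of_mulVec_eq δ x t (h.mulVec_eq hρ)) n
  have h1 : Tendsto (fun z => D.qm + ∑ n, z * (D.Y δ x t n * D.X δ x t n / (z - D.xi n)))
      (Bornology.cobounded ℂ) (𝓝 (D.potential δ x t)) := by
    rw [D.potential_eq]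
    exact tendsto_const_nhds.add (tendsto_finsetSum _ fun n _ =>
      tendsto_mul_div_sub_cobounded _ _)
  refine (h1.mono_left inf_le_left).congr' ?_
  rw [EventuallyEq, eventually_inf_principal]
  filter_upwards [Bornology.eventually_ne_cobounded (0 : ℂ), eventually_all.2 fun n =>
    Bornology.eventually_ne_cobounded (D.xi n)] with z hz hzξ hzc
  rw [h.col_zero_eq hρ hzc hzξ, mul_add, mul_div_cancel₀ _ hz, Finset.mul_sum]
  simp only [hX]

/-! ### The gauge transformation -/

theorem dx_mul (n : ℕ) (q : ℝ → ℝ → ℂ) (E : ℝ → ℂ) (x t : ℝ) :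
    dx n (fun x t => q x t * E t) x t = dx n q x t * E t := by
  simp only [dx]
  simp_rw [mul_comm _ (E t)]
  exact iteratedDeriv_const_mul_field _ _

/-- Every monomial has exactly one more unconjugated than conjugated factor, so a unimodular factor
depending on t alone comes out once. -/
theorem sexticTerm_mul {q : ℝ → ℝ → ℂ} {E : ℝ → ℂ} {t : ℝ} (hE : E t * conj (E t) = 1) (x : ℝ) :
    sexticTerm (fun x t => q x t * E t) x t = sexticTerm q x t * E t := by
  simp only [sexticTerm, dx_mul, map_mul]
  generalize dx 1 q x t = p1
  generalize dx 2 q x t = p2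
  generalize dx 3 q x t = p3
  generalize dx 4 q x t = p4
  generalize q x t = p
  generalize conj p1 = r1
  generalize conj p2 = r2
  generalize conj p3 = r3
  generalize conj p4 = r4
  generalize conj p = r
  generalize E t = E at hE ⊢
  have h2 : (E * conj E) ^ 2 = 1 := by rw [hE, one_pow]
  have h3 : (E * conj E) ^ 3 = 1 := by rw [hE, one_pow]
  generalize conj E = e at *
  linear_combination E * (2 * r4 * p ^ 2 + p * (12 * r * p4 + 8 * p1 * r3 + 22 * (p2 * r2)) +
    18 * p * p3 * r1 + 20 * p1 ^ 2 * r2 + 10 * p1 * (5 * p2 * r1 + 3 * r * p3) +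
    20 * r * p2 ^ 2) * hE + E * ((60 * r * (p1 * r1) + 50 * r ^ 2 * p2) * p ^ 2 +
    70 * p * r ^ 2 * p1 ^ 2 + 10 * p ^ 3 * (r1 ^ 2 + 2 * r * r2)) * h2 +
    E * (20 * p ^ 4 * r ^ 3) * h3

/-- Differentiating the phase factor in t produces -(q₀² + 20δq₀⁶) u, which absorbs the two linear
gauge terms. -/
theorem SolvesGaugedSNLS.solvesSNLS {δ q₀ : ℝ} {q : ℝ → ℝ → ℂ} (h : SolvesGaugedSNLS δ q₀ q)
    (hd : ∀ x, Differentiable ℝ fun s => q x s) :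
    SolvesSNLS δ fun x t => q x t *
      Complex.exp (Complex.I * ((q₀ : ℂ) ^ 2 + 20 * δ * (q₀ : ℂ) ^ 6) * t) := by
  intro x t
  set E : ℝ → ℂ := fun t =>
    Complex.exp (Complex.I * ((q₀ : ℂ) ^ 2 + 20 * δ * (q₀ : ℂ) ^ 6) * t) with hE
  have h1 : E t * conj (E t) = 1 := by
    rw [hE, ← Complex.exp_conj, ← Complex.exp_add, ← Complex.exp_zero]
    congr 1
    simp [Complex.conj_ofNat]
  have h2 : HasDerivAt E (E t * (Complex.I * ((q₀ : ℂ) ^ 2 + 20 * δ * (q₀ : ℂ) ^ 6))) t := by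
    have h3 : HasDerivAt (fun y : ℝ => (y : ℂ)) 1 t := Complex.ofRealCLM.hasDerivAt
    simpa using (h3.const_mul (Complex.I * ((q₀ : ℂ) ^ 2 + 20 * δ * (q₀ : ℂ) ^ 6))).cexp
  have h4 := ((hd x t).hasDerivAt.mul h2).deriv
  have h5 := h x t
  change Complex.I * deriv ((fun s => q x s) * E) t + 1 / 2 * (dx 2 (fun x t => q x t * E t) x t +
    2 * (q x t * E t * conj (q x t * E t)) * (q x t * E t)) +
    δ * sexticTerm (fun x t => q x t * E t) x t = 0
  rw [h4, dx_mul, sexticTerm_mul h1, map_mul]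
  linear_combination E t * h5 + q x t ^ 2 * conj (q x t) * E t * h1 +
    E t * ((q₀ : ℂ) ^ 2 + 20 * δ * (q₀ : ℂ) ^ 6) * q x t * Complex.I_mul_I

end SNLS

/-! ### The main theorem -/

theorem mainTheorem6 {N : ℕ} (D : SNLS.DiscreteData N) (δ : ℝ) :
    -- the linear system is nondegenerate for all `x`, `t`
    (∀ x t : ℝ, (D.M δ x t).det ≠ 0) ∧
    -- every solution of the Riemann–Hilbert problem with `ρ ≡ 0`
    (∀ ρ : ℂ → ℂ, (∀ s ∈ SNLS.contour D.q₀, ρ s = 0) →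
      ∀ (x t : ℝ) (Φ : ℂ → Matrix (Fin 2) (Fin 2) ℂ), SNLS.IsRHPSolution D δ ρ x t Φ →
        (1 + D.A δ x t).mulVec (fun n => Φ (D.xi n) 1 1) = D.B δ x t ∧
        (∀ n, Φ (D.xi n) 1 1 = (D.Mext δ x t n).det / (D.M δ x t).det) ∧
        Filter.Tendsto (fun z => z * Φ z 1 0)
          (Bornology.cobounded ℂ ⊓ Filter.principal (SNLS.contour D.q₀)ᶜ)
          (nhds (D.qm - (D.Maug δ x t).det / (D.M δ x t).det))) ∧
    -- the potential is a smooth solution of the gauged equation with constant boundary values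
    ContDiff ℝ ∞ (fun p : ℝ × ℝ => D.potential δ p.1 p.2) ∧
    SNLS.SolvesGaugedSNLS δ D.q₀ (D.potential δ) ∧
    (∀ t, Filter.Tendsto (fun x => D.potential δ x t) Filter.atBot (nhds D.qm)) ∧
    (∀ t, Filter.Tendsto (fun x => D.potential δ x t) Filter.atTop (nhds D.qp)) ∧
    ‖D.qp‖ = D.q₀ ∧
    -- undoing the gauge gives a solution of the original equation with the original boundary values
    (∃ u : ℝ → ℝ → ℂ,
      (∀ x t, u x t = D.potential δ x t *
        Complex.exp (Complex.I * ((D.q₀ : ℂ) ^ 2 + 20 * δ * (D.q₀ : ℂ) ^ 6) * t)) ∧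
      SNLS.SolvesSNLS δ u ∧
      (∀ t, Filter.Tendsto (fun x => u x t) Filter.atBot (nhds (D.qm *
        Complex.exp (Complex.I * ((D.q₀ : ℂ) ^ 2 + 20 * δ * (D.q₀ : ℂ) ^ 6) * t)))) ∧
      (∀ t, Filter.Tendsto (fun x => u x t) Filter.atTop (nhds (D.qp *
        Complex.exp (Complex.I * ((D.q₀ : ℂ) ^ 2 + 20 * δ * (D.q₀ : ℂ) ^ 6) * t))))) ∧
    -- the potential is reflectionless with the prescribed discrete data; its Jost functions give the
    -- solution of the Riemann–Hilbert problem, and their values solve the linear system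
    (∃ (μm μp : ℝ → ℝ → ℂ → Matrix (Fin 2) (Fin 2) ℂ) (S : ℂ → Matrix (Fin 2) (Fin 2) ℂ),
      SNLS.IsReflectionless D δ (D.potential δ) μm μp S ∧
      (∀ x t, SNLS.IsRHPSolution D δ (SNLS.reflection S) x t
        (SNLS.assembled D.q₀ μm μp S x t)) ∧
      (∀ x t, (1 + D.A δ x t).mulVec (fun n => μm x t (D.xi n) 1 1) = D.B δ x t)) := by
  refine ⟨D.det_M_ne_zero δ, fun ρ hρ x t Φ h => ⟨h.mulVec_eq hρ, fun n => ?_, ?_⟩,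
    D.contDiff_potential δ, D.solvesGaugedSNLS δ, D.tendsto_potential_atBot δ,
    D.tendsto_potential_atTop δ, D.norm_qp, ⟨_, fun _ _ => rfl, ?_, fun t => ?_, fun t => ?_⟩,
    D.muMinus δ, D.muPlus δ, D.scat, D.isReflectionless δ, D.isRHPSolution_assembled δ,
    D.mulVec_muMinus δ⟩
  · exact congrFun (D.eq_X_of_mulVec_eq δ x t (h.mulVec_eq hρ)) n
  · exact h.tendsto_potential hρ
  · exact (D.solvesGaugedSNLS δ).solvesSNLS fun x t =>
      (D.hasDerivAt_potential_t δ x t).differentiableAt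
  · exact (D.tendsto_potential_atBot δ t).mul_const _
  · exact (D.tendsto_potential_atTop δ t).mul_const _
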